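/- Let $(M,g)$ be an oriented smooth four-dimensional space-time of signature $(-,+,+,+)$, with metric volume element $\eta$, Levi-Civita connection $\nabla$ and Hodge operator $*$, and suppose that $(M,g)$ is non-conformally-flat in the sense that its Weyl tensor $W$ vanishes at no point. Let a $2+2$ structure be given by its canonical $2$-form $U$, a smooth $2$-form that is at each point the volume element of a time-like plane $V$, with space-like orthogonal complement $H$. For $2$-tensors write $(A\cdot B)_{\alpha\beta}=A_\alpha{}^{\mu}B_{\mu\beta}$, $\{A,B\}=A\cdot B+B\cdot A$ and $A(x)_\mu=A_{\mu\nu}x^\nu$; let $v=U\cdot U$ and $h=g-v$ be the projectors on $V$ and $H$. Suppose that the structure is umbilical: the symmetric part $S_v$ of $Q_v(x,y)=h(\nabla_{v(x)}v(y))$ satisfies $S_v=\tfrac12\,v\otimes\operatorname{tr}S_v$, and the same holds with $v$ and $h$ interchanged. Let $\mathcal U=\frac1{\sqrt2}(U-\mathrm i*U)$ be the canonical self-dual bivector, $\delta=*d*$ the codifferential (on $2$-forms $(\delta F)_\beta=-\nabla^\alpha F_{\alpha\beta}$), and $$\Phi=*U(\delta *U)-U(\delta U),\qquad \Psi=*U(\delta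 U)+U(\delta *U),\qquad \chi=i_{\xi}\,\mathcal U,\quad \xi=\delta\,\mathcal U .$$ (Here $\chi=\tfrac12(\Phi+\mathrm i\Psi)$.) The space-time is of Petrov-Bel type D if at every point the self-dual Weyl tensor $\mathcal W=\frac12(W-\mathrm i*W)$, as an endomorphism of the three-dimensional complex space of self-dual bivectors ($*\mathcal F=\mathrm i\mathcal F$), is diagonalizable with a double eigenvalue $\rho\neq0$ and a simple eigenvalue $-2\rho$; the structure is then the principal one if at every point $\mathcal U$ is an eigenbivector for the simple eigenvalue. Consider the four conditions, each required on all of $M$: 1. the space-time is of Petrov-Bel type D; 2. $d\Phi=0$ (the structure is pre-Maxwellian); 3. $d\Psi=0$; 4. $\{d\chi,\mathcal U\}=0$. Then the structure is Maxwellian, i.e. $d\chi=0$ on $M$, if and only if at least two of the conditions 1--4 hold; and if two of them hold, then all four hold. Moreover, under the above hypotheses, condition 1 holds if and only if the space-time is of type D and the structure is the principal one, and condition 4 holds if and only if $d\Phi=*d\Psi$. -/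

import Mathlib

open scoped Manifold ContDiff

noncomputable section

namespace Umbilic

/-- The model space of a four-dimensional manifold. -/
abbrev E4 : Type := EuclideanSpace ℝ (Fin 4)

/-- The model with corners of a four-dimensional manifold without boundary. -/
abbrev I4 : ModelWithCorners ℝ E4 E4 := 𝓘(ℝ, E4)

/-- Components of a tensor with four (lower) indices. -/
abbrev Tensor4 (𝕜 : Type) : Type := Fin 4 → Fin 4 → Fin 4 → Fin 4 → 𝕜

/-- Components of a tensor with two (lower) indices. -/
abbrev Tensor2 (𝕜 : Type) : Type := Matrix (Fin 4) (Fin 4) 𝕜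

/-! ### Algebra at a point, in components

`g` is the matrix of the metric at the point; indices are raised with `g⁻¹`. -/

section Pointwise

variable {𝕜 : Type} [RCLike 𝕜]

/-- `A · B`, with components `A_{aμ} g^{μν} B_{νb}`. -/
def dot (g : Tensor2 ℝ) (A B : Tensor2 𝕜) : Tensor2 𝕜 :=
  A * (g⁻¹).map (fun r : ℝ => (r : 𝕜)) * B

/-- The anti-commutator `{A, B} = A · B + B · A`. -/
def anticomm (g : Tensor2 ℝ) (A B : Tensor2 𝕜) : Tensor2 𝕜 :=
  dot g A B + dot g B A

/-- `A(θ)_a = A_{ab} g^{bc} θ_c`. -/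
def contractRight (g : Tensor2 ℝ) (A : Tensor2 𝕜) (θ : Fin 4 → 𝕜) : Fin 4 → 𝕜 :=
  fun a => ∑ b, ∑ c, A a b * ((g⁻¹ b c : ℝ) : 𝕜) * θ c

/-- The interior product `(i_θ A)_b = θ_c g^{ca} A_{ab}`. -/
def contractLeft (g : Tensor2 ℝ) (θ : Fin 4 → 𝕜) (A : Tensor2 𝕜) : Fin 4 → 𝕜 :=
  fun b => ∑ a, ∑ c, θ c * ((g⁻¹ c a : ℝ) : 𝕜) * A a b

/-- The action of a double 2-form on a 2-form:
`P(F)_{ab} = ½ P_{ab}{}^{mn} F_{mn}`. -/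
def act (g : Tensor2 ℝ) (P : Tensor4 𝕜) : Tensor2 𝕜 →ₗ[𝕜] Tensor2 𝕜 where
  toFun F := Matrix.of fun a b =>
    (1 / 2) * ∑ m, ∑ n, ∑ k, ∑ l,
      P a b m n * ((g⁻¹ m k : ℝ) : 𝕜) * ((g⁻¹ n l : ℝ) : 𝕜) * F k l
  map_add' F H := by
    ext a b
    simp [mul_add, Finset.sum_add_distrib]
  map_smul' r F := by
    ext a b
    simp only [Matrix.of_apply, Matrix.smul_apply, smul_eq_mul, RingHom.id_apply,
      Finset.mul_sum]
    refine Finset.sum_congr rfl fun m _ => Finset.sum_congr rfl fun n _ =>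
      Finset.sum_congr rfl fun k _ => Finset.sum_congr rfl fun l _ => ?_
    ring

/-- Composition of double 2-forms: `(P ∘ Q)_{abcd} = ½ P_{ab}{}^{mn} Q_{mncd}`. -/
def comp (g : Tensor2 ℝ) (P Q : Tensor4 𝕜) : Tensor4 𝕜 := fun a b c d =>
  (1 / 2) * ∑ m, ∑ n, ∑ k, ∑ l,
    P a b m n * ((g⁻¹ m k : ℝ) : 𝕜) * ((g⁻¹ n l : ℝ) : 𝕜) * Q k l c d

/-- The Hodge dual `(*F)_{ab} = ½ η_{ab}{}^{mn} F_{mn}` of a 2-form, `η` being the metric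
volume element. -/
def hodge (g : Tensor2 ℝ) (η : Tensor4 ℝ) : Tensor2 𝕜 →ₗ[𝕜] Tensor2 𝕜 :=
  act g (fun a b c d => ((η a b c d : ℝ) : 𝕜))

/-- The self-dual 2-form `(F - i *F) / √2` associated with a real 2-form `F`. -/
def selfDualPart (g : Tensor2 ℝ) (η : Tensor4 ℝ) (F : Tensor2 ℝ) : Tensor2 ℂ :=
  ((1 / Real.sqrt 2 : ℝ) : ℂ) •
    (F.map Complex.ofReal - Complex.I • (hodge g η F).map Complex.ofReal)

/-- The complex space of SD bivectors: the complex 2-forms with `*F = i F`. -/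
def sdBivectors (g : Tensor2 ℝ) (η : Tensor4 ℝ) : Submodule ℂ (Tensor2 ℂ) where
  carrier := {F | F.transpose = -F ∧ hodge g η F = Complex.I • F}
  zero_mem' := by simp
  add_mem' := by
    rintro F H ⟨hF, hF'⟩ ⟨hH, hH'⟩
    exact ⟨by rw [Matrix.transpose_add, hF, hH, neg_add], by rw [map_add, hF', hH', smul_add]⟩
  smul_mem' := by
    rintro c F ⟨hF, hF'⟩
    exact ⟨by rw [Matrix.transpose_smul, hF, smul_neg], by rw [map_smul, hF', smul_comm]⟩

end Pointwise

/-! ### Tensor calculus in a coordinate domain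

`G` is the matrix of components of the metric as a function of the coordinates. -/

section Calculus

/-- The partial derivative `∂_i f`. -/
def pd {V : Type} [NormedAddCommGroup V] [NormedSpace ℝ V] (f : E4 → V) (x : E4) (i : Fin 4) : V :=
  fderiv ℝ f x (EuclideanSpace.single i 1)

/-- The Christoffel symbols `Γ^k_{ij}` of the Levi-Civita connection. -/
def christoffel (G : E4 → Tensor2 ℝ) (x : E4) (k i j : Fin 4) : ℝ :=
  (1 / 2) * ∑ l, (G x)⁻¹ k l *
    (pd (fun y => G y l j) x i + pd (fun y => G y l i) x j - pd (fun y => G y i j) x l)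

/-- `R^a_{bcd} = ∂_c Γ^a_{db} - ∂_d Γ^a_{cb} + Γ^a_{ce} Γ^e_{db} - Γ^a_{de} Γ^e_{cb}`. -/
def riemannUp (G : E4 → Tensor2 ℝ) (x : E4) : Tensor4 ℝ := fun a b c d =>
  pd (fun y => christoffel G y a d b) x c - pd (fun y => christoffel G y a c b) x d
    + ∑ e, (christoffel G x a c e * christoffel G x e d b
      - christoffel G x a d e * christoffel G x e c b)

/-- The Riemann tensor `R_{abcd}`. -/
def riemann (G : E4 → Tensor2 ℝ) (x : E4) : Tensor4 ℝ := fun a b c d =>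
  ∑ e, G x a e * riemannUp G x e b c d

/-- The Ricci tensor `R_{bd} = R^a_{bad}`. -/
def ricci (G : E4 → Tensor2 ℝ) (x : E4) : Tensor2 ℝ :=
  Matrix.of fun b d => ∑ a, riemannUp G x a b a d

/-- The scalar curvature. -/
def scalarCurvature (G : E4 → Tensor2 ℝ) (x : E4) : ℝ :=
  ∑ a, ∑ b, (G x)⁻¹ a b * ricci G x a b

/-- The Weyl tensor of a four-dimensional metric. -/
def weyl (G : E4 → Tensor2 ℝ) (x : E4) : Tensor4 ℝ := fun a b c d =>
  riemann G x a b c d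
    - (1 / 2) * (G x a c * ricci G x b d + G x b d * ricci G x a c
        - G x a d * ricci G x b c - G x b c * ricci G x a d)
    + (1 / 6) * scalarCurvature G x * (G x a c * G x b d - G x a d * G x b c)

/-- The self-dual Weyl tensor `½ (W - i *W)`, where `*W = η ∘ W`. -/
def sdWeyl (G : E4 → Tensor2 ℝ) (η : E4 → Tensor4 ℝ) (x : E4) : Tensor4 ℂ := fun a b c d =>
  (1 / 2) * ((weyl G x a b c d : ℂ) - Complex.I * ((comp (G x) (η x) (weyl G x) a b c d : ℝ) : ℂ))

/-- The exterior derivative `(dθ)_{ij} = ∂_i θ_j - ∂_j θ_i` of a 1-form. -/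
def extD {𝕜 : Type} [RCLike 𝕜] (θ : E4 → Fin 4 → 𝕜) (x : E4) : Tensor2 𝕜 :=
  Matrix.of fun i j => pd (fun y => θ y j) x i - pd (fun y => θ y i) x j

/-- The covariant derivative `∇_m F_{ab}`. -/
def covDeriv {𝕜 : Type} [RCLike 𝕜] (G : E4 → Tensor2 ℝ) (F : E4 → Tensor2 𝕜) (x : E4)
    (m a b : Fin 4) : 𝕜 :=
  pd (fun y => F y a b) x m
    - ∑ k, ((christoffel G x k m a : ℝ) : 𝕜) * F x k b
    - ∑ k, ((christoffel G x k m b : ℝ) : 𝕜) * F x a k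

/-- The codifferential `δ = *d*` of a 2-form, in components `(δF)_b = -∇^a F_{ab}`. -/
def codiff {𝕜 : Type} [RCLike 𝕜] (G : E4 → Tensor2 ℝ) (F : E4 → Tensor2 𝕜) (x : E4) :
    Fin 4 → 𝕜 :=
  fun b => -∑ a, ∑ c, (((G x)⁻¹ a c : ℝ) : 𝕜) * covDeriv G F x a c b

/-! ### The second fundamental forms of a non-null plane -/

/-- The generalized second fundamental form `Q_v(x, y) = h(∇_{v(x)} v(y))` of the plane with
projector `v`, where `h = g - v`; the first index is the (lowered) value, the other two are
the arguments: `Q_{cab} = h_c{}^d v_a{}^m ∇_m v_{db}`. -/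
def secondForm (G v : E4 → Tensor2 ℝ) (x : E4) (c a b : Fin 4) : ℝ :=
  ∑ k, ∑ d, ∑ e, ∑ m, (G x - v x) c k * (G x)⁻¹ k d * v x a e * (G x)⁻¹ e m * covDeriv G v x m d b

/-- The symmetric part `S_v` of `Q_v`. -/
def secondFormSymm (G v : E4 → Tensor2 ℝ) (x : E4) (c a b : Fin 4) : ℝ :=
  (1 / 2) * (secondForm G v x c a b + secondForm G v x c b a)

/-- The two-dimensional plane with projector `v` is umbilical at `x`: the traceless part of `S_v`
vanishes, that is, `S_v = ½ v ⊗ tr S_v`. -/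
def PlaneUmbilicalAt (G v : E4 → Tensor2 ℝ) (x : E4) : Prop :=
  ∀ c a b, secondFormSymm G v x c a b =
    (1 / 2) * v x a b * ∑ m, ∑ n, (G x)⁻¹ m n * secondFormSymm G v x c m n

/-- The projector `v = U²` on the time-like plane of a 2+2 structure. -/
def projV (G U : E4 → Tensor2 ℝ) (x : E4) : Tensor2 ℝ := dot (G x) (U x) (U x)

/-- The projector `h = g - v` on the space-like plane of a 2+2 structure. -/
def projH (G U : E4 → Tensor2 ℝ) (x : E4) : Tensor2 ℝ := G x - projV G U x

/-- The 2+2 structure is umbilical at `x`: both of its planes are. -/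
def UmbilicalAt (G U : E4 → Tensor2 ℝ) (x : E4) : Prop :=
  PlaneUmbilicalAt G (projV G U) x ∧ PlaneUmbilicalAt G (projH G U) x

/-! ### First-order concomitants of a 2+2 structure -/

/-- The dual `*U`, as a field. -/
def starU (G : E4 → Tensor2 ℝ) (η : E4 → Tensor4 ℝ) (U : E4 → Tensor2 ℝ) (x : E4) : Tensor2 ℝ :=
  hodge (G x) (η x) (U x)

/-- The canonical SD bivector `𝒰 = (U - i *U) / √2`, as a field. -/
def sdU (G : E4 → Tensor2 ℝ) (η : E4 → Tensor4 ℝ) (U : E4 → Tensor2 ℝ) (x : E4) : Tensor2 ℂ :=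
  selfDualPart (G x) (η x) (U x)

/-- The expansion 1-form `Φ = *U(δ*U) - U(δU)`. -/
def expansion (G : E4 → Tensor2 ℝ) (η : E4 → Tensor4 ℝ) (U : E4 → Tensor2 ℝ) (x : E4) :
    Fin 4 → ℝ :=
  contractRight (G x) (starU G η U x) (codiff G (starU G η U) x)
    - contractRight (G x) (U x) (codiff G U x)

/-- The rotation 1-form `Ψ = *U(δU) + U(δ*U)`. -/
def rotation (G : E4 → Tensor2 ℝ) (η : E4 → Tensor4 ℝ) (U : E4 → Tensor2 ℝ) (x : E4) :
    Fin 4 → ℝ :=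
  contractRight (G x) (starU G η U x) (codiff G U x)
    + contractRight (G x) (U x) (codiff G (starU G η U) x)

/-- The complex 1-form `χ = i_ξ 𝒰`, `ξ = δ𝒰`. -/
def chi (G : E4 → Tensor2 ℝ) (η : E4 → Tensor4 ℝ) (U : E4 → Tensor2 ℝ) (x : E4) : Fin 4 → ℂ :=
  contractLeft (G x) (codiff G (sdU G η U) x) (sdU G η U x)

/-! ### Petrov-Bel type D -/

/-- The `r`-eigenspace of the self-dual Weyl tensor on the space of SD bivectors at `x`. -/
def weylEigenspace (G : E4 → Tensor2 ℝ) (η : E4 → Tensor4 ℝ) (x : E4) (r : ℂ) :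
    Submodule ℂ (Tensor2 ℂ) :=
  sdBivectors (G x) (η x) ⊓ Module.End.eigenspace (act (G x) (sdWeyl G η x)) r

/-- Type D with double eigenvalue `r`: on the three-dimensional space of SD bivectors, the
self-dual Weyl tensor has the double eigenvalue `r ≠ 0` and the simple eigenvalue `-2 r`, and it is
diagonalizable (its minimal polynomial has degree two). -/
def TypeDWith (G : E4 → Tensor2 ℝ) (η : E4 → Tensor4 ℝ) (x : E4) (r : ℂ) : Prop :=
  r ≠ 0 ∧ Module.finrank ℂ (weylEigenspace G η x r) = 2 ∧
    Module.finrank ℂ (weylEigenspace G η x (-2 * r)) = 1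

/-- The Weyl tensor is of Petrov-Bel type D at `x`. -/
def TypeDAt (G : E4 → Tensor2 ℝ) (η : E4 → Tensor4 ℝ) (x : E4) : Prop :=
  ∃ r, TypeDWith G η x r

/-- The Weyl tensor is of type D at `x` and the structure `U` is its principal one: `𝒰` is
the principal SD bivector, the eigenbivector of the simple eigenvalue. -/
def TypeDPrincipalAt (G : E4 → Tensor2 ℝ) (η : E4 → Tensor4 ℝ) (U : E4 → Tensor2 ℝ) (x : E4) :
    Prop :=
  ∃ r, TypeDWith G η x r ∧ sdU G η U x ∈ weylEigenspace G η x (-2 * r)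

end Calculus

/-! ### Space-times and 2+2 structures -/

section Manifold

variable {M : Type*} [TopologicalSpace M] [ChartedSpace E4 M]

/-- The coordinate vector `∂_i` of the chart `e` at the point with coordinates `x`. -/
def coordVec (e : OpenPartialHomeomorph M E4) (x : E4) (i : Fin 4) :
    TangentSpace I4 (e.symm x) :=
  mfderiv I4 I4 e.symm x (EuclideanSpace.single i 1 : E4)

/-- A basis of a four-dimensional space is an orthonormal frame of signature `(-,+,+,+)`. -/
def IsLorentzFrame {V : Type*} [AddCommGroup V] [Module ℝ V] (g : LinearMap.BilinForm ℝ V)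
    (b : Module.Basis (Fin 4) ℝ V) : Prop :=
  ∀ i j, g (b i) (b j) = Matrix.diagonal ![-1, 1, 1, 1] i j

variable (M) in
/-- An oriented space-time: a smooth metric of signature `(-,+,+,+)` and a smooth
metric volume element (the choice of one is the choice of an orientation). -/
structure OrientedSpacetime where
  metric : ∀ p : M, LinearMap.BilinForm ℝ (TangentSpace I4 p)
  exists_frame : ∀ p, ∃ b, IsLorentzFrame (metric p) b
  smooth_metric : ∀ e ∈ atlas E4 M, ∀ i j, ContDiffOn ℝ ∞
    (fun x => metric (e.symm x) (coordVec e x i) (coordVec e x j)) e.target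
  vol : ∀ p : M, (TangentSpace I4 p) [⋀^Fin 4]→ₗ[ℝ] ℝ
  vol_frame : ∀ p b, IsLorentzFrame (metric p) b → vol p b = 1 ∨ vol p b = -1
  smooth_vol : ∀ e ∈ atlas E4 M, ∀ i j k l, ContDiffOn ℝ ∞
    (fun x => vol (e.symm x) ![coordVec e x i, coordVec e x j, coordVec e x k, coordVec e x l])
    e.target

/-- A 2+2 structure, given by its canonical 2-form `U`: the volume element
`θ⁰ ∧ θ¹` of a time-like plane, for the dual basis `θ` of an orthonormal frame whose first two
vectors span the plane. -/
structure Structure22 (S : OrientedSpacetime M) where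
  form : ∀ p : M, LinearMap.BilinForm ℝ (TangentSpace I4 p)
  exists_frame : ∀ p, ∃ b, IsLorentzFrame (S.metric p) b ∧
    ∀ v w, form p v w = b.repr v 0 * b.repr w 1 - b.repr v 1 * b.repr w 0
  smooth_form : ∀ e ∈ atlas E4 M, ∀ i j, ContDiffOn ℝ ∞
    (fun x => form (e.symm x) (coordVec e x i) (coordVec e x j)) e.target

namespace OrientedSpacetime

variable (S : OrientedSpacetime M)

/-- Components of the metric in a chart. -/
def G (e : OpenPartialHomeomorph M E4) (x : E4) : Tensor2 ℝ :=
  Matrix.of fun i j => S.metric (e.symm x) (coordVec e x i) (coordVec e x j)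

/-- Components of the metric volume element in a chart. -/
def η (e : OpenPartialHomeomorph M E4) (x : E4) : Tensor4 ℝ := fun i j k l =>
  S.vol (e.symm x) ![coordVec e x i, coordVec e x j, coordVec e x k, coordVec e x l]

/-- The Weyl tensor vanishes at no point. -/
def NonConformallyFlat : Prop :=
  ∀ e ∈ atlas E4 M, ∀ x ∈ e.target, weyl (S.G e) x ≠ 0

/-- The space-time is of Petrov-Bel type D (at every point). -/
def TypeD : Prop :=
  ∀ e ∈ atlas E4 M, ∀ x ∈ e.target, TypeDAt (S.G e) (S.η e) x

end OrientedSpacetime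

namespace Structure22

variable {S : OrientedSpacetime M} (U : Structure22 S)

/-- Components of the canonical 2-form in a chart. -/
def comps (e : OpenPartialHomeomorph M E4) (x : E4) : Tensor2 ℝ :=
  Matrix.of fun i j => U.form (e.symm x) (coordVec e x i) (coordVec e x j)

/-- Both planes of the structure are umbilical. -/
def Umbilical : Prop :=
  ∀ e ∈ atlas E4 M, ∀ x ∈ e.target, UmbilicalAt (S.G e) (U.comps e) x

/-- The space-time is of type D and the structure is the principal one. -/
def TypeDPrincipal : Prop :=
  ∀ e ∈ atlas E4 M, ∀ x ∈ e.target, TypeDPrincipalAt (S.G e) (S.η e) (U.comps e) x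

/-- `dχ = 0`. -/
def Maxwellian : Prop :=
  ∀ e ∈ atlas E4 M, ∀ x ∈ e.target, extD (chi (S.G e) (S.η e) (U.comps e)) x = 0

/-- `dΦ = 0`. -/
def PreMaxwellian : Prop :=
  ∀ e ∈ atlas E4 M, ∀ x ∈ e.target, extD (expansion (S.G e) (S.η e) (U.comps e)) x = 0

/-- `dΨ = 0`. -/
def RotationClosed : Prop :=
  ∀ e ∈ atlas E4 M, ∀ x ∈ e.target, extD (rotation (S.G e) (S.η e) (U.comps e)) x = 0

/-- `{dχ, 𝒰} = 0`. -/
def AnticommVanishes : Prop :=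
  ∀ e ∈ atlas E4 M, ∀ x ∈ e.target,
    anticomm (S.G e x) (extD (chi (S.G e) (S.η e) (U.comps e)) x)
      (sdU (S.G e) (S.η e) (U.comps e) x) = 0

/-- `dΦ = *dΨ`. -/
def ExpansionDualRotation : Prop :=
  ∀ e ∈ atlas E4 M, ∀ x ∈ e.target,
    extD (expansion (S.G e) (S.η e) (U.comps e)) x =
      hodge (S.G e x) (S.η e x) (extD (rotation (S.G e) (S.η e) (U.comps e)) x)

/-- The four conditions: type D, `dΦ = 0`, `dΨ = 0`, `{dχ, 𝒰} = 0`. -/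
def conditions : Fin 4 → Prop :=
  ![S.TypeD, U.PreMaxwellian, U.RotationClosed, U.AnticommVanishes]

end Structure22

end Manifold

end Umbilic

end

noncomputable section

/-! ### Adapted frames, the Levi-Civita symbol and the Hodge dual -/

namespace Umbilic
open Matrix

/-! At each point an oriented orthonormal frame adapted to the structure gives a basis e 0 = 𝒰, e 1,
e 2 of the SD bivectors that obeys rescaled quaternion relations (`SDTriple`). Umbilicity of both
planes forces ∇𝒰 to be determined by its divergence (`covMat_sdU`): ∇_m 𝒰 = χ_m 𝒰 + ½ (ξ ∧ g_m − i
*(ξ ∧ g_m)).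

This formula is inserted in the Ricci identity for 𝒰. Pairing with e 1 and e 2 expresses the
curvature, as a matrix on SD bivectors, through ξ and ∇ξ; the SD components of dχ are traces of ∇ξ
of the same kind. Eliminating ∇ξ (`weylForm_umbilical`) shows that the Weyl matrix w, a symmetric
trace-free complex 3×3 matrix, satisfies w 1 2 = 0 and w 1 1 = w 2 2, that dχ has no component along
𝒰, and that its two other SD components are nonzero multiples of w 0 2 and w 0 1.

Type D is therefore equivalent to w 0 1 = w 0 2 = 0. If these vanish, w = diag(−2a, a, a), where a ≠
0 because the real tensor W is nonzero and is determined by w (`eq_zero_of_weylForm`); moreover 𝒰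
spans the simple eigenspace. Conversely a two-dimensional eigenspace forces them to vanish
(`eq_zero_of_finrank_coordEigenspace`). So condition 1 says that the SD part of dχ is zero, that is,
dΦ = −*dΨ.

SD bivectors orthogonal to 𝒰 anticommute with it, whereas anti-self-dual ones commute with it, and 𝒰
is invertible. As dχ has no component along 𝒰, condition 4 says that the anti-self-dual part of dχ
is zero, that is, dΦ = *dΨ. The four conditions have become the relations dΦ = −*dΨ, dΦ = 0, dΨ = 0,
dΦ = *dΨ; since ** = −1 on 2-forms, any two of them give dΦ = dΨ = 0, which in turn implies all
four.

The calculus takes place in a chart, on matrices of components of g, η and U. Adapted frames are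
used only pointwise, for algebra, so no smooth frame field is ever required. -/

/-- The Levi-Civita symbol on four indices. -/
def eps (a b c d : Fin 4) : ℝ :=
  (((b : ℕ) : ℝ) - (a : ℕ)) * (((c : ℕ) : ℝ) - (a : ℕ)) * (((d : ℕ) : ℝ) - (a : ℕ)) *
    (((c : ℕ) : ℝ) - (b : ℕ)) * (((d : ℕ) : ℝ) - (b : ℕ)) * (((d : ℕ) : ℝ) - (c : ℕ)) / 12

/-- The Minkowski metric in an orthonormal frame. -/
def mink : Tensor2 ℝ := !![-1, 0, 0, 0; 0, 1, 0, 0; 0, 0, 1, 0; 0, 0, 0, 1]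

/-- The canonical 2-form `θ⁰ ∧ θ¹` in an adapted frame. -/
def stdForm : Tensor2 ℝ := !![0, 1, 0, 0; -1, 0, 0, 0; 0, 0, 0, 0; 0, 0, 0, 0]

/-- The rows of `Q` are the components of the dual basis of an oriented orthonormal frame adapted
to the plane with volume element `U`. -/
structure IsAdapted (Q g : Tensor2 ℝ) (η : Tensor4 ℝ) (U : Tensor2 ℝ) : Prop where
  det_ne : IsUnit Q.det
  metric : g = Qᵀ * mink * Q
  form : U = Qᵀ * stdForm * Q
  vol : ∀ a b c d, η a b c d = (Q.submatrix id ![a, b, c, d]).det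

theorem mink_mul_mink : mink * mink = 1 := by
  ext i j; fin_cases i <;> fin_cases j <;> simp [mink, Matrix.mul_apply, Fin.sum_univ_four]

theorem mink_inv : mink⁻¹ = mink := Matrix.inv_eq_left_inv mink_mul_mink

theorem mink_transpose : minkᵀ = mink := by
  ext i j; fin_cases i <;> fin_cases j <;> simp [mink]

/-- The symbol is a Vandermonde product, normalised by 12 = 1·2·3·1·2·1, its unnormalised value at
(0, 1, 2, 3). Numerical evaluation leaves the 24 signed permutations. -/
theorem sum_eps_mul {R : Type} [Field R] [CharZero R] [Algebra ℝ R] (f : Fin 4 → Fin 4 → Fin 4 → Fin 4 → R) :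
    ∑ a, ∑ b, ∑ c, ∑ d, algebraMap ℝ R (eps a b c d) * f a b c d =
      f 0 1 2 3 - f 0 1 3 2 - f 0 2 1 3 + f 0 2 3 1 + f 0 3 1 2 - f 0 3 2 1 - f 1 0 2 3 + f 1 0 3 2 + f 1 2 0 3 - f 1 2 3 0 - f 1 3 0 2 + f 1 3 2 0 + f 2 0 1 3 - f 2 0 3 1 - f 2 1 0 3 + f 2 1 3 0 + f 2 3 0 1 - f 2 3 1 0 - f 3 0 1 2 + f 3 0 2 1 + f 3 1 0 2 - f 3 1 2 0 - f 3 2 0 1 + f 3 2 1 0 := by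
  simp only [Fin.sum_univ_four, eps]
  norm_num
  ring

theorem det_submatrix_eq_sum (Q : Tensor2 ℝ) (a b c d : Fin 4) :
    (Q.submatrix id ![a, b, c, d]).det =
      ∑ A, ∑ B, ∑ C, ∑ D, eps A B C D * (Q A a * Q B b * Q C c * Q D d) := by
  have := sum_eps_mul (fun A B C D => Q A a * Q B b * Q C c * Q D d)
  simp only [Algebra.algebraMap_self, RingHom.id_apply] at this
  rw [this, Matrix.det_succ_row_zero]
  simp [Matrix.det_fin_three, Fin.sum_univ_four, Fin.succAbove]
  ring

/-- Selecting columns of `Q` is right multiplication by the same selection of columns of the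
identity, whose determinant is the symbol. -/
theorem det_submatrix_eq (Q : Tensor2 ℝ) (a b c d : Fin 4) :
    (Q.submatrix id ![a, b, c, d]).det = Q.det * eps a b c d := by
  have h : Q.submatrix id ![a, b, c, d] =
      Q * (1 : Tensor2 ℝ).submatrix id ![a, b, c, d] := by
    ext i j
    simp [Matrix.mul_apply, Matrix.one_apply]
  rw [h, Matrix.det_mul, det_submatrix_eq_sum]
  congr 1
  simp [Matrix.one_apply]

theorem sum_comm₄ {R : Type} [AddCommMonoid R] (f : Fin 4 → Fin 4 → Fin 4 → Fin 4 → R) :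
    ∑ c, ∑ d, ∑ a, ∑ b, f a b c d = ∑ a, ∑ b, ∑ c, ∑ d, f a b c d := by
  calc ∑ c, ∑ d, ∑ a, ∑ b, f a b c d
      = ∑ c, ∑ a, ∑ d, ∑ b, f a b c d := Finset.sum_congr rfl fun c _ => Finset.sum_comm
    _ = ∑ a, ∑ c, ∑ d, ∑ b, f a b c d := Finset.sum_comm
    _ = ∑ a, ∑ c, ∑ b, ∑ d, f a b c d :=
        Finset.sum_congr rfl fun a _ => Finset.sum_congr rfl fun c _ => Finset.sum_comm
    _ = ∑ a, ∑ b, ∑ c, ∑ d, f a b c d := Finset.sum_congr rfl fun a _ => Finset.sum_comm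

section

variable {𝕜 : Type} [RCLike 𝕜]

variable (𝕜) in
/-- A real matrix, with entries regarded as scalars in `𝕜`. -/
def cast (A : Tensor2 ℝ) : Tensor2 𝕜 := A.map (fun r : ℝ => (r : 𝕜))

@[simp] theorem cast_apply (A : Tensor2 ℝ) (a b : Fin 4) : cast 𝕜 A a b = (A a b : 𝕜) := rfl

theorem cast_mul (A B : Tensor2 ℝ) : cast 𝕜 (A * B) = cast 𝕜 A * cast 𝕜 B := by
  ext i j; simp [Matrix.mul_apply]

theorem cast_transpose (A : Tensor2 ℝ) : cast 𝕜 Aᵀ = (cast 𝕜 A)ᵀ := rfl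

theorem cast_one : cast 𝕜 (1 : Tensor2 ℝ) = 1 := by
  ext i j; simp [Matrix.one_apply, apply_ite]

theorem cast_add (A B : Tensor2 ℝ) : cast 𝕜 (A + B) = cast 𝕜 A + cast 𝕜 B := by
  ext i j; simp

theorem cast_neg (A : Tensor2 ℝ) : cast 𝕜 (-A) = -cast 𝕜 A := by
  ext i j; simp

theorem cast_sub (A B : Tensor2 ℝ) : cast 𝕜 (A - B) = cast 𝕜 A - cast 𝕜 B := by
  ext i j; simp

theorem dot_eq (g : Tensor2 ℝ) (A B : Tensor2 𝕜) : dot g A B = A * cast 𝕜 g⁻¹ * B := rfl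

theorem act_apply (g : Tensor2 ℝ) (P : Tensor4 𝕜) (F : Tensor2 𝕜) (a b : Fin 4) :
    act g P F a b = (1 / 2) * ∑ m, ∑ n, P a b m n * (cast 𝕜 g⁻¹ * F * (cast 𝕜 g⁻¹)ᵀ) m n := by
  simp only [act, LinearMap.coe_mk, AddHom.coe_mk, Matrix.of_apply]
  congr 1
  refine Finset.sum_congr rfl fun m _ => Finset.sum_congr rfl fun n _ => ?_
  simp only [Matrix.mul_apply, Finset.sum_mul, Finset.mul_sum, cast_apply, Matrix.transpose_apply]
  rw [Finset.sum_comm]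
  refine Finset.sum_congr rfl fun k _ => Finset.sum_congr rfl fun l _ => ?_
  ring

theorem sum_mul_eq_trace (A B : Tensor2 𝕜) : ∑ m, ∑ n, A m n * B m n = (A * Bᵀ).trace := by
  simp [Matrix.trace, Matrix.mul_apply]

namespace IsAdapted

variable {Q g U : Tensor2 ℝ} {η : Tensor4 ℝ}

theorem inv_mul (h : IsAdapted Q g η U) : Q⁻¹ * Q = 1 := Matrix.nonsing_inv_mul _ h.det_ne

theorem mul_inv (h : IsAdapted Q g η U) : Q * Q⁻¹ = 1 := Matrix.mul_nonsing_inv _ h.det_ne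

theorem inv_transpose_mul (h : IsAdapted Q g η U) : Q⁻¹ᵀ * Qᵀ = 1 := by
  rw [← Matrix.transpose_mul, h.mul_inv, Matrix.transpose_one]

theorem inv_metric (h : IsAdapted Q g η U) : g⁻¹ = Q⁻¹ * mink * Q⁻¹ᵀ := by
  apply Matrix.inv_eq_left_inv
  rw [h.metric]
  calc Q⁻¹ * mink * Q⁻¹ᵀ * (Qᵀ * mink * Q) = Q⁻¹ * mink * (Q⁻¹ᵀ * Qᵀ) * mink * Q := by
        simp only [Matrix.mul_assoc]
    _ = 1 := by
        rw [h.inv_transpose_mul, Matrix.mul_one, Matrix.mul_assoc Q⁻¹, mink_mul_mink,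
          Matrix.mul_one, h.inv_mul]

theorem metric_transpose (h : IsAdapted Q g η U) : gᵀ = g := by
  rw [h.metric]; simp [Matrix.transpose_mul, mink_transpose, Matrix.mul_assoc]

theorem inv_metric_transpose (h : IsAdapted Q g η U) : g⁻¹ᵀ = g⁻¹ := by
  rw [Matrix.transpose_nonsing_inv, h.metric_transpose]

theorem det_metric (h : IsAdapted Q g η U) : g.det = -(Q.det) ^ 2 := by
  rw [h.metric, Matrix.det_mul, Matrix.det_mul, Matrix.det_transpose]
  have : mink.det = -1 := by
    simp [mink, Matrix.det_succ_row_zero, Fin.sum_univ_succ]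
  rw [this]; ring

theorem isUnit_metric (h : IsAdapted Q g η U) : IsUnit g.det := by
  rw [h.det_metric]
  have := h.det_ne.ne_zero
  exact isUnit_iff_ne_zero.mpr (neg_ne_zero.mpr (pow_ne_zero _ this))

theorem inv_mul_metric (h : IsAdapted Q g η U) : g⁻¹ * g = 1 :=
  Matrix.nonsing_inv_mul _ h.isUnit_metric

theorem vol_eq (h : IsAdapted Q g η U) (a b c d : Fin 4) : η a b c d = Q.det * eps a b c d := by
  rw [h.vol, det_submatrix_eq]

theorem cast_inv_mul (h : IsAdapted Q g η U) : cast 𝕜 Q⁻¹ * cast 𝕜 Q = 1 := by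
  rw [← cast_mul, h.inv_mul, cast_one]

theorem cast_mul_inv (h : IsAdapted Q g η U) : cast 𝕜 Q * cast 𝕜 Q⁻¹ = 1 := by
  rw [← cast_mul, h.mul_inv, cast_one]

/-- Since `g⁻¹` is `mink` transported by `Q⁻¹`, the inner factors cancel: covariant transport by `Q`
becomes contravariant transport by `Q⁻¹`. -/
theorem raise (h : IsAdapted Q g η U) (F : Tensor2 𝕜) :
    cast 𝕜 g⁻¹ * ((cast 𝕜 Q)ᵀ * F * cast 𝕜 Q) * (cast 𝕜 g⁻¹)ᵀ =
      cast 𝕜 Q⁻¹ * (cast 𝕜 mink * F * cast 𝕜 mink) * (cast 𝕜 Q⁻¹)ᵀ := by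
  have h1 : (cast 𝕜 Q⁻¹)ᵀ * (cast 𝕜 Q)ᵀ = 1 := by
    rw [← Matrix.transpose_mul, h.cast_mul_inv, Matrix.transpose_one]
  rw [← cast_transpose g⁻¹, h.inv_metric_transpose, h.inv_metric]
  simp only [cast_mul, cast_transpose]
  calc _ = cast 𝕜 Q⁻¹ * cast 𝕜 mink * ((cast 𝕜 Q⁻¹)ᵀ * (cast 𝕜 Q)ᵀ) * F *
        (cast 𝕜 Q * cast 𝕜 Q⁻¹) * cast 𝕜 mink * (cast 𝕜 Q⁻¹)ᵀ := by simp only [Matrix.mul_assoc]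
    _ = _ := by rw [h1, h.cast_mul_inv]; simp only [Matrix.mul_assoc, Matrix.mul_one]

/-- Naturality of the Hodge dual: both the metric and the volume element are pulled back by `Q` from
the standard ones. -/
theorem hodge_conj (h : IsAdapted Q g η U) (F : Tensor2 𝕜) :
    hodge g η ((cast 𝕜 Q)ᵀ * F * cast 𝕜 Q) = (cast 𝕜 Q)ᵀ * hodge mink eps F * cast 𝕜 Q := by
  ext a b
  have hm : (cast 𝕜 mink)ᵀ = cast 𝕜 mink := by rw [← cast_transpose, mink_transpose]
  set Y : Tensor2 𝕜 := cast 𝕜 mink * F * cast 𝕜 mink with hY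
  -- The volume element with its first two slots fixed in coordinates and its last two still in the
  -- frame.
  set E : Tensor2 𝕜 := Matrix.of fun C D => ∑ A, ∑ B, (eps A B C D : 𝕜) *
    ((Q A a : 𝕜) * (Q B b : 𝕜)) with hE
  have hη : ∀ m n, ((η a b m n : ℝ) : 𝕜) = ((cast 𝕜 Q)ᵀ * E * cast 𝕜 Q) m n := by
    intro m n
    rw [h.vol, det_submatrix_eq_sum, ← sum_comm₄]
    simp only [Matrix.mul_apply, hE, Matrix.of_apply, Matrix.transpose_apply, cast_apply,
      Finset.sum_mul, Finset.mul_sum, map_sum, map_mul]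
    rw [Finset.sum_comm]
    refine Finset.sum_congr rfl fun d _ => Finset.sum_congr rfl fun c _ =>
      Finset.sum_congr rfl fun a' _ => Finset.sum_congr rfl fun b' _ => ?_
    ring
  have h1 : (cast 𝕜 Q⁻¹)ᵀ * (cast 𝕜 Q)ᵀ = 1 := by
    rw [← Matrix.transpose_mul, h.cast_mul_inv, Matrix.transpose_one]
  have lhs : hodge g η ((cast 𝕜 Q)ᵀ * F * cast 𝕜 Q) a b =
      (1 / 2) * ∑ C, ∑ D, E C D * Y C D := by
    rw [hodge, act_apply, h.raise, ← hY]
    simp only [hη]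
    rw [sum_mul_eq_trace, sum_mul_eq_trace]
    congr 1
    simp only [Matrix.transpose_mul, Matrix.transpose_transpose]
    calc _ = ((cast 𝕜 Q)ᵀ * (E * ((cast 𝕜 Q * cast 𝕜 Q⁻¹) * (Yᵀ * (cast 𝕜 Q⁻¹)ᵀ)))).trace := by
          simp only [Matrix.mul_assoc]
      _ = (E * (Yᵀ * ((cast 𝕜 Q⁻¹)ᵀ * (cast 𝕜 Q)ᵀ))).trace := by
          rw [h.cast_mul_inv, Matrix.one_mul, Matrix.trace_mul_comm]
          simp only [Matrix.mul_assoc]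
      _ = _ := by rw [h1, Matrix.mul_one]
  rw [lhs]
  simp only [Matrix.mul_apply, Matrix.transpose_apply, hodge, act_apply, mink_inv, hm, hE, Matrix.of_apply, cast_apply, Finset.sum_mul, Finset.mul_sum]
  rw [sum_comm₄, Finset.sum_comm]
  refine Finset.sum_congr rfl fun d _ => Finset.sum_congr rfl fun c _ =>
      Finset.sum_congr rfl fun a' _ => Finset.sum_congr rfl fun b' _ => ?_
  have hY' : (∑ x, (∑ y, (mink a' y : 𝕜) * F y x) * (mink x b' : 𝕜)) = Y a' b' := by
    simp [hY, Matrix.mul_apply]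
  simp only [Finset.sum_mul] at hY'
  rw [← hY']
  simp only [Finset.mul_sum]
  ring_nf

end IsAdapted

theorem eps_values :
    eps 0 1 2 3 = 1 ∧ eps 0 1 3 2 = -1 ∧ eps 0 2 1 3 = -1 ∧ eps 0 2 3 1 = 1 ∧
    eps 0 3 1 2 = 1 ∧ eps 0 3 2 1 = -1 ∧ eps 1 0 2 3 = -1 ∧ eps 1 0 3 2 = 1 ∧
    eps 1 2 0 3 = 1 ∧ eps 1 2 3 0 = -1 ∧ eps 1 3 0 2 = -1 ∧ eps 1 3 2 0 = 1 ∧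
    eps 2 0 1 3 = 1 ∧ eps 2 0 3 1 = -1 ∧ eps 2 1 0 3 = -1 ∧ eps 2 1 3 0 = 1 ∧
    eps 2 3 0 1 = 1 ∧ eps 2 3 1 0 = -1 ∧ eps 3 0 1 2 = -1 ∧ eps 3 0 2 1 = 1 ∧
    eps 3 1 0 2 = 1 ∧ eps 3 1 2 0 = -1 ∧ eps 3 2 0 1 = -1 ∧ eps 3 2 1 0 = 1 := by
  norm_num [eps]

theorem eps_eq_zero (a b c : Fin 4) : eps a a b c = 0 ∧ eps a b a c = 0 ∧ eps a b c a = 0 ∧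
    eps b a a c = 0 ∧ eps b a c a = 0 ∧ eps b c a a = 0 := by
  simp [eps]

/-- Antisymmetry of `F` is not assumed, so both orders of each index pair and the factor 1/2 stay
visible. -/
theorem hodge_mink (F : Tensor2 𝕜) : hodge mink eps F = (1 / 2 : 𝕜) •
    !![0, F 2 3 - F 3 2, F 3 1 - F 1 3, F 1 2 - F 2 1;
      F 3 2 - F 2 3, 0, F 3 0 - F 0 3, F 0 2 - F 2 0;
      F 1 3 - F 3 1, F 0 3 - F 3 0, 0, F 1 0 - F 0 1;
      F 2 1 - F 1 2, F 2 0 - F 0 2, F 0 1 - F 1 0, 0] := by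
  have hF : ∀ m n, (cast 𝕜 mink * F * (cast 𝕜 mink)ᵀ) m n =
      (if m = 0 then -1 else 1) * (if n = 0 then -1 else 1) * F m n := by
    intro m n
    fin_cases m <;> fin_cases n <;>
      simp [Matrix.mul_apply, Fin.sum_univ_four, mink]
  ext a b
  rw [hodge, act_apply, Matrix.smul_apply, smul_eq_mul]
  congr 1
  simp only [mink_inv, hF, Fin.sum_univ_four]
  fin_cases a <;> fin_cases b <;> simp [eps_values, eps_eq_zero] <;> ring

end

end Umbilic

/-! ### The quaternionic basis of self-dual bivectors -/

namespace Umbilic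
open Matrix

/-- The complex number `1 / √2`. -/
def rt : ℂ := ((1 / Real.sqrt 2 : ℝ) : ℂ)

theorem rt_mul_rt : rt * rt = 1 / 2 := by
  rw [rt, ← Complex.ofReal_mul, div_mul_div_comm, Real.mul_self_sqrt (by norm_num)]
  norm_num

theorem rt_ne_zero : rt ≠ 0 := fun h => by
  have := rt_mul_rt
  rw [h] at this
  norm_num at this

/-- The standard basis of self-dual bivectors in an orthonormal frame. -/
def sdStd : Fin 3 → Tensor2 ℂ
  | 0 => rt • !![0, 1, 0, 0; -1, 0, 0, 0; 0, 0, 0, Complex.I; 0, 0, -Complex.I, 0]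
  | 1 => rt • !![0, 0, 1, 0; 0, 0, 0, -Complex.I; -1, 0, 0, 0; 0, Complex.I, 0, 0]
  | 2 => rt • !![0, 0, 0, 1; 0, 0, Complex.I, 0; 0, -Complex.I, 0, 0; -1, 0, 0, 0]

theorem sdStd_transpose (i : Fin 3) : (sdStd i)ᵀ = -sdStd i := by
  ext a b
  fin_cases i <;> fin_cases a <;> fin_cases b <;> simp [sdStd]

theorem cast_mink : cast ℂ mink = !![-1, 0, 0, 0; 0, 1, 0, 0; 0, 0, 1, 0; 0, 0, 0, 1] := by
  ext i j; fin_cases i <;> fin_cases j <;> simp [mink]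

theorem cast_mink_mul (A : Tensor2 ℂ) : cast ℂ mink * A =
    Matrix.of fun i j => (if i = 0 then -1 else 1) * A i j := by
  ext i j
  rw [cast_mink]
  fin_cases i <;> simp [Matrix.mul_apply, Fin.sum_univ_four]

/-- Quaternion relations up to scale. Arithmetic in `Fin 3` is cyclic: in the last case j = i + 2,
so the third index is i + 1. -/
theorem sdStd_mul (i j : Fin 3) : cast ℂ mink * sdStd i * (cast ℂ mink * sdStd j) =
    if i = j then (1 / 2 : ℂ) • 1 else
      if j = i + 1 then (-(rt * Complex.I)) • (cast ℂ mink * sdStd (i + 2)) else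
        (rt * Complex.I) • (cast ℂ mink * sdStd (i + 1)) := by
  have h2 : rt ^ 2 = 1 / 2 := by rw [sq, rt_mul_rt]
  simp only [cast_mink_mul]
  ext a b
  fin_cases i <;> fin_cases j <;> fin_cases a <;> fin_cases b <;>
    simp [sdStd, Matrix.mul_apply, Fin.sum_univ_four] <;> ring_nf <;> simp [h2]

theorem trace_cast_mink_mul_sdStd (i : Fin 3) : (cast ℂ mink * sdStd i).trace = 0 := by
  rw [cast_mink_mul]
  fin_cases i <;> simp [sdStd, Matrix.trace, Fin.sum_univ_four]

theorem antisymm_apply {F : Tensor2 ℂ} (hF : Fᵀ = -F) (a b : Fin 4) : F a b = -F b a := by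
  have := congrFun (congrFun hF b) a
  simpa using this

theorem antisymm_diag {F : Tensor2 ℂ} (hF : Fᵀ = -F) (a : Fin 4) : F a a = 0 := by
  have := antisymm_apply hF a a
  linear_combination (1 / 2 : ℂ) * this

/-- The left side is twice the SD projection. The basis is orthogonal for the trace form, with
squared norm tr(½·1) = 2, so the factor 2 cancels and the traces are the coefficients. -/
theorem sdPart_mink {F : Tensor2 ℂ} (hF : Fᵀ = -F) :
    F - Complex.I • hodge mink eps F =
      ∑ i, (cast ℂ mink * F * (cast ℂ mink * sdStd i)).trace • sdStd i := by
  have h10 := antisymm_apply hF 1 0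
  have h20 := antisymm_apply hF 2 0
  have h30 := antisymm_apply hF 3 0
  have h21 := antisymm_apply hF 2 1
  have h31 := antisymm_apply hF 3 1
  have h32 := antisymm_apply hF 3 2
  have h2 : rt ^ 2 = 1 / 2 := by rw [sq, rt_mul_rt]
  have t0 : (cast ℂ mink * F * (cast ℂ mink * sdStd 0)).trace =
      2 * rt * (F 0 1 - Complex.I * F 2 3) := by
    simp [cast_mink_mul, sdStd, Matrix.trace, Matrix.mul_apply, Fin.sum_univ_four, h10, h32]; ring
  have t1 : (cast ℂ mink * F * (cast ℂ mink * sdStd 1)).trace =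
      2 * rt * (F 0 2 + Complex.I * F 1 3) := by
    simp [cast_mink_mul, sdStd, Matrix.trace, Matrix.mul_apply, Fin.sum_univ_four, h20, h31]; ring
  have t2 : (cast ℂ mink * F * (cast ℂ mink * sdStd 2)).trace =
      2 * rt * (F 0 3 - Complex.I * F 1 2) := by
    simp [cast_mink_mul, sdStd, Matrix.trace, Matrix.mul_apply, Fin.sum_univ_four, h30, h21]; ring
  rw [Fin.sum_univ_three, t0, t1, t2, hodge_mink]
  ext a b
  fin_cases a <;> fin_cases b <;>
    simp [sdStd, h10, h20, h30, h21, h31, h32, antisymm_diag hF] <;> ring_nf <;>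
    simp [h2]

theorem antisymm_eq {F : Tensor2 ℂ} (hF : Fᵀ = -F) :
    F = !![0, F 0 1, F 0 2, F 0 3; -F 0 1, 0, F 1 2, F 1 3; -F 0 2, -F 1 2, 0, F 2 3;
      -F 0 3, -F 1 3, -F 2 3, 0] := by
  have h10 := antisymm_apply hF 1 0
  have h20 := antisymm_apply hF 2 0
  have h30 := antisymm_apply hF 3 0
  have h21 := antisymm_apply hF 2 1
  have h31 := antisymm_apply hF 3 1
  have h32 := antisymm_apply hF 3 2
  ext a b
  fin_cases a <;> fin_cases b <;> simp [h10, h20, h30, h21, h31, h32, antisymm_diag hF]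

/-- SD bivectors orthogonal to `sdStd 0` anticommute with it and anti-self-dual ones commute with
it. Once `h0` has removed the component along `sdStd 0`, the anticommutator is twice the product of
the anti-self-dual part with an invertible matrix. -/
theorem anticomm_mink {F : Tensor2 ℂ} (hF : Fᵀ = -F)
    (h0 : (cast ℂ mink * F * (cast ℂ mink * sdStd 0)).trace = 0) :
    F * cast ℂ mink * sdStd 0 + sdStd 0 * cast ℂ mink * F = 0 ↔
      hodge mink eps F = Complex.I • F := by
  have hF' := antisymm_eq hF
  generalize F 0 1 = a at hF'
  generalize F 0 2 = b at hF'
  generalize F 0 3 = c at hF'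
  generalize F 1 2 = d at hF'
  generalize F 1 3 = e at hF'
  generalize F 2 3 = f at hF'
  subst hF'
  have hr := rt_ne_zero
  -- The trace condition ties the (0,1) and (2,3) entries; self-duality would tie them with the
  -- opposite sign, so both must vanish in the end.
  have h01 : a = Complex.I * f := by
    simp [cast_mink, sdStd, Matrix.trace, Fin.sum_univ_four] at h0
    have : rt * (a - Complex.I * f) = 0 := by linear_combination (1 / 2 : ℂ) * h0
    linear_combination (mul_eq_zero.mp this).resolve_left hr
  subst h01
  rw [hodge_mink, cast_mink]
  constructor
  · intro h
    have h' := fun a b => congrFun (congrFun h a) b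
    have e02 := h' 0 2
    have e03 := h' 0 3
    have e00 := h' 0 0
    simp [sdStd] at e02 e03 e00
    have q13 : e = -Complex.I * b := by
      have : rt * (e + Complex.I * b) = 0 := by linear_combination e03
      linear_combination (mul_eq_zero.mp this).resolve_left hr
    have q12 : d = Complex.I * c := by
      have : rt * (d - Complex.I * c) = 0 := by linear_combination e02
      linear_combination (mul_eq_zero.mp this).resolve_left hr
    have q01 : f = 0 := by
      have : rt * (Complex.I * f) = 0 := by linear_combination (-1 / 2 : ℂ) * e00
      simpa [hr] using this
    subst q01 q13 q12
    ext i j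
    fin_cases i <;> fin_cases j <;> simp <;> ring_nf <;> try simp
  · intro h
    have h' := fun a b => congrFun (congrFun h a) b
    have e02 := h' 0 2
    have e03 := h' 0 3
    have e01 := h' 0 1
    simp at e02 e03 e01
    have q13 : e = -Complex.I * b := by linear_combination -e02
    have q12 : d = Complex.I * c := by linear_combination e03
    have q01 : f = 0 := by
      have h2 := Complex.I_mul_I
      linear_combination (1 / 2 : ℂ) * e01 + (1 / 2 : ℂ) * f * h2
    subst q01 q13 q12
    ext i j
    fin_cases i <;> fin_cases j <;> simp [sdStd] <;> ring_nf <;> try simp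

theorem cast_hodge {𝕜 : Type} [RCLike 𝕜] (g : Tensor2 ℝ) (η : Tensor4 ℝ) (F : Tensor2 ℝ) :
    cast 𝕜 (hodge g η F) = hodge g η (cast 𝕜 F) := by
  ext a b
  rw [cast_apply, hodge, hodge, act_apply, act_apply]
  simp only [Matrix.mul_apply, map_sum, map_mul, cast_apply, Matrix.transpose_apply, map_div₀,
    map_one, map_ofNat, RCLike.ofReal_real_eq_id, id]

/-- A basis of self-dual bivectors satisfying the quaternion relations. -/
structure SDTriple (g : Tensor2 ℝ) (η : Tensor4 ℝ) (e : Fin 3 → Tensor2 ℂ) : Prop where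
  metric_transpose : gᵀ = g
  inv_mul : g⁻¹ * g = 1
  transpose : ∀ i, (e i)ᵀ = -e i
  mul : ∀ i j, cast ℂ g⁻¹ * e i * (cast ℂ g⁻¹ * e j) =
    if i = j then (1 / 2 : ℂ) • 1 else
      if j = i + 1 then (-(rt * Complex.I)) • (cast ℂ g⁻¹ * e (i + 2)) else
        (rt * Complex.I) • (cast ℂ g⁻¹ * e (i + 1))
  trace : ∀ i, (cast ℂ g⁻¹ * e i).trace = 0
  sdPart : ∀ F : Tensor2 ℂ, Fᵀ = -F → F - Complex.I • hodge g η F =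
    ∑ i, (cast ℂ g⁻¹ * F * (cast ℂ g⁻¹ * e i)).trace • e i
  anticomm_iff : ∀ F : Tensor2 ℂ, Fᵀ = -F →
    (cast ℂ g⁻¹ * F * (cast ℂ g⁻¹ * e 0)).trace = 0 →
    (anticomm g F (e 0) = 0 ↔ hodge g η F = Complex.I • F)

/-- The basis of self-dual bivectors associated with an adapted frame. -/
def sdFrame (Q : Tensor2 ℝ) (i : Fin 3) : Tensor2 ℂ := (cast ℂ Q)ᵀ * sdStd i * cast ℂ Q

namespace IsAdapted

variable {Q g U : Tensor2 ℝ} {η : Tensor4 ℝ}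

theorem hat_conj (h : IsAdapted Q g η U) (F : Tensor2 ℂ) :
    cast ℂ g⁻¹ * ((cast ℂ Q)ᵀ * F * cast ℂ Q) = cast ℂ Q⁻¹ * (cast ℂ mink * F) * cast ℂ Q := by
  have h1 : (cast ℂ Q⁻¹)ᵀ * (cast ℂ Q)ᵀ = 1 := by
    rw [← Matrix.transpose_mul, h.cast_mul_inv, Matrix.transpose_one]
  rw [h.inv_metric]
  simp only [cast_mul, cast_transpose]
  calc _ = cast ℂ Q⁻¹ * cast ℂ mink * ((cast ℂ Q⁻¹)ᵀ * (cast ℂ Q)ᵀ) * F * cast ℂ Q := by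
        simp only [Matrix.mul_assoc]
    _ = _ := by rw [h1]; simp only [Matrix.mul_assoc, Matrix.one_mul]

theorem conj_mul (h : IsAdapted Q g η U) (A B : Tensor2 ℂ) :
    cast ℂ Q⁻¹ * A * cast ℂ Q * (cast ℂ Q⁻¹ * B * cast ℂ Q) =
      cast ℂ Q⁻¹ * (A * B) * cast ℂ Q := by
  calc _ = cast ℂ Q⁻¹ * A * (cast ℂ Q * cast ℂ Q⁻¹) * B * cast ℂ Q := by
        simp only [Matrix.mul_assoc]
    _ = _ := by rw [h.cast_mul_inv, Matrix.mul_one]; simp only [Matrix.mul_assoc]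

theorem trace_conj (h : IsAdapted Q g η U) (A : Tensor2 ℂ) :
    (cast ℂ Q⁻¹ * A * cast ℂ Q).trace = A.trace := by
  rw [Matrix.trace_mul_comm, ← Matrix.mul_assoc, h.cast_mul_inv, Matrix.one_mul]

theorem eq_conj (h : IsAdapted Q g η U) (F : Tensor2 ℂ) :
    F = (cast ℂ Q)ᵀ * ((cast ℂ Q⁻¹)ᵀ * F * cast ℂ Q⁻¹) * cast ℂ Q := by
  have h1 : (cast ℂ Q)ᵀ * (cast ℂ Q⁻¹)ᵀ = 1 := by
    rw [← Matrix.transpose_mul, h.cast_inv_mul, Matrix.transpose_one]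
  calc F = ((cast ℂ Q)ᵀ * (cast ℂ Q⁻¹)ᵀ) * F * (cast ℂ Q⁻¹ * cast ℂ Q) := by
        rw [h1, h.cast_inv_mul, Matrix.one_mul, Matrix.mul_one]
    _ = _ := by simp only [Matrix.mul_assoc]

theorem conj_injective (h : IsAdapted Q g η U) {A B : Tensor2 ℂ}
    (hAB : (cast ℂ Q)ᵀ * A * cast ℂ Q = (cast ℂ Q)ᵀ * B * cast ℂ Q) : A = B := by
  have h1 : (cast ℂ Q⁻¹)ᵀ * (cast ℂ Q)ᵀ = 1 := by
    rw [← Matrix.transpose_mul, h.cast_mul_inv, Matrix.transpose_one]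
  have key : ∀ A : Tensor2 ℂ,
      (cast ℂ Q⁻¹)ᵀ * ((cast ℂ Q)ᵀ * A * cast ℂ Q) * cast ℂ Q⁻¹ = A := by
    intro A
    calc _ = ((cast ℂ Q⁻¹)ᵀ * (cast ℂ Q)ᵀ) * A * (cast ℂ Q * cast ℂ Q⁻¹) := by
          simp only [Matrix.mul_assoc]
      _ = A := by rw [h1, h.cast_mul_inv, Matrix.one_mul, Matrix.mul_one]
  rw [← key A, hAB, key B]

/-- Every relation is tensorial: raising an index turns congruence by `Q` into conjugation by `Q`,
which respects products and traces, so the standard frame suffices. -/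
theorem sdTriple (h : IsAdapted Q g η U) : SDTriple g η (sdFrame Q) where
  metric_transpose := h.metric_transpose
  inv_mul := h.inv_mul_metric
  transpose i := by
    simp only [sdFrame, Matrix.transpose_mul, Matrix.transpose_transpose, sdStd_transpose]
    simp [Matrix.mul_assoc]
  mul i j := by
    simp only [sdFrame]
    rw [h.hat_conj, h.hat_conj, h.conj_mul, sdStd_mul]
    split_ifs
    · simp [h.cast_inv_mul]
    · rw [h.hat_conj]; simp
    · rw [h.hat_conj]; simp
  trace i := by
    rw [sdFrame, h.hat_conj, h.trace_conj, trace_cast_mink_mul_sdStd]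
  sdPart F hF := by
    rw [h.eq_conj F, h.hodge_conj]
    set F' := (cast ℂ Q⁻¹)ᵀ * F * cast ℂ Q⁻¹ with hF'
    have ha : F'ᵀ = -F' := by
      simp [hF', Matrix.transpose_mul, hF, Matrix.mul_assoc]
    have := congrArg (fun X => (cast ℂ Q)ᵀ * X * cast ℂ Q) (sdPart_mink ha)
    simp only [Matrix.mul_sub, Matrix.sub_mul, Matrix.mul_smul, Matrix.smul_mul, Matrix.mul_sum,
      Matrix.sum_mul] at this
    rw [this]
    refine Finset.sum_congr rfl fun i _ => ?_
    rw [sdFrame, h.hat_conj, h.hat_conj, h.conj_mul, h.trace_conj]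
  anticomm_iff F hF h0 := by
    rw [h.eq_conj F] at h0 ⊢
    set F' := (cast ℂ Q⁻¹)ᵀ * F * cast ℂ Q⁻¹ with hF'
    have ha : F'ᵀ = -F' := by
      simp [hF', Matrix.transpose_mul, hF, Matrix.mul_assoc]
    rw [sdFrame, h.hat_conj, h.hat_conj, h.conj_mul, h.trace_conj] at h0
    have key := anticomm_mink ha h0
    have h1 : ∀ A B : Tensor2 ℂ, dot g ((cast ℂ Q)ᵀ * A * cast ℂ Q) ((cast ℂ Q)ᵀ * B * cast ℂ Q) =
        (cast ℂ Q)ᵀ * (A * cast ℂ mink * B) * cast ℂ Q := by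
      intro A B
      rw [dot_eq, Matrix.mul_assoc, h.hat_conj]
      calc _ = (cast ℂ Q)ᵀ * A * (cast ℂ Q * cast ℂ Q⁻¹) * (cast ℂ mink * B) * cast ℂ Q := by
            simp only [Matrix.mul_assoc]
        _ = _ := by rw [h.cast_mul_inv, Matrix.mul_one]; simp only [Matrix.mul_assoc]
    rw [h.hodge_conj, anticomm, sdFrame, h1, h1, ← Matrix.add_mul, ← Matrix.mul_add]
    constructor
    · intro hA
      have := key.mp (h.conj_injective (hA.trans (by simp)))
      rw [this]; simp
    · intro hA
      have : hodge mink eps F' = Complex.I • F' := h.conj_injective (hA.trans (by simp))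
      rw [key.mpr this]; simp

/-- This singles out index 0 of the basis: every later pairing with `sdFrame Q 0` is a pairing with
𝒰. -/
theorem selfDualPart_eq (h : IsAdapted Q g η U) : selfDualPart g η U = sdFrame Q 0 := by
  have h1 : selfDualPart g η U = rt • (cast ℂ U - Complex.I • hodge g η (cast ℂ U)) := by
    rw [← cast_hodge]; rfl
  have hs : rt • (cast ℂ stdForm - Complex.I • hodge mink eps (cast ℂ stdForm)) = sdStd 0 := by
    rw [hodge_mink]
    ext a b
    fin_cases a <;> fin_cases b <;> simp [sdStd, stdForm] <;> norm_num
  rw [h1, h.form]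
  simp only [cast_mul, cast_transpose]
  rw [h.hodge_conj, sdFrame, ← hs]
  simp [Matrix.mul_sub, Matrix.sub_mul]

end IsAdapted

end Umbilic

/-! ### Partial derivatives of smooth functions and matrices -/

namespace Umbilic
open Matrix Filter Topology

section Partial

variable {𝕜 : Type} [RCLike 𝕜] {f h : E4 → 𝕜} {x : E4}

theorem pd_congr {f h : E4 → 𝕜} (hfh : f =ᶠ[𝓝 x] h) (i : Fin 4) : pd f x i = pd h x i := by
  rw [pd, pd, hfh.fderiv_eq]

theorem pd_add (hf : ContDiffAt ℝ ∞ f x) (hh : ContDiffAt ℝ ∞ h x) (i : Fin 4) :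
    pd (fun y => f y + h y) x i = pd f x i + pd h x i := by
  rw [pd, fderiv_fun_add (hf.differentiableAt (by simp)) (hh.differentiableAt (by simp))]
  rfl

theorem pd_sub (hf : ContDiffAt ℝ ∞ f x) (hh : ContDiffAt ℝ ∞ h x) (i : Fin 4) :
    pd (fun y => f y - h y) x i = pd f x i - pd h x i := by
  rw [pd, fderiv_fun_sub (hf.differentiableAt (by simp)) (hh.differentiableAt (by simp))]
  rfl

theorem pd_neg (i : Fin 4) : pd (fun y => -f y) x i = -pd f x i := by
  rw [pd, fderiv_fun_neg]
  rfl

theorem pd_mul (hf : ContDiffAt ℝ ∞ f x) (hh : ContDiffAt ℝ ∞ h x) (i : Fin 4) :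
    pd (fun y => f y * h y) x i = pd f x i * h x + f x * pd h x i := by
  rw [pd, fderiv_fun_mul (hf.differentiableAt (by simp)) (hh.differentiableAt (by simp))]
  simp [pd, mul_comm, add_comm]

theorem pd_const (c : 𝕜) (i : Fin 4) : pd (fun _ : E4 => c) x i = 0 := by
  simp [pd]

theorem pd_const_mul (c : 𝕜) (hf : ContDiffAt ℝ ∞ f x) (i : Fin 4) :
    pd (fun y => c * f y) x i = c * pd f x i := by
  rw [pd_mul contDiffAt_const hf, pd_const, zero_mul, zero_add]

theorem pd_sum {ι : Type} (s : Finset ι) {f : ι → E4 → 𝕜} (hf : ∀ j ∈ s, ContDiffAt ℝ ∞ (f j) x)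
    (i : Fin 4) : pd (fun y => ∑ j ∈ s, f j y) x i = ∑ j ∈ s, pd (f j) x i := by
  rw [pd, fderiv_fun_sum fun j hj => (hf j hj).differentiableAt (by simp)]
  simp [pd]

theorem contDiffAt_ofReal {f : E4 → ℝ} (hf : ContDiffAt ℝ ∞ f x) :
    ContDiffAt ℝ ∞ (fun y => ((f y : ℝ) : 𝕜)) x :=
  (RCLike.ofRealCLM (K := 𝕜)).contDiff.contDiffAt.comp x hf

theorem pd_ofReal {f : E4 → ℝ} (hf : ContDiffAt ℝ ∞ f x) (i : Fin 4) :
    pd (fun y => ((f y : ℝ) : 𝕜)) x i = ((pd f x i : ℝ) : 𝕜) := by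
  have := ((RCLike.ofRealCLM (K := 𝕜)).hasFDerivAt (x := f x)).comp x
    (hf.differentiableAt (by simp)).hasFDerivAt
  have h2 : fderiv ℝ (fun y => ((f y : ℝ) : 𝕜)) x = _ := this.fderiv
  rw [pd, h2]
  rfl

theorem contDiffAt_pd (hf : ContDiffAt ℝ ∞ f x) (i : Fin 4) :
    ContDiffAt ℝ ∞ (fun y => pd f y i) x :=
  (hf.fderiv_right (m := ∞) (by simp)).clm_apply contDiffAt_const

theorem pd_comm (hf : ContDiffAt ℝ ∞ f x) (i j : Fin 4) :
    pd (fun y => pd f y i) x j = pd (fun y => pd f y j) x i := by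
  have hd : DifferentiableAt ℝ (fderiv ℝ f) x :=
    (hf.fderiv_right (m := ∞) (by simp)).differentiableAt (by simp)
  have key : ∀ i j, pd (fun y => pd f y i) x j =
      fderiv ℝ (fderiv ℝ f) x (EuclideanSpace.single j 1) (EuclideanSpace.single i 1) := by
    intro i j
    rw [pd]
    simp only [pd]
    rw [fderiv_clm_apply hd (differentiableAt_const _)]
    simp
  rw [key, key]
  -- Over ℝ two derivatives suffice for symmetry; the side goal compares this order with ∞.
  exact (hf.isSymmSndFDerivAt (by simp only [minSmoothness_of_isRCLikeNormedField]; exact WithTop.coe_le_coe.mpr le_top)) _ _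

end Partial

section MatrixCalculus

variable {𝕜 : Type} [RCLike 𝕜] {x : E4}

/-- All entries of the matrix-valued function are smooth at the point. -/
def SmoothMat (F : E4 → Tensor2 𝕜) (x : E4) : Prop :=
  ∀ a b, ContDiffAt ℝ ∞ (fun y => F y a b) x

/-- The entrywise partial derivative of a matrix-valued function. -/
def dMat (F : E4 → Tensor2 𝕜) (x : E4) (m : Fin 4) : Tensor2 𝕜 :=
  Matrix.of fun a b => pd (fun y => F y a b) x m

theorem dMat_congr {F H : E4 → Tensor2 𝕜} (hFH : F =ᶠ[𝓝 x] H) (m : Fin 4) :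
    dMat F x m = dMat H x m := by
  ext a b
  exact pd_congr (hFH.mono fun y hy => by rw [hy]) m

namespace SmoothMat

variable {F H : E4 → Tensor2 𝕜}

theorem congr (hF : SmoothMat F x) (hFH : H =ᶠ[𝓝 x] F) : SmoothMat H x := fun a b =>
  (hF a b).congr_of_eventuallyEq (hFH.mono fun _ hy => congrFun (congrFun hy a) b)

theorem sub (hF : SmoothMat F x) (hH : SmoothMat H x) : SmoothMat (fun y => F y - H y) x :=
  fun a b => (hF a b).sub (hH a b)

theorem mul (hF : SmoothMat F x) (hH : SmoothMat H x) : SmoothMat (fun y => F y * H y) x := by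
  intro a b
  simp only [Matrix.mul_apply]
  exact ContDiffAt.sum fun k _ => (hF a k).mul (hH k b)

theorem transpose (hF : SmoothMat F x) : SmoothMat (fun y => (F y)ᵀ) x := fun a b => hF b a

theorem smul {f : E4 → 𝕜} (hf : ContDiffAt ℝ ∞ f x) (hF : SmoothMat F x) :
    SmoothMat (fun y => f y • F y) x := fun a b => hf.mul (hF a b)

theorem dMat (hF : SmoothMat F x) (m : Fin 4) : SmoothMat (fun y => dMat F y m) x :=
  fun a b => contDiffAt_pd (hF a b) m

theorem cast {F : E4 → Tensor2 ℝ} (hF : SmoothMat F x) : SmoothMat (fun y => cast 𝕜 (F y)) x :=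
  fun a b => contDiffAt_ofReal (hF a b)

theorem det {F : E4 → Tensor2 ℝ} (hF : SmoothMat F x) : ContDiffAt ℝ ∞ (fun y => (F y).det) x := by
  simp only [Matrix.det_apply']
  exact ContDiffAt.sum fun σ _ => contDiffAt_const.mul (contDiffAt_prod fun i _ => hF _ _)

theorem adjugate {F : E4 → Tensor2 ℝ} (hF : SmoothMat F x) :
    SmoothMat (fun y => (F y).adjugate) x := by
  intro a b
  simp only [Matrix.adjugate_apply]
  refine det (F := fun y => (F y).updateRow b (Pi.single a 1)) fun i j => ?_
  by_cases h : i = b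
  · subst h; simpa using contDiffAt_const
  · simpa [Matrix.updateRow_ne h] using hF i j

theorem inv {F : E4 → Tensor2 ℝ} (hF : SmoothMat F x) (h : IsUnit (F x).det) :
    SmoothMat (fun y => (F y)⁻¹) x := by
  intro a b
  simp only [Matrix.inv_def, Ring.inverse_eq_inv', Matrix.smul_apply, smul_eq_mul]
  exact (hF.det.inv h.ne_zero).mul (hF.adjugate a b)

end SmoothMat

variable {F H : E4 → Tensor2 𝕜}

theorem dMat_add (hF : SmoothMat F x) (hH : SmoothMat H x) (m : Fin 4) :
    dMat (fun y => F y + H y) x m = dMat F x m + dMat H x m := by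
  ext a b; exact pd_add (hF a b) (hH a b) m

theorem dMat_sub (hF : SmoothMat F x) (hH : SmoothMat H x) (m : Fin 4) :
    dMat (fun y => F y - H y) x m = dMat F x m - dMat H x m := by
  ext a b; exact pd_sub (hF a b) (hH a b) m

theorem dMat_neg (m : Fin 4) : dMat (fun y => -F y) x m = -dMat F x m := by
  ext a b; exact pd_neg m

theorem dMat_mul (hF : SmoothMat F x) (hH : SmoothMat H x) (m : Fin 4) :
    dMat (fun y => F y * H y) x m = dMat F x m * H x + F x * dMat H x m := by
  ext a b
  simp only [dMat, Matrix.of_apply, Matrix.add_apply, Matrix.mul_apply]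
  rw [pd_sum _ fun k _ => (hF a k).mul (hH k b), ← Finset.sum_add_distrib]
  exact Finset.sum_congr rfl fun k _ => pd_mul (hF a k) (hH k b) m

theorem dMat_smul {f : E4 → 𝕜} (hf : ContDiffAt ℝ ∞ f x) (hF : SmoothMat F x) (m : Fin 4) :
    dMat (fun y => f y • F y) x m = pd f x m • F x + f x • dMat F x m := by
  ext a b; exact pd_mul hf (hF a b) m

theorem dMat_const (A : Tensor2 𝕜) (m : Fin 4) : dMat (fun _ => A) x m = 0 := by
  ext a b; exact pd_const _ m

theorem dMat_transpose (m : Fin 4) : dMat (fun y => (F y)ᵀ) x m = (dMat F x m)ᵀ := rfl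

theorem dMat_cast {F : E4 → Tensor2 ℝ} (hF : SmoothMat F x) (m : Fin 4) :
    dMat (fun y => cast 𝕜 (F y)) x m = cast 𝕜 (dMat F x m) := by
  ext a b; exact pd_ofReal (hF a b) m

theorem dMat_comm (hF : SmoothMat F x) (k m : Fin 4) :
    dMat (fun y => dMat F y m) x k = dMat (fun y => dMat F y k) x m := by
  ext a b; exact pd_comm (hF a b) m k

end MatrixCalculus

end Umbilic

/-! ### Levi-Civita connection: metric compatibility, parallel volume, Ricci identity -/

namespace Umbilic
open Matrix Filter Topology

/-- Jacobi's formula: the Leibniz rule differentiates one column at a time, and Cramer's rule turns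
the resulting determinants into the adjugate. -/
theorem pd_det {F : E4 → Tensor2 ℝ} {x : E4} (hF : SmoothMat F x) (m : Fin 4) :
    pd (fun y => (F y).det) x m = ((F x).adjugate * dMat F x m).trace := by
  have h1 : ((F x).adjugate * dMat F x m).trace =
      ∑ k, ((F x).updateCol k fun j => dMat F x m j k).det := by
    simp only [Matrix.trace, Matrix.diag_apply]
    refine Finset.sum_congr rfl fun k _ => ?_
    rw [← Matrix.cramer_apply, Matrix.cramer_eq_adjugate_mulVec]
    rfl
  rw [h1]
  simp only [Matrix.det_apply']
  rw [pd_sum _ fun σ _ => contDiffAt_const.mul (contDiffAt_prod fun i _ => hF _ _),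
    Finset.sum_comm]
  refine Finset.sum_congr rfl fun σ _ => ?_
  rw [pd_const_mul _ (contDiffAt_prod fun i _ => hF _ _), ← Finset.mul_sum]
  congr 1
  simp only [Fin.prod_univ_four, Fin.sum_univ_four]
  rw [pd_mul (((hF _ _).mul (hF _ _)).mul (hF _ _)) (hF _ _),
    pd_mul ((hF _ _).mul (hF _ _)) (hF _ _), pd_mul (hF _ _) (hF _ _)]
  simp [dMat]
  ring

/-- Smooth components, on an open set of coordinates, of a metric, of its volume element and of the
canonical form of a 2+2 structure. -/
structure AdaptedOn (O : Set E4) (G : E4 → Tensor2 ℝ) (η : E4 → Tensor4 ℝ)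
    (U : E4 → Tensor2 ℝ) : Prop where
  isOpen : IsOpen O
  smooth_metric : ∀ x ∈ O, SmoothMat G x
  smooth_form : ∀ x ∈ O, SmoothMat U x
  smooth_vol : ∀ x ∈ O, ∀ a b c d, ContDiffAt ℝ ∞ (fun y => η y a b c d) x
  exists_frame : ∀ x ∈ O, ∃ Q, IsAdapted Q (G x) (η x) (U x)

/-- The connection matrices `(Γ_m)^k_a`. -/
def Gam (G : E4 → Tensor2 ℝ) (x : E4) (m : Fin 4) : Tensor2 ℝ :=
  Matrix.of fun k a => christoffel G x k m a

/-- The covariant derivative of a 2-tensor, as a matrix. -/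
def covMat {𝕜 : Type} [RCLike 𝕜] (G : E4 → Tensor2 ℝ) (F : E4 → Tensor2 𝕜) (x : E4) (m : Fin 4) :
    Tensor2 𝕜 :=
  dMat F x m - (cast 𝕜 (Gam G x m))ᵀ * F x - F x * cast 𝕜 (Gam G x m)

theorem covDeriv_eq {𝕜 : Type} [RCLike 𝕜] (G : E4 → Tensor2 ℝ) (F : E4 → Tensor2 𝕜) (x : E4)
    (m a b : Fin 4) : covDeriv G F x m a b = covMat G F x m a b := by
  simp [covDeriv, covMat, dMat, Matrix.mul_apply, Gam, mul_comm]

namespace AdaptedOn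

variable {O : Set E4} {G : E4 → Tensor2 ℝ} {η : E4 → Tensor4 ℝ} {U : E4 → Tensor2 ℝ} {x : E4}

theorem mem_nhds (h : AdaptedOn O G η U) (hx : x ∈ O) : O ∈ 𝓝 x := h.isOpen.mem_nhds hx

theorem symm (h : AdaptedOn O G η U) (hx : x ∈ O) : (G x)ᵀ = G x := by
  obtain ⟨Q, hQ⟩ := h.exists_frame x hx
  exact hQ.metric_transpose

theorem symm_apply (h : AdaptedOn O G η U) (hx : x ∈ O) (a b : Fin 4) : G x a b = G x b a :=
  congrFun (congrFun (h.symm hx) b) a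

theorem isUnit (h : AdaptedOn O G η U) (hx : x ∈ O) : IsUnit (G x).det := by
  obtain ⟨Q, hQ⟩ := h.exists_frame x hx
  exact hQ.isUnit_metric

theorem mul_inv (h : AdaptedOn O G η U) (hx : x ∈ O) : G x * (G x)⁻¹ = 1 :=
  Matrix.mul_nonsing_inv _ (h.isUnit hx)

theorem inv_mul (h : AdaptedOn O G η U) (hx : x ∈ O) : (G x)⁻¹ * G x = 1 :=
  Matrix.nonsing_inv_mul _ (h.isUnit hx)

theorem inv_symm (h : AdaptedOn O G η U) (hx : x ∈ O) : (G x)⁻¹ᵀ = (G x)⁻¹ := by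
  rw [Matrix.transpose_nonsing_inv, h.symm hx]

theorem smooth_inv (h : AdaptedOn O G η U) (hx : x ∈ O) : SmoothMat (fun y => (G y)⁻¹) x :=
  (h.smooth_metric x hx).inv (h.isUnit hx)

theorem pd_symm (h : AdaptedOn O G η U) (hx : x ∈ O) (a b m : Fin 4) :
    pd (fun y => G y a b) x m = pd (fun y => G y b a) x m :=
  pd_congr (Filter.eventually_of_mem (h.mem_nhds hx) fun _ hy => h.symm_apply hy a b) m

theorem smooth_Gam (h : AdaptedOn O G η U) (hx : x ∈ O) (m : Fin 4) :
    SmoothMat (fun y => Gam G y m) x := by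
  intro a b
  simp only [Gam, Matrix.of_apply, christoffel]
  have hG := h.smooth_metric x hx
  refine contDiffAt_const.mul (ContDiffAt.sum fun l _ => (h.smooth_inv hx a l).mul ?_)
  exact ((contDiffAt_pd (hG _ _) _).add (contDiffAt_pd (hG _ _) _)).sub (contDiffAt_pd (hG _ _) _)

theorem christoffel_symm (h : AdaptedOn O G η U) (hx : x ∈ O) (k i j : Fin 4) :
    christoffel G x k i j = christoffel G x k j i := by
  simp only [christoffel]
  congr 1
  refine Finset.sum_congr rfl fun l _ => ?_
  rw [h.pd_symm hx i j l]
  ring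

theorem metric_mul_Gam (h : AdaptedOn O G η U) (hx : x ∈ O) (l m a : Fin 4) :
    (G x * Gam G x m) l a = (1 / 2) * (pd (fun y => G y l a) x m + pd (fun y => G y l m) x a -
      pd (fun y => G y m a) x l) := by
  have : Gam G x m = (G x)⁻¹ * Matrix.of fun l a => (1 / 2) * (pd (fun y => G y l a) x m +
      pd (fun y => G y l m) x a - pd (fun y => G y m a) x l) := by
    ext k a
    simp only [Gam, christoffel, Matrix.of_apply, Matrix.mul_apply, Finset.mul_sum]
    exact Finset.sum_congr rfl fun l _ => by ring
  rw [this, ← Matrix.mul_assoc, h.mul_inv hx, Matrix.one_mul, Matrix.of_apply]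

/-- In the sum of the two Christoffel symbols of the first kind all but one derivative of the metric
cancel. -/
theorem dMat_metric (h : AdaptedOn O G η U) (hx : x ∈ O) (m : Fin 4) :
    dMat G x m = (Gam G x m)ᵀ * G x + G x * Gam G x m := by
  have : (Gam G x m)ᵀ * G x = (G x * Gam G x m)ᵀ := by rw [Matrix.transpose_mul, h.symm hx]
  rw [this]
  ext l a
  rw [Matrix.add_apply, Matrix.transpose_apply, h.metric_mul_Gam hx, h.metric_mul_Gam hx,
    h.pd_symm hx a l m, h.pd_symm hx a m l, h.pd_symm hx m l a]
  simp only [dMat, Matrix.of_apply]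
  ring

/-- Obtained by differentiating g⁻¹ g = 1. -/
theorem dMat_inv (h : AdaptedOn O G η U) (hx : x ∈ O) (m : Fin 4) :
    dMat (fun y => (G y)⁻¹) x m = -((G x)⁻¹ * (Gam G x m)ᵀ) - Gam G x m * (G x)⁻¹ := by
  have h0 : dMat (fun y => (G y)⁻¹ * G y) x m = 0 := by
    rw [dMat_congr (H := fun _ => 1) (Filter.eventually_of_mem (h.mem_nhds hx)
      fun y hy => h.inv_mul hy), dMat_const]
  rw [dMat_mul (h.smooth_inv hx) (h.smooth_metric x hx), h.dMat_metric hx] at h0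
  have h1 := congrArg (fun A => A * (G x)⁻¹) h0
  simp only [Matrix.add_mul, Matrix.mul_add, Matrix.mul_assoc, h.mul_inv hx, Matrix.mul_one,
    Matrix.zero_mul] at h1
  rw [← Matrix.mul_assoc (G x)⁻¹ (G x), h.inv_mul hx, Matrix.one_mul] at h1
  rw [eq_sub_iff_add_eq, eq_neg_iff_add_eq_zero, ← h1]
  abel

theorem vol_eq (h : AdaptedOn O G η U) (hx : x ∈ O) (a b c d : Fin 4) :
    η x a b c d = η x 0 1 2 3 * eps a b c d := by
  obtain ⟨Q, hQ⟩ := h.exists_frame x hx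
  rw [hQ.vol_eq, hQ.vol_eq 0 1 2 3, eps_values.1, mul_one]

/-- The square of η₀₁₂₃ is −det g whatever the orientation. Differentiating it by Jacobi's formula
and dividing by 2 η₀₁₂₃ ≠ 0 gives the trace of the connection. -/
theorem pd_vol (h : AdaptedOn O G η U) (hx : x ∈ O) (m : Fin 4) :
    pd (fun y => η y 0 1 2 3) x m = η x 0 1 2 3 * (Gam G x m).trace := by
  have hs := h.smooth_vol x hx 0 1 2 3
  have hsq : ∀ y ∈ O, η y 0 1 2 3 * η y 0 1 2 3 = -(G y).det := by
    intro y hy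
    obtain ⟨Q, hQ⟩ := h.exists_frame y hy
    rw [hQ.vol_eq 0 1 2 3, eps_values.1, mul_one, hQ.det_metric]
    ring
  have hne : η x 0 1 2 3 ≠ 0 := by
    obtain ⟨Q, hQ⟩ := h.exists_frame x hx
    rw [hQ.vol_eq 0 1 2 3, eps_values.1, mul_one]
    exact hQ.det_ne.ne_zero
  have h1 := pd_congr (Filter.eventually_of_mem (h.mem_nhds hx) hsq) m
  rw [pd_mul hs hs, pd_neg, pd_det (h.smooth_metric x hx), h.dMat_metric hx] at h1
  -- The two terms of ∂g contribute equally, hence the factor 2.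
  have h2 : ((G x).adjugate * ((Gam G x m)ᵀ * G x + G x * Gam G x m)).trace =
      2 * (G x).det * (Gam G x m).trace := by
    rw [Matrix.mul_add, Matrix.trace_add, Matrix.trace_mul_comm, Matrix.mul_assoc,
      Matrix.mul_adjugate, ← Matrix.mul_assoc, Matrix.adjugate_mul]
    simp
    ring
  rw [h2] at h1
  have h3 := hsq x hx
  apply mul_left_cancel₀ hne
  linear_combination (1 / 2 : ℝ) * h1 - (Gam G x m).trace * h3

end AdaptedOn

section

variable {𝕜 : Type} [RCLike 𝕜]

/-- Contraction of a contravariant 2-tensor with the Levi-Civita symbol. -/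
def epsContr (Y : Tensor2 𝕜) : Tensor2 𝕜 :=
  Matrix.of fun a b => ∑ m, ∑ n, (eps a b m n : 𝕜) * Y m n

theorem epsContr_eq (Y : Tensor2 𝕜) : epsContr Y =
    !![0, Y 2 3 - Y 3 2, Y 3 1 - Y 1 3, Y 1 2 - Y 2 1;
      Y 3 2 - Y 2 3, 0, Y 0 3 - Y 3 0, Y 2 0 - Y 0 2;
      Y 1 3 - Y 3 1, Y 3 0 - Y 0 3, 0, Y 0 1 - Y 1 0;
      Y 2 1 - Y 1 2, Y 0 2 - Y 2 0, Y 1 0 - Y 0 1, 0] := by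
  ext a b
  simp only [epsContr, Matrix.of_apply, Fin.sum_univ_four]
  fin_cases a <;> fin_cases b <;> simp [eps_values, eps_eq_zero] <;> ring

theorem epsContr_values (Y : Tensor2 𝕜) :
    epsContr Y 0 0 = 0 ∧ epsContr Y 0 1 = Y 2 3 - Y 3 2 ∧ epsContr Y 0 2 = Y 3 1 - Y 1 3 ∧ epsContr Y 0 3 = Y 1 2 - Y 2 1 ∧
    epsContr Y 1 0 = Y 3 2 - Y 2 3 ∧ epsContr Y 1 1 = 0 ∧ epsContr Y 1 2 = Y 0 3 - Y 3 0 ∧ epsContr Y 1 3 = Y 2 0 - Y 0 2 ∧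
    epsContr Y 2 0 = Y 1 3 - Y 3 1 ∧ epsContr Y 2 1 = Y 3 0 - Y 0 3 ∧ epsContr Y 2 2 = 0 ∧ epsContr Y 2 3 = Y 0 1 - Y 1 0 ∧
    epsContr Y 3 0 = Y 2 1 - Y 1 2 ∧ epsContr Y 3 1 = Y 0 2 - Y 2 0 ∧ epsContr Y 3 2 = Y 1 0 - Y 0 1 ∧ epsContr Y 3 3 = 0 := by
  rw [epsContr_eq]
  simp

-- An endomorphism `A` acts as a derivation on an alternating 4-form by multiplication by tr A. This
-- is that identity with two slots contracted against `Y`.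
set_option maxHeartbeats 1000000 in
theorem trace_smul_epsContr (A Y : Tensor2 𝕜) : A.trace • epsContr Y =
    epsContr (A * Y + Y * Aᵀ) + Aᵀ * epsContr Y + epsContr Y * A := by
  have e := epsContr_values (𝕜 := 𝕜)
  ext a b
  simp only [Matrix.smul_apply, Matrix.add_apply, smul_eq_mul, Matrix.mul_apply, Matrix.trace,
    Fin.sum_univ_four, Matrix.diag_apply, Matrix.transpose_apply]
  fin_cases a <;> fin_cases b <;>
    simp only [Fin.zero_eta, Fin.mk_one, Fin.reduceFinMk, e, Matrix.add_apply, Matrix.mul_apply,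
      Fin.sum_univ_four, Matrix.transpose_apply] <;> ring

theorem epsContr_add (X Y : Tensor2 𝕜) : epsContr (X + Y) = epsContr X + epsContr Y := by
  ext a b
  simp [epsContr, mul_add, Finset.sum_add_distrib]

theorem trace_cast (A : Tensor2 ℝ) : (cast 𝕜 A).trace = ((A.trace : ℝ) : 𝕜) := by
  simp [Matrix.trace]

end

namespace AdaptedOn

variable {O : Set E4} {G : E4 → Tensor2 ℝ} {η : E4 → Tensor4 ℝ} {U : E4 → Tensor2 ℝ} {x : E4}
  {𝕜 : Type} [RCLike 𝕜]

theorem hodge_eq (h : AdaptedOn O G η U) (hx : x ∈ O) (F : Tensor2 𝕜) :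
    hodge (G x) (η x) F = ((1 / 2) * (η x 0 1 2 3 : 𝕜)) •
      epsContr (cast 𝕜 (G x)⁻¹ * F * cast 𝕜 (G x)⁻¹) := by
  ext a b
  rw [hodge, act_apply, ← cast_transpose, h.inv_symm hx, Matrix.smul_apply, smul_eq_mul, mul_assoc (1 / 2 : 𝕜)]
  congr 1
  simp only [epsContr, Matrix.of_apply, Finset.mul_sum]
  refine Finset.sum_congr rfl fun m _ => Finset.sum_congr rfl fun n _ => ?_
  rw [h.vol_eq hx a b m n]
  push_cast
  ring

theorem smooth_epsContr {Y : E4 → Tensor2 𝕜} (hY : SmoothMat Y x) :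
    SmoothMat (fun y => epsContr (Y y)) x := by
  intro a b
  simp only [epsContr, Matrix.of_apply]
  exact ContDiffAt.sum fun m _ => ContDiffAt.sum fun n _ => contDiffAt_const.mul (hY m n)

theorem dMat_epsContr {Y : E4 → Tensor2 𝕜} (hY : SmoothMat Y x) (k : Fin 4) :
    dMat (fun y => epsContr (Y y)) x k = epsContr (dMat Y x k) := by
  ext a b
  simp only [epsContr, Matrix.of_apply, dMat]
  rw [pd_sum _ fun m _ => ContDiffAt.sum fun n _ => contDiffAt_const.mul (hY m n)]
  refine Finset.sum_congr rfl fun m _ => ?_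
  rw [pd_sum _ fun n _ => contDiffAt_const.mul (hY m n)]
  exact Finset.sum_congr rfl fun n _ => pd_const_mul _ (hY m n) k

theorem smooth_hodge (h : AdaptedOn O G η U) (hx : x ∈ O) {F : E4 → Tensor2 𝕜}
    (hF : SmoothMat F x) : SmoothMat (fun y => hodge (G y) (η y) (F y)) x := by
  have hg : SmoothMat (fun y => cast 𝕜 (G y)⁻¹) x := (h.smooth_inv hx).cast
  refine SmoothMat.congr (SmoothMat.smul (contDiffAt_const.mul (contDiffAt_ofReal
    (h.smooth_vol x hx 0 1 2 3))) (smooth_epsContr ((hg.mul hF).mul hg)))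
    (Filter.eventually_of_mem (h.mem_nhds hx) fun y hy => h.hodge_eq hy (F y))

/-- The dual is built from η and g⁻¹, which are parallel. Concretely, the trace of Γ coming from ∂η
is absorbed by `trace_smul_epsContr`, which supplies the Γ-terms of the covariant derivative. -/
theorem covMat_hodge (h : AdaptedOn O G η U) (hx : x ∈ O) {F : E4 → Tensor2 𝕜}
    (hF : SmoothMat F x) (k : Fin 4) :
    covMat G (fun y => hodge (G y) (η y) (F y)) x k = hodge (G x) (η x) (covMat G F x k) := by
  have hg : SmoothMat (fun y => cast 𝕜 (G y)⁻¹) x := (h.smooth_inv hx).cast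
  have hs : ContDiffAt ℝ ∞ (fun y => (1 / 2 : 𝕜) * (η y 0 1 2 3 : 𝕜)) x :=
    contDiffAt_const.mul (contDiffAt_ofReal (h.smooth_vol x hx 0 1 2 3))
  have hY := (hg.mul hF).mul hg
  have e : (fun y => hodge (G y) (η y) (F y)) =ᶠ[𝓝 x] fun y =>
      ((1 / 2) * (η y 0 1 2 3 : 𝕜)) • epsContr (cast 𝕜 (G y)⁻¹ * F y * cast 𝕜 (G y)⁻¹) :=
    Filter.eventually_of_mem (h.mem_nhds hx) fun y hy => h.hodge_eq hy (F y)
  have hds : pd (fun y => (1 / 2 : 𝕜) * (η y 0 1 2 3 : 𝕜)) x k =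
      (1 / 2 : 𝕜) * (η x 0 1 2 3 : 𝕜) * (cast 𝕜 (Gam G x k)).trace := by
    rw [pd_const_mul _ (contDiffAt_ofReal (h.smooth_vol x hx 0 1 2 3)),
      pd_ofReal (h.smooth_vol x hx 0 1 2 3), h.pd_vol hx, trace_cast]
    push_cast
    ring
  have hdg : dMat (fun y => cast 𝕜 (G y)⁻¹) x k =
      -(cast 𝕜 (G x)⁻¹ * (cast 𝕜 (Gam G x k))ᵀ) - cast 𝕜 (Gam G x k) * cast 𝕜 (G x)⁻¹ := by
    rw [dMat_cast (h.smooth_inv hx), h.dMat_inv hx, cast_sub, cast_neg, cast_mul, cast_mul,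
      cast_transpose]
  rw [covMat, dMat_congr e, dMat_smul hs (smooth_epsContr hY), dMat_epsContr hY,
    dMat_mul (hg.mul hF) hg, dMat_mul hg hF, h.hodge_eq hx, h.hodge_eq hx, hds, hdg, mul_smul,
    trace_smul_epsContr]
  set A := cast 𝕜 (Gam G x k)
  set g := cast 𝕜 (G x)⁻¹
  set c : 𝕜 := (1 / 2) * (η x 0 1 2 3 : 𝕜)
  simp only [Matrix.mul_smul, Matrix.smul_mul, ← smul_add, ← smul_sub]
  congr 1
  -- Raising indices commutes with ∇: the Γ-terms acting on upper indices are traded for those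
  -- acting on lower ones.
  have key : g * covMat G F x k * g =
      (A * (g * F x * g) + g * F x * g * Aᵀ) +
      (((-(g * Aᵀ) - A * g) * F x + g * dMat F x k) * g + g * F x * (-(g * Aᵀ) - A * g)) := by
    simp only [covMat]
    noncomm_ring
  rw [key, epsContr_add _ (_ + _)]
  abel

theorem covMat_metric (h : AdaptedOn O G η U) (hx : x ∈ O) (m : Fin 4) : covMat G G x m = 0 := by
  have hc : ∀ A : Tensor2 ℝ, cast ℝ A = A := fun A => rfl
  rw [covMat, h.dMat_metric hx, hc]
  abel

/-- Leibniz rule; the derivative of the intermediate g⁻¹ is cancelled by the connection terms, since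
g⁻¹ is parallel. -/
theorem covMat_dot (h : AdaptedOn O G η U) (hx : x ∈ O) {F H : E4 → Tensor2 𝕜}
    (hF : SmoothMat F x) (hH : SmoothMat H x) (m : Fin 4) :
    covMat G (fun y => dot (G y) (F y) (H y)) x m =
      dot (G x) (covMat G F x m) (H x) + dot (G x) (F x) (covMat G H x m) := by
  have hg : SmoothMat (fun y => cast 𝕜 (G y)⁻¹) x := (h.smooth_inv hx).cast
  have hdg : dMat (fun y => cast 𝕜 (G y)⁻¹) x m =
      -(cast 𝕜 (G x)⁻¹ * (cast 𝕜 (Gam G x m))ᵀ) - cast 𝕜 (Gam G x m) * cast 𝕜 (G x)⁻¹ := by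
    rw [dMat_cast (h.smooth_inv hx), h.dMat_inv hx, cast_sub, cast_neg, cast_mul, cast_mul,
      cast_transpose]
  simp only [dot_eq, covMat]
  rw [dMat_mul (hF.mul hg) hH, dMat_mul hF hg, hdg]
  noncomm_ring

end AdaptedOn

/-- The curvature matrices `(R_{kn})^a_b`. -/
def Curv (G : E4 → Tensor2 ℝ) (x : E4) (k n : Fin 4) : Tensor2 ℝ :=
  Matrix.of fun a b => riemannUp G x a b k n

namespace AdaptedOn

variable {O : Set E4} {G : E4 → Tensor2 ℝ} {η : E4 → Tensor4 ℝ} {U : E4 → Tensor2 ℝ} {x : E4}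
  {𝕜 : Type} [RCLike 𝕜]

theorem curv_eq (k n : Fin 4) : Curv G x k n =
    dMat (fun y => Gam G y n) x k - dMat (fun y => Gam G y k) x n +
      (Gam G x k * Gam G x n - Gam G x n * Gam G x k) := by
  ext a b
  simp [Curv, riemannUp, dMat, Gam, Matrix.mul_apply, Finset.sum_sub_distrib]

/-- The Ricci identity for 2-tensors. -/
theorem ricci_identity (h : AdaptedOn O G η U) (hx : x ∈ O) {F : E4 → Tensor2 𝕜}
    (hF : SmoothMat F x) (k n : Fin 4) :
    covMat G (fun y => covMat G F y n) x k - covMat G (fun y => covMat G F y k) x n =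
      -((cast 𝕜 (Curv G x k n))ᵀ * F x) - F x * cast 𝕜 (Curv G x k n) := by
  have hΓ : ∀ m, SmoothMat (fun y => cast 𝕜 (Gam G y m)) x := fun m => (h.smooth_Gam hx m).cast
  have hd : ∀ k n, dMat (fun y => covMat G F y n) x k = dMat (fun y => dMat F y n) x k
      - ((cast 𝕜 (dMat (fun y => Gam G y n) x k))ᵀ * F x + (cast 𝕜 (Gam G x n))ᵀ * dMat F x k)
      - (dMat F x k * cast 𝕜 (Gam G x n) + F x * cast 𝕜 (dMat (fun y => Gam G y n) x k)) := by
    intro k n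
    simp only [covMat]
    rw [dMat_sub ((hF.dMat n).sub ((hΓ n).transpose.mul hF)) (hF.mul (hΓ n)),
      dMat_sub (hF.dMat n) ((hΓ n).transpose.mul hF), dMat_mul (hΓ n).transpose hF,
      dMat_mul hF (hΓ n), dMat_transpose, dMat_cast (h.smooth_Gam hx n)]
  have e : ∀ k n, covMat G (fun y => covMat G F y n) x k = dMat (fun y => covMat G F y n) x k -
      (cast 𝕜 (Gam G x k))ᵀ * covMat G F x n - covMat G F x n * cast 𝕜 (Gam G x k) :=
    fun _ _ => rfl
  rw [e, e, hd, hd, dMat_comm hF k n, curv_eq]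
  simp only [covMat, cast_add, cast_sub, cast_mul, Matrix.transpose_add, Matrix.transpose_sub,
    Matrix.transpose_mul]
  noncomm_ring

end AdaptedOn

end Umbilic

/-! ### Algebraic symmetries of the Riemann and Weyl tensors -/

namespace Umbilic
open Matrix Filter Topology

/-- The algebraic symmetries of a curvature tensor. -/
structure IsCurvatureLike (R : Tensor4 ℝ) : Prop where
  anti_left : ∀ a b c d, R a b c d = -R b a c d
  anti_right : ∀ a b c d, R a b c d = -R a b d c
  cyclic : ∀ a b c d, R a b c d + R a c d b + R a d b c = 0

/-- The octahedron argument: four cyclic identities, combined using the two antisymmetries. -/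
theorem IsCurvatureLike.pair {R : Tensor4 ℝ} (h : IsCurvatureLike R) (a b c d : Fin 4) :
    R a b c d = R c d a b := by
  have h1 := h.cyclic a b c d
  have h2 := h.cyclic b c d a
  have h3 := h.cyclic c d a b
  have h4 := h.cyclic d a b c
  have e1 := h.anti_left b a c d
  have e2 := h.anti_left c b d a
  have e3 := h.anti_left d c a b
  have e4 := h.anti_left a d b c
  have f1 := h.anti_right b a c d
  have f2 := h.anti_right c b d a
  have f3 := h.anti_left c a d b
  have f4 := h.anti_right a c d b
  have f5 := h.anti_left d b a c
  have f6 := h.anti_right b d a c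
  have f7 := h.anti_right d b c a
  have f8 := h.anti_right c a b d
  have f9 := h.anti_right d c b a
  have f10 := h.anti_right a d c b
  linarith

/-- The algebraic symmetries of a Weyl tensor. -/
structure IsWeylLike (g : Tensor2 ℝ) (W : Tensor4 ℝ) : Prop extends IsCurvatureLike W where
  trace : ∀ b d, ∑ a, ∑ c, g⁻¹ a c * W a b c d = 0

namespace AdaptedOn

variable {O : Set E4} {G : E4 → Tensor2 ℝ} {η : E4 → Tensor4 ℝ} {U : E4 → Tensor2 ℝ} {x : E4}

theorem riemann_eq (a b c d : Fin 4) : riemann G x a b c d = (G x * Curv G x c d) a b := by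
  simp [riemann, Matrix.mul_apply, Curv]

/-- The Ricci identity applied to the parallel tensor g: its left side vanishes. -/
theorem curv_transpose (h : AdaptedOn O G η U) (hx : x ∈ O) (k n : Fin 4) :
    (G x * Curv G x k n)ᵀ = -(G x * Curv G x k n) := by
  have hz : ∀ k n, covMat G (fun y => covMat G G y n) x k = 0 := by
    intro k n
    have e : (fun y => covMat G G y n) =ᶠ[𝓝 x] fun _ => 0 :=
      Filter.eventually_of_mem (h.mem_nhds hx) fun y hy => h.covMat_metric hy n
    rw [covMat, dMat_congr e, dMat_const, h.covMat_metric hx]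
    simp
  have h1 := h.ricci_identity hx (h.smooth_metric x hx) k n
  rw [hz, hz] at h1
  have hc : cast ℝ (Curv G x k n) = Curv G x k n := rfl
  rw [hc, sub_zero, eq_comm, sub_eq_zero] at h1
  rw [Matrix.transpose_mul, h.symm hx, ← h1, neg_neg]

theorem isCurvatureLike (h : AdaptedOn O G η U) (hx : x ∈ O) : IsCurvatureLike (riemann G x) where
  anti_left a b c d := by
    rw [riemann_eq, riemann_eq]
    exact congrFun (congrFun (h.curv_transpose hx c d) b) a
  anti_right a b c d := by
    have e : Curv G x c d = -Curv G x d c := by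
      rw [curv_eq, curv_eq]
      abel
    rw [riemann_eq, riemann_eq, e, Matrix.mul_neg, Matrix.neg_apply]
  cyclic a b c d := by
    -- First Bianchi identity: absence of torsion makes both the derivative terms and the quadratic
    -- terms cancel in the cyclic sum.
    have key : ∀ e b c d, riemannUp G x e b c d + riemannUp G x e c d b +
        riemannUp G x e d b c = 0 := by
      intro e b c d
      have hs : ∀ i j m, pd (fun y => christoffel G y e i j) x m =
          pd (fun y => christoffel G y e j i) x m := fun i j m =>
        pd_congr (Filter.eventually_of_mem (h.mem_nhds hx) fun y hy =>
          h.christoffel_symm hy e i j) m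
      simp only [riemannUp]
      rw [hs d b c, hs c b d, hs d c b]
      have h1 : ∑ k, (christoffel G x e c k * christoffel G x k d b -
          christoffel G x e d k * christoffel G x k c b) +
          ∑ k, (christoffel G x e d k * christoffel G x k b c -
          christoffel G x e b k * christoffel G x k d c) +
          ∑ k, (christoffel G x e b k * christoffel G x k c d -
          christoffel G x e c k * christoffel G x k b d) = 0 := by
        rw [← Finset.sum_add_distrib, ← Finset.sum_add_distrib]
        refine Finset.sum_eq_zero fun k _ => ?_
        rw [h.christoffel_symm hx k d b, h.christoffel_symm hx k c b, h.christoffel_symm hx k d c]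
        ring
      linear_combination h1
    simp only [riemann]
    rw [← Finset.sum_add_distrib, ← Finset.sum_add_distrib]
    refine Finset.sum_eq_zero fun e _ => ?_
    rw [← mul_add, ← mul_add, key, mul_zero]

theorem sum_inv_mul (h : AdaptedOn O G η U) (hx : x ∈ O) (b c : Fin 4) :
    ∑ a, (G x)⁻¹ b a * G x a c = if b = c then 1 else 0 := by
  have := congrFun (congrFun (h.inv_mul hx) b) c
  simpa [Matrix.mul_apply, Matrix.one_apply] using this

theorem ricci_eq (h : AdaptedOn O G η U) (hx : x ∈ O) (b d : Fin 4) :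
    ∑ a, ∑ c, (G x)⁻¹ a c * riemann G x a b c d = ricci G x b d := by
  simp only [riemann, ricci, Matrix.of_apply, Finset.mul_sum]
  rw [Finset.sum_comm]
  refine Finset.sum_congr rfl fun c _ => ?_
  rw [Finset.sum_comm]
  have : ∀ e, ∑ a, (G x)⁻¹ a c * (G x a e * riemannUp G x e b c d) =
      (if c = e then 1 else 0) * riemannUp G x e b c d := by
    intro e
    rw [← h.sum_inv_mul hx c e, Finset.sum_mul]
    refine Finset.sum_congr rfl fun a _ => ?_
    have := congrFun (congrFun (h.inv_symm hx) c) a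
    rw [Matrix.transpose_apply] at this
    rw [this, mul_assoc]
  simp [this]

theorem inv_symm_apply (h : AdaptedOn O G η U) (hx : x ∈ O) (a b : Fin 4) :
    (G x)⁻¹ a b = (G x)⁻¹ b a := congrFun (congrFun (h.inv_symm hx) b) a

theorem ricci_symm (h : AdaptedOn O G η U) (hx : x ∈ O) (b d : Fin 4) :
    ricci G x b d = ricci G x d b := by
  rw [← h.ricci_eq hx, ← h.ricci_eq hx, Finset.sum_comm]
  refine Finset.sum_congr rfl fun a _ => Finset.sum_congr rfl fun c _ => ?_
  rw [h.inv_symm_apply hx, (h.isCurvatureLike hx).pair]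

theorem isWeylLike (h : AdaptedOn O G η U) (hx : x ∈ O) : IsWeylLike (G x) (weyl G x) where
  anti_left a b c d := by
    simp only [weyl]
    rw [(h.isCurvatureLike hx).anti_left]
    ring
  anti_right a b c d := by
    simp only [weyl]
    rw [(h.isCurvatureLike hx).anti_right]
    ring
  cyclic a b c d := by
    have h1 := (h.isCurvatureLike hx).cyclic a b c d
    simp only [weyl]
    rw [h.symm_apply hx c b, h.symm_apply hx d b, h.symm_apply hx d c, h.ricci_symm hx c b,
      h.ricci_symm hx d b, h.ricci_symm hx d c]
    linear_combination h1
  trace b d := by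
    have hg := h.sum_inv_mul hx
    have h4 : ∑ a, ∑ c, (G x)⁻¹ a c * G x a c = 4 := by
      have : ∀ a, ∑ c, (G x)⁻¹ a c * G x a c = 1 := by
        intro a
        have := hg a a
        rw [if_pos rfl] at this
        rw [← this]
        exact Finset.sum_congr rfl fun c _ => by rw [h.symm_apply hx a c]
      simp [this]
    have hR : ∀ X : Tensor2 ℝ, ∀ b d, ∑ a, ∑ c, (G x)⁻¹ a c * (G x a d * X b c) = X b d := by
      intro X b d
      rw [Finset.sum_comm]
      have : ∀ c, ∑ a, (G x)⁻¹ a c * (G x a d * X b c) = (if c = d then 1 else 0) * X b c := by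
        intro c
        rw [← hg c d, Finset.sum_mul]
        exact Finset.sum_congr rfl fun a _ => by rw [h.inv_symm_apply hx a c, mul_assoc]
      simp [this]
    have hR' : ∀ X : Tensor2 ℝ, ∀ b d, ∑ a, ∑ c, (G x)⁻¹ a c * (G x b c * X a d) = X b d := by
      intro X b d
      have : ∀ a, ∑ c, (G x)⁻¹ a c * (G x b c * X a d) = (if a = b then 1 else 0) * X a d := by
        intro a
        rw [← hg a b, Finset.sum_mul]
        exact Finset.sum_congr rfl fun c _ => by rw [h.symm_apply hx b c, mul_assoc]
      simp [this]
    -- Arranged for term-by-term contraction. With tr g = 4 the total is Ric − ½(2 Ric + s g) + ½ s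
    -- g = 0.
    have e : ∀ a c, (G x)⁻¹ a c * weyl G x a b c d = (G x)⁻¹ a c * riemann G x a b c d
        - (1 / 2) * (((G x)⁻¹ a c * G x a c) * ricci G x b d
          + G x b d * ((G x)⁻¹ a c * ricci G x a c)
          - (G x)⁻¹ a c * (G x a d * ricci G x b c) - (G x)⁻¹ a c * (G x b c * ricci G x a d))
        + (1 / 6) * scalarCurvature G x * (((G x)⁻¹ a c * G x a c) * G x b d
          - (G x)⁻¹ a c * (G x a d * G x b c)) := by
      intro a c
      simp only [weyl]
      ring
    simp only [e, Finset.sum_add_distrib, Finset.sum_sub_distrib, ← Finset.mul_sum,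
      ← Finset.sum_mul, hR, hR', h4, h.ricci_eq hx]
    rw [← scalarCurvature]
    ring

end AdaptedOn

end Umbilic

/-! ### The Weyl tensor as a complex 3×3 matrix -/

namespace Umbilic
open Matrix Filter Topology

/-- Components of a tensor with four lower indices in the frame given by the columns of `P`. -/
def pull (P : Tensor2 ℝ) (W : Tensor4 ℝ) : Tensor4 ℝ := fun A B C D =>
  ∑ a, ∑ b, ∑ c, ∑ d, P a A * P b B * (P c C * P d D) * W a b c d

theorem pull_isCurvatureLike (P : Tensor2 ℝ) {W : Tensor4 ℝ} (h : IsCurvatureLike W) :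
    IsCurvatureLike (pull P W) where
  anti_left A B C D := by
    simp only [pull]
    rw [Finset.sum_comm]
    simp only [← Finset.sum_neg_distrib]
    refine Finset.sum_congr rfl fun a _ => Finset.sum_congr rfl fun b _ =>
      Finset.sum_congr rfl fun c _ => Finset.sum_congr rfl fun d _ => ?_
    rw [h.anti_left]
    ring
  anti_right A B C D := by
    simp only [pull, ← Finset.sum_neg_distrib]
    refine Finset.sum_congr rfl fun a _ => Finset.sum_congr rfl fun b _ => ?_
    rw [Finset.sum_comm]
    refine Finset.sum_congr rfl fun c _ => Finset.sum_congr rfl fun d _ => ?_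
    rw [h.anti_right]
    ring
  cyclic A B C D := by
    simp only [pull]
    rw [← Finset.sum_add_distrib, ← Finset.sum_add_distrib]
    refine Finset.sum_eq_zero fun a _ => ?_
    have r1 : ∀ f : Fin 4 → Fin 4 → Fin 4 → ℝ,
        ∑ b, ∑ c, ∑ d, f b c d = ∑ d, ∑ b, ∑ c, f b c d := by
      intro f
      calc ∑ b, ∑ c, ∑ d, f b c d = ∑ b, ∑ d, ∑ c, f b c d :=
            Finset.sum_congr rfl fun b _ => Finset.sum_comm
        _ = _ := Finset.sum_comm
    -- The summation indices are rotated so that the three sums carry the same frame coefficients.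
    rw [r1 fun b c d => P a A * P b C * (P c D * P d B) * W a b c d,
      r1 fun b c d => P a A * P b D * (P c B * P d C) * W a b c d,
      r1 fun d b c => P a A * P b D * (P c B * P d C) * W a b c d]
    simp only [← Finset.sum_add_distrib]
    refine Finset.sum_eq_zero fun b _ => Finset.sum_eq_zero fun c _ =>
      Finset.sum_eq_zero fun d _ => ?_
    linear_combination P a A * P b B * (P c C * P d D) * h.cyclic a b c d

theorem IsAdapted.pull_isWeylLike {Q g U : Tensor2 ℝ} {η : Tensor4 ℝ} (hQ : IsAdapted Q g η U)
    {W : Tensor4 ℝ} (h : IsWeylLike g W) : IsWeylLike mink (pull Q⁻¹ W) where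
  toIsCurvatureLike := pull_isCurvatureLike _ h.toIsCurvatureLike
  trace B D := by
    set P := Q⁻¹ with hP
    have hg : ∀ a c, g⁻¹ a c = ∑ A, ∑ C, mink A C * (P a A * P c C) := by
      intro a c
      rw [hQ.inv_metric]
      simp only [Matrix.mul_apply, Matrix.transpose_apply, Finset.sum_mul]
      rw [Finset.sum_comm]
      exact Finset.sum_congr rfl fun A _ => Finset.sum_congr rfl fun C _ => by ring
    have h1 : ∑ b, ∑ d, P b B * P d D * ∑ a, ∑ c, g⁻¹ a c * W a b c d = 0 := by
      simp [h.trace]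
    rw [← h1, mink_inv]
    simp only [hg, pull, Finset.mul_sum, Finset.sum_mul]
    calc ∑ A, ∑ C, ∑ a, ∑ b, ∑ c, ∑ d, mink A C * (P a A * P b B * (P c C * P d D) * W a b c d)
        = ∑ A, ∑ C, ∑ b, ∑ d, ∑ a, ∑ c,
          mink A C * (P a A * P b B * (P c C * P d D) * W a b c d) := by
          refine Finset.sum_congr rfl fun A _ => Finset.sum_congr rfl fun C _ => ?_
          rw [Finset.sum_comm]
          refine Finset.sum_congr rfl fun b _ => ?_
          rw [Finset.sum_comm (s := (Finset.univ : Finset (Fin 4)))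
            (f := fun d a => ∑ c, mink A C * (P a A * P b B * (P c C * P d D) * W a b c d))]
          exact Finset.sum_congr rfl fun a _ => Finset.sum_comm
      _ = ∑ b, ∑ d, ∑ A, ∑ C, ∑ a, ∑ c,
          mink A C * (P a A * P b B * (P c C * P d D) * W a b c d) :=
          sum_comm₄ fun b d A C => ∑ a, ∑ c,
            mink A C * (P a A * P b B * (P c C * P d D) * W a b c d)
      _ = _ := by
          refine Finset.sum_congr rfl fun b _ => Finset.sum_congr rfl fun d _ => ?_
          rw [sum_comm₄ fun a c A C => mink A C * (P a A * P b B * (P c C * P d D) * W a b c d)]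
          refine Finset.sum_congr rfl fun a _ => Finset.sum_congr rfl fun c _ =>
            Finset.sum_congr rfl fun A _ => Finset.sum_congr rfl fun C _ => ?_
          ring

/-- Invertibility of the transpose of `P` is used four times, once for each index. -/
theorem eq_zero_of_pull {P : Tensor2 ℝ} (hP : IsUnit P.det) {W : Tensor4 ℝ} (h : pull P W = 0) :
    W = 0 := by
  have key : ∀ v : Fin 4 → ℝ, (∀ D, ∑ d, P d D * v d = 0) → v = 0 := by
    intro v hv
    have h1 : Pᵀ *ᵥ v = 0 := by
      ext D
      simpa [Matrix.mulVec, dotProduct] using hv D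
    have h2 : Pᵀ⁻¹ *ᵥ (Pᵀ *ᵥ v) = v := by
      rw [Matrix.mulVec_mulVec, Matrix.nonsing_inv_mul _ (by rwa [Matrix.det_transpose]),
        Matrix.one_mulVec]
    rw [← h2, h1, Matrix.mulVec_zero]
  have h4 : ∀ A B C D, ∑ a, P a A * ∑ b, P b B * ∑ c, P c C * ∑ d, P d D * W a b c d = 0 := by
    intro A B C D
    have : pull P W A B C D = 0 := by rw [h]; rfl
    rw [← this, pull]
    simp only [Finset.mul_sum]
    refine Finset.sum_congr rfl fun a _ => Finset.sum_congr rfl fun b _ =>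
      Finset.sum_congr rfl fun c _ => Finset.sum_congr rfl fun d _ => ?_
    ring
  funext a b c d
  have h3 : ∀ B C D a, ∑ b, P b B * ∑ c, P c C * ∑ d, P d D * W a b c d = 0 := fun B C D =>
    congrFun (key _ fun A => h4 A B C D)
  have h2 : ∀ C D a b, ∑ c, P c C * ∑ d, P d D * W a b c d = 0 := fun C D a =>
    congrFun (key _ fun B => h3 B C D a)
  have h1 : ∀ D a b c, ∑ d, P d D * W a b c d = 0 := fun D a b =>
    congrFun (key _ fun C => h2 C D a b)
  exact congrFun (key _ fun D => h1 D a b c) d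

/-- The matrix of a double 2-form with respect to a triple of bivectors. -/
def weylForm (g : Tensor2 ℝ) (W : Tensor4 ℝ) (e : Fin 3 → Tensor2 ℂ) (j i : Fin 3) : ℂ :=
  (1 / 2) * ∑ a, ∑ b, (cast ℂ g⁻¹ * e i * cast ℂ g⁻¹) b a *
    ∑ m, ∑ n, (cast ℂ g⁻¹ * e j * cast ℂ g⁻¹) m n * (W a b m n : ℂ)

theorem sum_conj_mul (P S : Tensor2 ℂ) (f : Fin 4 → Fin 4 → ℂ) :
    ∑ m, ∑ n, (P * S * Pᵀ) m n * f m n =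
      ∑ M, ∑ N, S M N * ∑ m, ∑ n, P m M * P n N * f m n := by
  simp only [Matrix.mul_apply, Matrix.transpose_apply, Finset.mul_sum, Finset.sum_mul]
  rw [← sum_comm₄, Finset.sum_comm]
  exact Finset.sum_congr rfl fun M _ => Finset.sum_congr rfl fun N _ =>
    Finset.sum_congr rfl fun m _ => Finset.sum_congr rfl fun n _ => by ring

theorem IsAdapted.weylForm_eq {Q g U : Tensor2 ℝ} {η : Tensor4 ℝ} (hQ : IsAdapted Q g η U)
    (W : Tensor4 ℝ) (j i : Fin 3) :
    weylForm g W (sdFrame Q) j i = weylForm mink (pull Q⁻¹ W) sdStd j i := by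
  have hr : ∀ k, cast ℂ g⁻¹ * sdFrame Q k * cast ℂ g⁻¹ =
      cast ℂ Q⁻¹ * (cast ℂ mink * sdStd k * cast ℂ mink) * (cast ℂ Q⁻¹)ᵀ := by
    intro k
    have := hQ.raise (sdStd k)
    rwa [← cast_transpose g⁻¹, hQ.inv_metric_transpose] at this
  simp only [weylForm, hr, mink_inv]
  set P := cast ℂ Q⁻¹
  set S : Fin 3 → Tensor2 ℂ := fun k => cast ℂ mink * sdStd k * cast ℂ mink
  congr 1
  rw [Finset.sum_comm]
  simp only [sum_conj_mul]
  rw [Finset.sum_comm]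
  refine Finset.sum_congr rfl fun A _ => Finset.sum_congr rfl fun B _ => ?_
  congr 1
  simp only [Finset.mul_sum]
  rw [sum_comm₄]
  refine Finset.sum_congr rfl fun M _ => Finset.sum_congr rfl fun N _ => ?_
  simp only [pull, Complex.ofReal_sum, Complex.ofReal_mul, Finset.mul_sum]
  rw [Finset.sum_comm]
  refine Finset.sum_congr rfl fun a _ => Finset.sum_congr rfl fun b _ =>
    Finset.sum_congr rfl fun m _ => Finset.sum_congr rfl fun n _ => ?_
  simp only [P, cast_apply]
  simp only [Complex.coe_algebraMap]
  ring

theorem sum_sdStd_zero (f : Fin 4 → Fin 4 → ℂ) :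
    ∑ m, ∑ n, (cast ℂ mink * sdStd 0 * cast ℂ mink) m n * f m n =
      rt * (f 1 0 - f 0 1 + Complex.I * (f 2 3 - f 3 2)) := by
  simp [cast_mink, sdStd, Fin.sum_univ_four]; ring

theorem sum_sdStd_one (f : Fin 4 → Fin 4 → ℂ) :
    ∑ m, ∑ n, (cast ℂ mink * sdStd 1 * cast ℂ mink) m n * f m n =
      rt * (f 2 0 - f 0 2 + Complex.I * (f 3 1 - f 1 3)) := by
  simp [cast_mink, sdStd, Fin.sum_univ_four]; ring

theorem sum_sdStd_two (f : Fin 4 → Fin 4 → ℂ) :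
    ∑ m, ∑ n, (cast ℂ mink * sdStd 2 * cast ℂ mink) m n * f m n =
      rt * (f 3 0 - f 0 3 + Complex.I * (f 1 2 - f 2 1)) := by
  simp [cast_mink, sdStd, Fin.sum_univ_four]; ring

/-- With k = j + 1 and (p, q) the cyclic complement of k among the space indices, `sdStd j` is θ⁰ ∧
θᵏ + i θᵖ ∧ θ^q divided by √2; raising indices flips the sign of the first term. -/
theorem sum_sdStd (j : Fin 3) (f : Fin 4 → Fin 4 → ℂ) :
    ∑ m, ∑ n, (cast ℂ mink * sdStd j * cast ℂ mink) m n * f m n =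
      rt * (f (![1, 2, 3] j) 0 - f 0 (![1, 2, 3] j) +
        Complex.I * (f (![2, 3, 1] j) (![3, 1, 2] j) - f (![3, 1, 2] j) (![2, 3, 1] j))) := by
  fin_cases j
  · exact sum_sdStd_zero f
  · exact sum_sdStd_one f
  · exact sum_sdStd_two f

/-- Bilinear expansion on the bivectors −θ⁰ᵏ + i θᵖ^q. The electric-type components form the real
part and the mixed ones the imaginary part. -/
theorem weylForm_mink {W : Tensor4 ℝ} (h : IsCurvatureLike W) (j i : Fin 3) :
    weylForm mink W sdStd j i =
      ((W ((![2, 3, 1] : Fin 3 → Fin 4) i) ((![3, 1, 2] : Fin 3 → Fin 4) i) ((![2, 3, 1] : Fin 3 → Fin 4) j) ((![3, 1, 2] : Fin 3 → Fin 4) j) -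
        W 0 ((![1, 2, 3] : Fin 3 → Fin 4) i) 0 ((![1, 2, 3] : Fin 3 → Fin 4) j) : ℝ) : ℂ) +
      Complex.I * ((W 0 ((![1, 2, 3] : Fin 3 → Fin 4) i) ((![2, 3, 1] : Fin 3 → Fin 4) j) ((![3, 1, 2] : Fin 3 → Fin 4) j) +
        W ((![2, 3, 1] : Fin 3 → Fin 4) i) ((![3, 1, 2] : Fin 3 → Fin 4) i) 0 ((![1, 2, 3] : Fin 3 → Fin 4) j) : ℝ) : ℂ) := by
  rw [weylForm, Finset.sum_comm]
  simp only [mink_inv, sum_sdStd]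
  generalize (![1, 2, 3] : Fin 3 → Fin 4) i = k'
  generalize (![2, 3, 1] : Fin 3 → Fin 4) i = p'
  generalize (![3, 1, 2] : Fin 3 → Fin 4) i = q'
  generalize (![1, 2, 3] : Fin 3 → Fin 4) j = k
  generalize (![2, 3, 1] : Fin 3 → Fin 4) j = p
  generalize (![3, 1, 2] : Fin 3 → Fin 4) j = q
  have r : ∀ a b, W a b k 0 = -W a b 0 k := fun a b => h.anti_right _ _ _ _
  have r' : ∀ a b, W a b q p = -W a b p q := fun a b => h.anti_right _ _ _ _
  have l : ∀ a b, W k' 0 a b = -W 0 k' a b := fun a b => h.anti_left _ _ _ _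
  have l' : ∀ a b, W q' p' a b = -W p' q' a b := fun a b => h.anti_left _ _ _ _
  simp only [r, r', l, l']
  push_cast
  have h2 := rt_mul_rt
  have h3 := Complex.I_mul_I
  linear_combination ((W p' q' p q - W 0 k' 0 k : ℂ) +
      Complex.I * (W 0 k' p q + W p' q' 0 k) : ℂ) * 2 * h2 - (rt * rt * 2 * W p' q' p q : ℂ) * h3

theorem weylForm_symm {W : Tensor4 ℝ} (h : IsCurvatureLike W) (j i : Fin 3) :
    weylForm mink W sdStd j i = weylForm mink W sdStd i j := by
  rw [weylForm_mink h, weylForm_mink h]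
  have p := h.pair
  rw [p (_ : Fin 4) _ ((![2, 3, 1] : Fin 3 → Fin 4) j), p 0 _ 0 _,
    p 0 _ ((![2, 3, 1] : Fin 3 → Fin 4) j), p _ _ 0 ((![1, 2, 3] : Fin 3 → Fin 4) j)]
  push_cast
  ring

theorem IsWeylLike.trace_mink {W : Tensor4 ℝ} (h : IsWeylLike mink W) (b d : Fin 4) :
    -W 0 b 0 d + W 1 b 1 d + W 2 b 2 d + W 3 b 3 d = 0 := by
  have := h.trace b d
  rw [mink_inv] at this
  simpa [mink, Fin.sum_univ_four] using this

theorem IsCurvatureLike.diag {W : Tensor4 ℝ} (h : IsCurvatureLike W) (a c d : Fin 4) :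
    W a a c d = 0 ∧ W c d a a = 0 := by
  have h1 := h.anti_left a a c d
  have h2 := h.anti_right c d a a
  constructor <;> linarith

/-- The real part vanishes because W is trace-free, the imaginary part by the cyclic identity. -/
theorem weylForm_trace {W : Tensor4 ℝ} (h : IsWeylLike mink W) :
    weylForm mink W sdStd 0 0 + weylForm mink W sdStd 1 1 + weylForm mink W sdStd 2 2 = 0 := by
  have hc := h.toIsCurvatureLike
  rw [weylForm_mink hc, weylForm_mink hc, weylForm_mink hc]
  have t := h.trace_mink
  have t0 := t 0 0
  have t1 := t 1 1
  have t2 := t 2 2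
  have t3 := t 3 3
  have l := hc.anti_left
  have r := hc.anti_right
  have d := hc.diag
  have c := hc.cyclic 0 1 2 3
  have p := hc.pair
  simp only [d, l 1 0, l 2 0, l 3 0, l 2 1, l 3 1, l 3 2, r _ _ 1 0, r _ _ 2 0, r _ _ 3 0,
    r _ _ 2 1, r _ _ 3 1, r _ _ 3 2] at t0 t1 t2 t3 c
  simp only [Matrix.cons_val]
  rw [l 3 1, r _ _ 3 1, r _ _ 3 1, l 3 1, p 2 3 0 1, p 1 3 0 2, p 1 2 0 3]
  have e1 : (W 2 3 2 3 - W 0 1 0 1) + (-(-W 1 3 1 3) - W 0 2 0 2) + (W 1 2 1 2 - W 0 3 0 3) = 0 := by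
    linarith
  have e2 : (W 0 1 2 3 + W 0 1 2 3) + (-W 0 2 1 3 + -W 0 2 1 3) + (W 0 3 1 2 + W 0 3 1 2) = 0 := by
    linarith
  have e1' := congrArg (fun z : ℝ => (z : ℂ)) e1
  have e2' := congrArg (fun z : ℝ => (z : ℂ)) e2
  push_cast at e1' e2' ⊢
  linear_combination e1' + Complex.I * e2'

-- A real Weyl-like tensor is determined by its SD half. Real and imaginary parts of the entries,
-- together with the trace conditions, are a linear system that annihilates each of the 21
-- components left by the pair symmetries.
set_option linter.unusedSimpArgs false in
theorem eq_zero_of_weylForm {W : Tensor4 ℝ} (h : IsWeylLike mink W)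
    (hw : ∀ j i, weylForm mink W sdStd j i = 0) : W = 0 := by
  have hc := h.toIsCurvatureLike
  have hre : ∀ j i, W ((![2, 3, 1] : Fin 3 → Fin 4) i) ((![3, 1, 2] : Fin 3 → Fin 4) i)
      ((![2, 3, 1] : Fin 3 → Fin 4) j) ((![3, 1, 2] : Fin 3 → Fin 4) j) -
      W 0 ((![1, 2, 3] : Fin 3 → Fin 4) i) 0 ((![1, 2, 3] : Fin 3 → Fin 4) j) = 0 := by
    intro j i
    have := congrArg Complex.re (hw j i)
    rw [weylForm_mink hc] at this
    simpa using this
  have him : ∀ j i, W 0 ((![1, 2, 3] : Fin 3 → Fin 4) i) ((![2, 3, 1] : Fin 3 → Fin 4) j)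
      ((![3, 1, 2] : Fin 3 → Fin 4) j) + W ((![2, 3, 1] : Fin 3 → Fin 4) i)
      ((![3, 1, 2] : Fin 3 → Fin 4) i) 0 ((![1, 2, 3] : Fin 3 → Fin 4) j) = 0 := by
    intro j i
    have := congrArg Complex.im (hw j i)
    rw [weylForm_mink hc] at this
    simpa using this
  have t := h.trace_mink
  have l := hc.anti_left
  have r := hc.anti_right
  have d := hc.diag
  have p := hc.pair
  have a00 := hre 0 0
  have b00 := him 0 0
  have a01 := hre 0 1
  have b01 := him 0 1
  have a02 := hre 0 2
  have b02 := him 0 2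
  have a10 := hre 1 0
  have b10 := him 1 0
  have a11 := hre 1 1
  have b11 := him 1 1
  have a12 := hre 1 2
  have b12 := him 1 2
  have a20 := hre 2 0
  have b20 := him 2 0
  have a21 := hre 2 1
  have b21 := him 2 1
  have a22 := hre 2 2
  have b22 := him 2 2
  have t00 := t 0 0
  have t01 := t 0 1
  have t02 := t 0 2
  have t03 := t 0 3
  have t11 := t 1 1
  have t12 := t 1 2
  have t13 := t 1 3
  have t22 := t 2 2
  have t23 := t 2 3
  have t33 := t 3 3
  simp only [Matrix.cons_val, d, l 1 0, l 2 0, l 3 0, l 2 1, l 3 1, l 3 2, r _ _ 1 0, r _ _ 2 0,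
      r _ _ 3 0, r _ _ 2 1, r _ _ 3 1, r _ _ 3 2, p 0 2 0 1, p 0 3 0 1, p 0 3 0 2, p 1 2 0 1, p 1 2 0 2, p 1 2 0 3, p 1 3 0 1, p 1 3 0 2,
      p 1 3 0 3, p 1 3 1 2, p 2 3 0 1, p 2 3 0 2, p 2 3 0 3, p 2 3 1 2, p 2 3 1 3] at a00 b00 a01 b01 a02 b02 a10 b10
  simp only [Matrix.cons_val, d, l 1 0, l 2 0, l 3 0, l 2 1, l 3 1, l 3 2, r _ _ 1 0, r _ _ 2 0,
      r _ _ 3 0, r _ _ 2 1, r _ _ 3 1, r _ _ 3 2, p 0 2 0 1, p 0 3 0 1, p 0 3 0 2, p 1 2 0 1, p 1 2 0 2, p 1 2 0 3, p 1 3 0 1, p 1 3 0 2,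
      p 1 3 0 3, p 1 3 1 2, p 2 3 0 1, p 2 3 0 2, p 2 3 0 3, p 2 3 1 2, p 2 3 1 3] at a11 b11 a12 b12 a20 b20 a21
  simp only [Matrix.cons_val, d, l 1 0, l 2 0, l 3 0, l 2 1, l 3 1, l 3 2, r _ _ 1 0, r _ _ 2 0,
      r _ _ 3 0, r _ _ 2 1, r _ _ 3 1, r _ _ 3 2, p 0 2 0 1, p 0 3 0 1, p 0 3 0 2, p 1 2 0 1, p 1 2 0 2, p 1 2 0 3, p 1 3 0 1, p 1 3 0 2,
      p 1 3 0 3, p 1 3 1 2, p 2 3 0 1, p 2 3 0 2, p 2 3 0 3, p 2 3 1 2, p 2 3 1 3] at b21 a22 b22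
  simp only [d, l 1 0, l 2 0, l 3 0, l 2 1, l 3 1, l 3 2, r _ _ 1 0, r _ _ 2 0,
      r _ _ 3 0, r _ _ 2 1, r _ _ 3 1, r _ _ 3 2, p 0 2 0 1, p 0 3 0 1, p 0 3 0 2, p 1 2 0 1, p 1 2 0 2, p 1 2 0 3, p 1 3 0 1, p 1 3 0 2,
      p 1 3 0 3, p 1 3 1 2, p 2 3 0 1, p 2 3 0 2, p 2 3 0 3, p 2 3 1 2, p 2 3 1 3] at t00 t01 t02 t03 t11 t12
  simp only [d, l 1 0, l 2 0, l 3 0, l 2 1, l 3 1, l 3 2, r _ _ 1 0, r _ _ 2 0,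
      r _ _ 3 0, r _ _ 2 1, r _ _ 3 1, r _ _ 3 2, p 0 2 0 1, p 0 3 0 1, p 0 3 0 2, p 1 2 0 1, p 1 2 0 2, p 1 2 0 3, p 1 3 0 1, p 1 3 0 2,
      p 1 3 0 3, p 1 3 1 2, p 2 3 0 1, p 2 3 0 2, p 2 3 0 3, p 2 3 1 2, p 2 3 1 3] at t13 t22 t23 t33
  have z0101 : W 0 1 0 1 = 0 := by linarith
  have z0102 : W 0 1 0 2 = 0 := by linarith
  have z0103 : W 0 1 0 3 = 0 := by linarith
  have z0112 : W 0 1 1 2 = 0 := by linarith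
  have z0113 : W 0 1 1 3 = 0 := by linarith
  have z0123 : W 0 1 2 3 = 0 := by linarith
  have z0202 : W 0 2 0 2 = 0 := by linarith
  have z0203 : W 0 2 0 3 = 0 := by linarith
  have z0212 : W 0 2 1 2 = 0 := by linarith
  have z0213 : W 0 2 1 3 = 0 := by linarith
  have z0223 : W 0 2 2 3 = 0 := by linarith
  have z0303 : W 0 3 0 3 = 0 := by linarith
  have z0312 : W 0 3 1 2 = 0 := by linarith
  have z0313 : W 0 3 1 3 = 0 := by linarith
  have z0323 : W 0 3 2 3 = 0 := by linarith
  have z1212 : W 1 2 1 2 = 0 := by linarith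
  have z1213 : W 1 2 1 3 = 0 := by linarith
  have z1223 : W 1 2 2 3 = 0 := by linarith
  have z1313 : W 1 3 1 3 = 0 := by linarith
  have z1323 : W 1 3 2 3 = 0 := by linarith
  have z2323 : W 2 3 2 3 = 0 := by linarith
  funext a b c d
  fin_cases a <;> fin_cases b <;> fin_cases c <;> fin_cases d <;>
    simp only [Fin.zero_eta, Fin.mk_one, Fin.reduceFinMk, d, l 1 0, l 2 0, l 3 0, l 2 1, l 3 1, l 3 2, r _ _ 1 0, r _ _ 2 0,
      r _ _ 3 0, r _ _ 2 1, r _ _ 3 1, r _ _ 3 2, p 0 2 0 1, p 0 3 0 1, p 0 3 0 2, p 1 2 0 1, p 1 2 0 2, p 1 2 0 3, p 1 3 0 1, p 1 3 0 2,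
      p 1 3 0 3, p 1 3 1 2, p 2 3 0 1, p 2 3 0 2, p 2 3 0 3, p 2 3 1 2, p 2 3 1 3,
      z0101, z0102, z0103, z0112, z0113, z0123, z0202, z0203, z0212, z0213, z0223,
      z0303, z0312, z0313, z0323, z1212, z1213, z1223, z1313, z1323, z2323, neg_zero, Pi.zero_apply]

end Umbilic

/-! ### Reconstruction of ∇𝒰 from its divergence in an orthonormal frame -/

namespace Umbilic
open Matrix Filter Topology

/-- Lowered 2-form `θ ∧ g_m`, where `g_m` is the `m`-th row of the metric. -/
def wedgeRow (g : Tensor2 ℂ) (θ : Fin 4 → ℂ) (m : Fin 4) : Tensor2 ℂ :=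
  Matrix.of fun b c => θ b * g m c - θ c * g m b

-- The hypotheses leave eight real parameters in ∇U. They are the real and imaginary parts, up to
-- scale and sign, of the four components of ξ, so ∇𝒰 can be read off from ξ.
set_option maxHeartbeats 2000000 in
theorem umbilic_mink (a0 a1 a2 a3 b0 b1 d2 d3 : ℝ) (c : Fin 4 → Tensor2 ℝ)
    (h0 : c 0 = !![0, 0, a0, b0; 0, 0, -a1, -b1; -a0, a1, 0, 0; -b0, b1, 0, 0])
    (h1 : c 1 = !![0, 0, a1, b1; 0, 0, -a0, -b0; -a1, a0, 0, 0; -b1, b0, 0, 0])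
    (h2 : c 2 = !![0, 0, a2, -a3; 0, 0, d2, -d3; -a2, -d2, 0, 0; a3, d3, 0, 0])
    (h3 : c 3 = !![0, 0, a3, a2; 0, 0, d3, d2; -a3, -d3, 0, 0; -a2, -d2, 0, 0])
    (Z : Fin 4 → Tensor2 ℂ)
    (hZ : ∀ M, Z M = rt • (cast ℂ (c M) - Complex.I • hodge mink eps (cast ℂ (c M))))
    (ξ : Fin 4 → ℂ) (hξ : ∀ B, ξ B = -∑ A, ∑ C, (mink A C : ℂ) * Z A C B)
    (χ : Fin 4 → ℂ) (hχ : ∀ M, χ M = ∑ A, ∑ C, ξ C * (mink C A : ℂ) * sdStd 0 A M) (M : Fin 4) :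
    Z M = χ M • sdStd 0 + (1 / 2 : ℂ) • (wedgeRow (cast ℂ mink) ξ M -
      Complex.I • hodge mink eps (wedgeRow (cast ℂ mink) ξ M)) := by
  have z0 : Z 0 = rt • !![0, 0, a0 - Complex.I * b1, b0 + Complex.I * a1;
      0, 0, -a1 + Complex.I * b0, -b1 - Complex.I * a0;
      -(a0 - Complex.I * b1), -(-a1 + Complex.I * b0), 0, 0;
      -(b0 + Complex.I * a1), -(-b1 - Complex.I * a0), 0, 0] := by
    rw [hZ, h0, hodge_mink]
    ext i j
    fin_cases i <;> fin_cases j <;> simp [-mul_eq_mul_left_iff] <;> ring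
  have z1 : Z 1 = rt • !![0, 0, a1 - Complex.I * b0, b1 + Complex.I * a0;
      0, 0, -a0 + Complex.I * b1, -b0 - Complex.I * a1;
      -(a1 - Complex.I * b0), -(-a0 + Complex.I * b1), 0, 0;
      -(b1 + Complex.I * a0), -(-b0 - Complex.I * a1), 0, 0] := by
    rw [hZ, h1, hodge_mink]
    ext i j
    fin_cases i <;> fin_cases j <;> simp [-mul_eq_mul_left_iff] <;> ring
  have z2 : Z 2 = rt • !![0, 0, a2 - Complex.I * d3, -a3 - Complex.I * d2;
      0, 0, d2 - Complex.I * a3, -d3 - Complex.I * a2;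
      -(a2 - Complex.I * d3), -(d2 - Complex.I * a3), 0, 0;
      -(-a3 - Complex.I * d2), -(-d3 - Complex.I * a2), 0, 0] := by
    rw [hZ, h2, hodge_mink]
    ext i j
    fin_cases i <;> fin_cases j <;> simp [-mul_eq_mul_left_iff] <;> ring
  have z3 : Z 3 = rt • !![0, 0, a3 + Complex.I * d2, a2 - Complex.I * d3;
      0, 0, d3 + Complex.I * a2, d2 - Complex.I * a3;
      -(a3 + Complex.I * d2), -(d3 + Complex.I * a2), 0, 0;
      -(a2 - Complex.I * d3), -(d2 - Complex.I * a3), 0, 0] := by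
    rw [hZ, h3, hodge_mink]
    ext i j
    fin_cases i <;> fin_cases j <;> simp [-mul_eq_mul_left_iff] <;> ring
  -- Each component of ξ collects two equal contributions; every entry of `Z` is one of these four
  -- numbers, up to a power of i and a scale.
  have x0 : ξ 0 = 2 * rt * (a2 - Complex.I * d3) := by
    rw [hξ]; simp [Fin.sum_univ_four, mink, z0, z1, z2, z3]; ring
  have x1 : ξ 1 = 2 * rt * (d2 - Complex.I * a3) := by
    rw [hξ]; simp [Fin.sum_univ_four, mink, z0, z1, z2, z3]; ring
  have x2 : ξ 2 = 2 * rt * (a0 - Complex.I * b1) := by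
    rw [hξ]; simp [Fin.sum_univ_four, mink, z0, z1, z2, z3]; ring
  have x3 : ξ 3 = 2 * rt * (b0 + Complex.I * a1) := by
    rw [hξ]; simp [Fin.sum_univ_four, mink, z0, z1, z2, z3]; ring
  have hr := rt_mul_rt
  have y0 : χ 0 = -(d2 - Complex.I * a3) := by
    rw [hχ]; simp [Fin.sum_univ_four, mink, sdStd, x0, x1, x2, x3]
    linear_combination (-(d2 - Complex.I * a3) * 2) * hr
  have y1 : χ 1 = -(a2 - Complex.I * d3) := by
    rw [hχ]; simp [Fin.sum_univ_four, mink, sdStd, x0, x1, x2, x3]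
    linear_combination (-(a2 - Complex.I * d3) * 2) * hr
  have y2 : χ 2 = -Complex.I * (b0 + Complex.I * a1) := by
    rw [hχ]; simp [Fin.sum_univ_four, mink, sdStd, x0, x1, x2, x3]
    linear_combination (Complex.I * (b0 + Complex.I * a1) * 2) * hr
  have y3 : χ 3 = Complex.I * (a0 - Complex.I * b1) := by
    rw [hχ]; simp [Fin.sum_univ_four, mink, sdStd, x0, x1, x2, x3]
    linear_combination (Complex.I * (a0 - Complex.I * b1) * 2) * hr
  have hI := Complex.I_sq
  have hI' : Complex.I ^ 3 = -Complex.I := by rw [pow_succ, hI]; ring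
  rw [hodge_mink]
  ext i j
  simp only [Matrix.add_apply, Matrix.smul_apply, Matrix.sub_apply, wedgeRow, Matrix.of_apply,
    smul_eq_mul]
  fin_cases M <;> fin_cases i <;> fin_cases j <;>
    simp [z0, z1, z2, z3, y0, y1, y2, y3, x0, x1, x2, x3, sdStd, mink, -mul_eq_mul_left_iff] <;>
    ring_nf <;> (try simp only [hI, hI']) <;> ring

end Umbilic

/-! ### Transport of tensors and second fundamental forms to a frame -/

namespace Umbilic
open Matrix Filter Topology

section

variable {𝕜 : Type} [RCLike 𝕜]

/-- Components of a family of 2-tensors in the frame given by the columns of `P`. -/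
def pullFam (P : Tensor2 ℝ) (T : Fin 4 → Tensor2 𝕜) (M : Fin 4) : Tensor2 𝕜 :=
  ∑ m, (P m M : 𝕜) • ((cast 𝕜 P)ᵀ * T m * cast 𝕜 P)

namespace IsAdapted

variable {Q g U : Tensor2 ℝ} {η : Tensor4 ℝ}

theorem pullFam_pullFam (h : IsAdapted Q g η U) (T : Fin 4 → Tensor2 𝕜) (m : Fin 4) :
    pullFam Q (pullFam Q⁻¹ T) m = T m := by
  have h1 : (cast 𝕜 Q)ᵀ * (cast 𝕜 Q⁻¹)ᵀ = 1 := by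
    rw [← Matrix.transpose_mul, h.cast_inv_mul, Matrix.transpose_one]
  have h2 : ∀ A : Tensor2 𝕜, (cast 𝕜 Q)ᵀ * ((cast 𝕜 Q⁻¹)ᵀ * A * cast 𝕜 Q⁻¹) * cast 𝕜 Q = A := by
    intro A
    calc _ = ((cast 𝕜 Q)ᵀ * (cast 𝕜 Q⁻¹)ᵀ) * A * (cast 𝕜 Q⁻¹ * cast 𝕜 Q) := by
          simp only [Matrix.mul_assoc]
      _ = A := by rw [h1, h.cast_inv_mul, Matrix.one_mul, Matrix.mul_one]
  simp only [pullFam, Matrix.mul_sum, Matrix.sum_mul, Matrix.mul_smul, Matrix.smul_mul, h2,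
    Finset.smul_sum, smul_smul]
  rw [Finset.sum_comm]
  have h3 : ∀ k, ∑ M, ((Q M m : 𝕜) * (Q⁻¹ k M : 𝕜)) = if k = m then 1 else 0 := by
    intro k
    have := congrFun (congrFun (h.cast_inv_mul (𝕜 := 𝕜)) k) m
    rw [Matrix.mul_apply, Matrix.one_apply] at this
    rw [← this]
    exact Finset.sum_congr rfl fun M _ => mul_comm _ _
  simp [← Finset.sum_smul, h3]

theorem pullFam_injective (h : IsAdapted Q g η U) {T T' : Fin 4 → Tensor2 𝕜}
    (hT : pullFam Q⁻¹ T = pullFam Q⁻¹ T') : T = T' := by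
  funext m
  rw [← h.pullFam_pullFam T m, hT, h.pullFam_pullFam]

theorem inv_conj (h : IsAdapted Q g η U) (A : Tensor2 𝕜) :
    (cast 𝕜 Q⁻¹)ᵀ * ((cast 𝕜 Q)ᵀ * A * cast 𝕜 Q) * cast 𝕜 Q⁻¹ = A := by
  have h1 : (cast 𝕜 Q⁻¹)ᵀ * (cast 𝕜 Q)ᵀ = 1 := by
    rw [← Matrix.transpose_mul, h.cast_mul_inv, Matrix.transpose_one]
  calc _ = ((cast 𝕜 Q⁻¹)ᵀ * (cast 𝕜 Q)ᵀ) * A * (cast 𝕜 Q * cast 𝕜 Q⁻¹) := by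
        simp only [Matrix.mul_assoc]
    _ = A := by rw [h1, h.cast_mul_inv, Matrix.one_mul, Matrix.mul_one]

theorem cast_inv_metric (h : IsAdapted Q g η U) :
    cast 𝕜 g⁻¹ = cast 𝕜 Q⁻¹ * cast 𝕜 mink * (cast 𝕜 Q⁻¹)ᵀ := by
  rw [h.inv_metric, cast_mul, cast_mul, cast_transpose]

theorem inv_transpose_dot (h : IsAdapted Q g η U) (A B : Tensor2 𝕜) :
    (cast 𝕜 Q⁻¹)ᵀ * dot g A B * cast 𝕜 Q⁻¹ =
      dot mink ((cast 𝕜 Q⁻¹)ᵀ * A * cast 𝕜 Q⁻¹) ((cast 𝕜 Q⁻¹)ᵀ * B * cast 𝕜 Q⁻¹) := by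
  rw [dot_eq, dot_eq, mink_inv, h.cast_inv_metric]
  simp only [Matrix.mul_assoc]

theorem inv_transpose_hodge (h : IsAdapted Q g η U) (F : Tensor2 𝕜) :
    (cast 𝕜 Q⁻¹)ᵀ * hodge g η F * cast 𝕜 Q⁻¹ =
      hodge mink eps ((cast 𝕜 Q⁻¹)ᵀ * F * cast 𝕜 Q⁻¹) := by
  have h1 : (cast 𝕜 Q)ᵀ * (cast 𝕜 Q⁻¹)ᵀ = 1 := by
    rw [← Matrix.transpose_mul, h.cast_inv_mul, Matrix.transpose_one]
  have e : F = (cast 𝕜 Q)ᵀ * ((cast 𝕜 Q⁻¹)ᵀ * F * cast 𝕜 Q⁻¹) * cast 𝕜 Q := by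
    calc F = ((cast 𝕜 Q)ᵀ * (cast 𝕜 Q⁻¹)ᵀ) * F * (cast 𝕜 Q⁻¹ * cast 𝕜 Q) := by
          rw [h1, h.cast_inv_mul, Matrix.one_mul, Matrix.mul_one]
      _ = _ := by simp only [Matrix.mul_assoc]
  conv_lhs => rw [e, h.hodge_conj, h.inv_conj]

end IsAdapted

end

theorem secondForm_eq (G v : E4 → Tensor2 ℝ) (x : E4) (c a b : Fin 4) :
    secondForm G v x c a b = ∑ m, (v x * (G x)⁻¹) a m *
      ((G x - v x) * (G x)⁻¹ * covMat G v x m) c b := by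
  simp only [secondForm, covDeriv_eq]
  simp only [Matrix.mul_apply, Finset.mul_sum, Finset.sum_mul]
  symm
  calc ∑ m, ∑ d, ∑ k, ∑ e, v x a e * (G x)⁻¹ e m * ((G x - v x) c k * (G x)⁻¹ k d *
        covMat G v x m d b)
      = ∑ d, ∑ k, ∑ e, ∑ m, v x a e * (G x)⁻¹ e m * ((G x - v x) c k * (G x)⁻¹ k d *
        covMat G v x m d b) := by
        rw [Finset.sum_comm]
        refine Finset.sum_congr rfl fun d _ => ?_
        rw [Finset.sum_comm]
        exact Finset.sum_congr rfl fun k _ => Finset.sum_comm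
    _ = _ := by
        rw [Finset.sum_comm]
        refine Finset.sum_congr rfl fun k _ => Finset.sum_congr rfl fun d _ =>
          Finset.sum_congr rfl fun e _ => Finset.sum_congr rfl fun m _ => ?_
        ring

theorem sum_conj_entries (P X : Tensor2 ℝ) (C B : Fin 4) :
    ∑ c, ∑ b, P c C * P b B * X c b = (Pᵀ * X * P) C B := by
  simp only [Matrix.mul_apply, Matrix.transpose_apply, Finset.sum_mul]
  rw [Finset.sum_comm]
  exact Finset.sum_congr rfl fun b _ => Finset.sum_congr rfl fun c _ => by ring

/-- The second fundamental form of a plane in an adapted frame. -/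
def frameSecondForm (V H : Tensor2 ℝ) (D : Fin 4 → Tensor2 ℝ) (C A B : Fin 4) : ℝ :=
  ∑ M, (V * mink) A M * (H * mink * D M) C B

theorem pull_secondForm {G v : E4 → Tensor2 ℝ} {x : E4} {Q U V H : Tensor2 ℝ} {η : Tensor4 ℝ}
    (hQ : IsAdapted Q (G x) η U) (hv : v x = Qᵀ * V * Q) (hh : G x - v x = Qᵀ * H * Q)
    (C A B : Fin 4) :
    ∑ a, Q⁻¹ a A * ∑ c, ∑ b, Q⁻¹ c C * Q⁻¹ b B * secondForm G v x c a b =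
      frameSecondForm V H (pullFam Q⁻¹ (covMat G v x)) C A B := by
  set P := Q⁻¹ with hP
  have h1 : Pᵀ * Qᵀ = 1 := hQ.inv_transpose_mul
  have h2 : Q * P = 1 := hQ.mul_inv
  have e1 : Pᵀ * (v x * (G x)⁻¹) = V * mink * Pᵀ := by
    rw [hv, hQ.inv_metric]
    calc _ = (Pᵀ * Qᵀ) * V * (Q * P) * mink * Pᵀ := by simp only [Matrix.mul_assoc, hP]
      _ = _ := by rw [h1, h2, Matrix.one_mul, Matrix.mul_one]
  have e2 : ∀ X : Tensor2 ℝ, Pᵀ * ((G x - v x) * (G x)⁻¹ * X) * P = H * mink * (Pᵀ * X * P) := by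
    intro X
    rw [hh, hQ.inv_metric]
    calc _ = (Pᵀ * Qᵀ) * H * (Q * P) * mink * (Pᵀ * X * P) := by simp only [Matrix.mul_assoc, hP]
      _ = _ := by rw [h1, h2, Matrix.one_mul, Matrix.mul_one]
  have e3 : ∀ a, ∑ c, ∑ b, P c C * P b B * secondForm G v x c a b =
      ∑ m, (v x * (G x)⁻¹) a m * (H * mink * (Pᵀ * covMat G v x m * P)) C B := by
    intro a
    simp only [← e2, ← sum_conj_entries, secondForm_eq, Finset.mul_sum]
    calc ∑ c, ∑ b, ∑ m, P c C * P b B * ((v x * (G x)⁻¹) a m *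
          ((G x - v x) * (G x)⁻¹ * covMat G v x m) c b)
        = ∑ c, ∑ m, ∑ b, P c C * P b B * ((v x * (G x)⁻¹) a m *
          ((G x - v x) * (G x)⁻¹ * covMat G v x m) c b) :=
          Finset.sum_congr rfl fun c _ => Finset.sum_comm
      _ = _ := by
          rw [Finset.sum_comm]
          refine Finset.sum_congr rfl fun m _ => Finset.sum_congr rfl fun c _ =>
            Finset.sum_congr rfl fun b _ => ?_
          ring
  have e4 : ∀ m, ∑ a, P a A * (v x * (G x)⁻¹) a m = ∑ M, (V * mink) A M * P m M := by
    intro m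
    have := congrFun (congrFun e1 A) m
    simpa only [Matrix.mul_apply (M := Pᵀ), Matrix.mul_apply (N := Pᵀ), Matrix.transpose_apply]
      using this
  simp only [e3, Finset.mul_sum]
  rw [Finset.sum_comm]
  have e5 : ∀ m, ∑ a, P a A * ((v x * (G x)⁻¹) a m *
      (H * mink * (Pᵀ * covMat G v x m * P)) C B) =
      ∑ M, (V * mink) A M * (P m M * (H * mink * (Pᵀ * covMat G v x m * P)) C B) := by
    intro m
    simp only [← mul_assoc, ← Finset.sum_mul, e4]
  simp only [e5]
  rw [Finset.sum_comm]
  refine Finset.sum_congr rfl fun M _ => ?_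
  rw [← Finset.mul_sum]
  congr 1
  have hc : cast ℝ P = P := rfl
  simp only [pullFam, hc, Matrix.mul_sum, Matrix.mul_smul, Matrix.sum_apply, Matrix.smul_apply,
    smul_eq_mul]
  rfl

theorem pull_umbilical {G v : E4 → Tensor2 ℝ} {x : E4} {Q U V H : Tensor2 ℝ} {η : Tensor4 ℝ}
    (hQ : IsAdapted Q (G x) η U) (hv : v x = Qᵀ * V * Q) (hh : G x - v x = Qᵀ * H * Q)
    (hu : PlaneUmbilicalAt G v x) (C A B : Fin 4) :
    frameSecondForm V H (pullFam Q⁻¹ (covMat G v x)) C A B +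
      frameSecondForm V H (pullFam Q⁻¹ (covMat G v x)) C B A =
    V A B * ∑ M, ∑ N, mink M N * frameSecondForm V H (pullFam Q⁻¹ (covMat G v x)) C M N := by
  set P := Q⁻¹ with hP
  set sf := secondForm G v x with hsf
  -- Symmetrisation does not change the trace, so umbilicity can be stated for the unsymmetrised
  -- form and the halves cancel.
  have hs : ∀ c a b, sf c a b + sf c b a = v x a b * ∑ m, ∑ n, (G x)⁻¹ m n * sf c m n := by
    intro c a b
    have h1 := hu c a b
    have h2 : ∑ m, ∑ n, (G x)⁻¹ m n * sf c n m = ∑ m, ∑ n, (G x)⁻¹ m n * sf c m n := by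
      rw [Finset.sum_comm]
      refine Finset.sum_congr rfl fun m _ => Finset.sum_congr rfl fun n _ => ?_
      rw [← hQ.inv_metric_transpose, Matrix.transpose_apply, hQ.inv_metric_transpose]
    simp only [secondFormSymm, ← hsf] at h1
    have h3 : ∑ m, ∑ n, (G x)⁻¹ m n * (1 / 2 * (sf c m n + sf c n m)) =
        1 / 2 * (∑ m, ∑ n, (G x)⁻¹ m n * sf c m n + ∑ m, ∑ n, (G x)⁻¹ m n * sf c n m) := by
      rw [← Finset.sum_add_distrib, Finset.mul_sum]
      refine Finset.sum_congr rfl fun m _ => ?_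
      rw [← Finset.sum_add_distrib, Finset.mul_sum]
      exact Finset.sum_congr rfl fun n _ => by ring
    rw [h3, h2] at h1
    linarith
  have hV : Pᵀ * v x * P = V := by
    rw [hv]
    exact hQ.inv_conj (𝕜 := ℝ) V
  have p := pull_secondForm hQ hv hh
  rw [← hP, ← hsf] at p
  have e1 : ∀ A B, ∑ a, P a A * ∑ c, ∑ b, P c C * P b B * sf c a b =
      ∑ a, ∑ b, P a A * P b B * ∑ c, P c C * sf c a b := by
    intro A B
    refine Finset.sum_congr rfl fun a _ => ?_
    rw [Finset.sum_comm, Finset.mul_sum]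
    refine Finset.sum_congr rfl fun b _ => ?_
    rw [Finset.mul_sum, Finset.mul_sum]
    exact Finset.sum_congr rfl fun c _ => by ring
  have e2 : ∑ a, ∑ b, P a A * P b B * ∑ c, P c C * sf c a b +
      ∑ a, ∑ b, P a B * P b A * ∑ c, P c C * sf c a b =
      ∑ a, ∑ b, P a A * P b B * ∑ c, P c C * (sf c a b + sf c b a) := by
    have e0 : ∑ a, ∑ b, P a B * P b A * ∑ c, P c C * sf c a b =
        ∑ a, ∑ b, P b B * P a A * ∑ c, P c C * sf c b a := Finset.sum_comm
    rw [e0]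
    simp only [mul_add, Finset.sum_add_distrib, mul_comm (P _ B) (P _ A)]
  have e3 : ∑ a, ∑ b, P a A * P b B * ∑ c, P c C * (sf c a b + sf c b a) =
      V A B * ∑ c, P c C * ∑ m, ∑ n, (G x)⁻¹ m n * sf c m n := by
    rw [← hV, ← sum_conj_entries, Finset.sum_mul]
    refine Finset.sum_congr rfl fun a _ => ?_
    rw [Finset.sum_mul]
    refine Finset.sum_congr rfl fun b _ => ?_
    rw [Finset.mul_sum, Finset.mul_sum]
    refine Finset.sum_congr rfl fun c _ => ?_
    rw [hs]
    ring
  have e4 : ∑ c, P c C * ∑ m, ∑ n, (G x)⁻¹ m n * sf c m n =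
      ∑ M, ∑ N, mink M N * ∑ m, ∑ n, P m M * P n N * ∑ c, P c C * sf c m n := by
    have hg : ∀ m n, (G x)⁻¹ m n = ∑ M, ∑ N, mink M N * (P m M * P n N) := by
      intro m n
      rw [hQ.inv_metric]
      simp only [Matrix.mul_apply, Matrix.transpose_apply, Finset.sum_mul]
      rw [Finset.sum_comm]
      exact Finset.sum_congr rfl fun A _ => Finset.sum_congr rfl fun C _ => by ring
    have : ∑ c, P c C * ∑ m, ∑ n, (G x)⁻¹ m n * sf c m n =
        ∑ m, ∑ n, (G x)⁻¹ m n * ∑ c, P c C * sf c m n := by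
      simp only [Finset.mul_sum]
      rw [Finset.sum_comm]
      refine Finset.sum_congr rfl fun m _ => ?_
      rw [Finset.sum_comm]
      exact Finset.sum_congr rfl fun n _ => Finset.sum_congr rfl fun c _ => by ring
    rw [this]
    simp only [hg]
    calc _ = ∑ m, ∑ n, ∑ M, ∑ N, mink M N * (P m M * P n N * ∑ c, P c C * sf c m n) := by
          refine Finset.sum_congr rfl fun m _ => Finset.sum_congr rfl fun n _ => ?_
          rw [Finset.sum_mul]
          refine Finset.sum_congr rfl fun M _ => ?_
          rw [Finset.sum_mul]
          exact Finset.sum_congr rfl fun N _ => by ring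
      _ = _ := by
          rw [sum_comm₄]
          simp only [Finset.mul_sum]
  rw [← p, ← p, e1, e1, e2, e3, e4]
  simp only [← e1, p]

end Umbilic

/-! ### The linear equations imposed by umbilicity -/

namespace Umbilic
open Matrix Filter Topology

/-- The projector on the time-like plane, in an adapted frame. -/
def stdV : Tensor2 ℝ := !![-1, 0, 0, 0; 0, 1, 0, 0; 0, 0, 0, 0; 0, 0, 0, 0]

/-- The projector on the space-like plane, in an adapted frame. -/
def stdH : Tensor2 ℝ := !![0, 0, 0, 0; 0, 0, 0, 0; 0, 0, 1, 0; 0, 0, 0, 1]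

theorem stdForm_sq : stdForm * mink * stdForm = stdV := by
  ext i j; fin_cases i <;> fin_cases j <;> simp [stdForm, mink, stdV]

theorem mink_sub_stdV : mink - stdV = stdH := by
  ext i j; fin_cases i <;> fin_cases j <;> simp [stdH, mink, stdV]

theorem stdV_mul_mink : stdV * mink =
    !![1, 0, 0, 0; 0, 1, 0, 0; 0, 0, 0, 0; 0, 0, 0, 0] := by
  ext i j; fin_cases i <;> fin_cases j <;> simp [mink, stdV]

theorem stdH_mul_mink : stdH * mink =
    !![0, 0, 0, 0; 0, 0, 0, 0; 0, 0, 1, 0; 0, 0, 0, 1] := by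
  ext i j; fin_cases i <;> fin_cases j <;> simp [mink, stdH]

theorem frameSecondForm_stdV (D : Fin 4 → Tensor2 ℝ) (B : Fin 4) :
    (∀ C : Fin 4, frameSecondForm stdV stdH D C 2 B = 0) ∧
    (∀ C : Fin 4, frameSecondForm stdV stdH D C 3 B = 0) ∧
    frameSecondForm stdV stdH D 2 0 B = D 0 2 B ∧ frameSecondForm stdV stdH D 3 0 B = D 0 3 B ∧
    frameSecondForm stdV stdH D 2 1 B = D 1 2 B ∧ frameSecondForm stdV stdH D 3 1 B = D 1 3 B := by
  simp [frameSecondForm, stdV_mul_mink, stdH_mul_mink, vecMul, dotProduct, Fin.sum_univ_four]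

theorem frameSecondForm_stdH (D : Fin 4 → Tensor2 ℝ) (B : Fin 4) :
    (∀ C : Fin 4, frameSecondForm stdH stdV D C 0 B = 0) ∧
    (∀ C : Fin 4, frameSecondForm stdH stdV D C 1 B = 0) ∧
    frameSecondForm stdH stdV D 0 2 B = D 2 0 B ∧ frameSecondForm stdH stdV D 1 2 B = D 2 1 B ∧
    frameSecondForm stdH stdV D 0 3 B = D 3 0 B ∧ frameSecondForm stdH stdV D 1 3 B = D 3 1 B := by
  simp [frameSecondForm, stdV_mul_mink, stdH_mul_mink, vecMul, dotProduct, Fin.sum_univ_four]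

/-- The consequences, in an adapted frame, of umbilicity for the covariant derivative of `U`. -/
theorem frame_equations {c D : Fin 4 → Tensor2 ℝ} (ha : ∀ M, (c M)ᵀ = -c M)
    (hc : ∀ M, dot mink (dot mink (c M) stdForm + dot mink stdForm (c M)) stdForm +
      dot mink (dot mink stdForm stdForm) (c M) = c M)
    (hD : ∀ M, D M = dot mink (c M) stdForm + dot mink stdForm (c M))
    (hV : ∀ C A B, frameSecondForm stdV stdH D C A B + frameSecondForm stdV stdH D C B A =
      stdV A B * ∑ M, ∑ N, mink M N * frameSecondForm stdV stdH D C M N)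
    (hH : ∀ C A B, frameSecondForm stdH stdV (-D) C A B + frameSecondForm stdH stdV (-D) C B A =
      stdH A B * ∑ M, ∑ N, mink M N * frameSecondForm stdH stdV (-D) C M N) :
    ∃ a0 a1 a2 a3 b0 b1 d2 d3 : ℝ,
      c 0 = !![0, 0, a0, b0; 0, 0, -a1, -b1; -a0, a1, 0, 0; -b0, b1, 0, 0] ∧
      c 1 = !![0, 0, a1, b1; 0, 0, -a0, -b0; -a1, a0, 0, 0; -b1, b0, 0, 0] ∧
      c 2 = !![0, 0, a2, -a3; 0, 0, d2, -d3; -a2, -d2, 0, 0; a3, d3, 0, 0] ∧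
      c 3 = !![0, 0, a3, a2; 0, 0, d3, d2; -a3, -d3, 0, 0; -a2, -d2, 0, 0] := by
  have hs : ∀ M a b, c M a b = -c M b a := fun M a b => by
    simpa using congrFun (congrFun (ha M) b) a
  have hd : ∀ M a, c M a a = 0 := fun M a => by linarith [hs M a a]
  have hdot : ∀ A B : Tensor2 ℝ, dot mink A B = A * mink * B := fun A B => by
    rw [dot_eq, mink_inv]; rfl
  simp only [hdot] at hc hD
  -- Hypothesis `hc` is the derivative of U³ = U. It kills the components of ∇U with both tensor
  -- indices in the same plane.
  have c01 : ∀ M, c M 0 1 = 0 := by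
    intro M
    have := congrFun (congrFun (hc M) 0) 1
    simp [Matrix.mul_apply, Fin.sum_univ_four, vecMul, dotProduct, mink, stdForm, hd] at this
    linarith [hs M 1 0]
  have c23 : ∀ M, c M 2 3 = 0 := by
    intro M
    have := congrFun (congrFun (hc M) 2) 3
    simp [Matrix.mul_apply, Fin.sum_univ_four, vecMul, dotProduct, mink, stdForm, hd] at this
    linarith
  -- On mixed entries, contraction with U exchanges the frame indices 0 and 1; this relates ∇v to
  -- ∇U.
  have D20 : ∀ M, D M 2 0 = c M 1 2 := by
    intro M
    rw [hD]
    simp [Matrix.mul_apply, Fin.sum_univ_four, vecMul, dotProduct, mink, stdForm]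
    linarith [hs M 2 1]
  have D21 : ∀ M, D M 2 1 = c M 0 2 := by
    intro M
    rw [hD]
    simp [Matrix.mul_apply, Fin.sum_univ_four, vecMul, dotProduct, mink, stdForm]
    linarith [hs M 2 0]
  have D30 : ∀ M, D M 3 0 = c M 1 3 := by
    intro M
    rw [hD]
    simp [Matrix.mul_apply, Fin.sum_univ_four, vecMul, dotProduct, mink, stdForm]
    linarith [hs M 3 1]
  have D31 : ∀ M, D M 3 1 = c M 0 3 := by
    intro M
    rw [hD]
    simp [Matrix.mul_apply, Fin.sum_univ_four, vecMul, dotProduct, mink, stdForm]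
    linarith [hs M 3 0]
  have D02 : ∀ M, D M 0 2 = c M 1 2 := by
    intro M
    rw [hD]
    simp [Matrix.mul_apply, Fin.sum_univ_four, vecMul, dotProduct, mink, stdForm]
  have D12 : ∀ M, D M 1 2 = c M 0 2 := by
    intro M
    rw [hD]
    simp [Matrix.mul_apply, Fin.sum_univ_four, vecMul, dotProduct, mink, stdForm]
  have D03 : ∀ M, D M 0 3 = c M 1 3 := by
    intro M
    rw [hD]
    simp [Matrix.mul_apply, Fin.sum_univ_four, vecMul, dotProduct, mink, stdForm]
  have D13 : ∀ M, D M 1 3 = c M 0 3 := by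
    intro M
    rw [hD]
    simp [Matrix.mul_apply, Fin.sum_univ_four, vecMul, dotProduct, mink, stdForm]
  -- A trace-free symmetric form on a plane has one off-diagonal and one diagonal component. Two
  -- normal directions for each of two planes give eight equations on the sixteen mixed components,
  -- which leaves eight parameters.
  have v1 := hV 2 0 1
  have v2 := hV 2 1 1
  have v3 := hV 3 0 1
  have v4 := hV 3 1 1
  have h1 := hH 0 2 3
  have h2 := hH 0 3 3
  have h3 := hH 1 2 3
  have h4 := hH 1 3 3
  simp only [Fin.sum_univ_four, frameSecondForm_stdV] at v1 v2 v3 v4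
  simp only [Fin.sum_univ_four, frameSecondForm_stdH] at h1 h2 h3 h4
  simp [mink, stdV, D20, D21, D30, D31] at v1 v2 v3 v4
  simp [mink, stdH, D02, D12, D03, D13] at h1 h2 h3 h4
  have s := hs
  refine ⟨c 0 0 2, c 1 0 2, c 2 0 2, c 3 0 2, c 0 0 3, c 1 0 3, c 2 1 2, c 3 1 2, ?_, ?_, ?_, ?_⟩
  all_goals
    ext i j
    fin_cases i <;> fin_cases j <;> simp [hd, c01, c23, s _ 1 0, s _ 2 0, s _ 3 0, s _ 2 1, s _ 3 1,
      s _ 3 2] <;> linarith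

end Umbilic

/-! ### The formula for ∇𝒰, from frame to coordinates -/

namespace Umbilic
open Matrix Filter Topology

section Pull

variable {𝕜 : Type} [RCLike 𝕜]

theorem pullFam_add (P : Tensor2 ℝ) (T T' : Fin 4 → Tensor2 𝕜) :
    pullFam P (fun m => T m + T' m) = fun M => pullFam P T M + pullFam P T' M := by
  ext1 M
  simp only [pullFam, mul_add, add_mul, smul_add, Finset.sum_add_distrib]

theorem pullFam_sub (P : Tensor2 ℝ) (T T' : Fin 4 → Tensor2 𝕜) :
    pullFam P (fun m => T m - T' m) = fun M => pullFam P T M - pullFam P T' M := by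
  ext1 M
  simp only [pullFam, mul_sub, sub_mul, smul_sub, Finset.sum_sub_distrib]

theorem pullFam_neg (P : Tensor2 ℝ) (T : Fin 4 → Tensor2 𝕜) :
    pullFam P (-T) = -pullFam P T := by
  ext1 M
  simp only [pullFam, Pi.neg_apply, mul_neg, neg_mul, smul_neg, Finset.sum_neg_distrib]

theorem pullFam_smul (P : Tensor2 ℝ) (r : 𝕜) (T : Fin 4 → Tensor2 𝕜) :
    pullFam P (fun m => r • T m) = fun M => r • pullFam P T M := by
  ext1 M
  simp only [pullFam, mul_smul_comm, smul_mul_assoc, Finset.smul_sum]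
  exact Finset.sum_congr rfl fun m _ => smul_comm _ _ _

theorem pullFam_smul_const (P : Tensor2 ℝ) (χ : Fin 4 → 𝕜) (A : Tensor2 𝕜) (M : Fin 4) :
    pullFam P (fun m => χ m • A) M = (χ ᵥ* cast 𝕜 P) M • ((cast 𝕜 P)ᵀ * A * cast 𝕜 P) := by
  simp only [pullFam, mul_smul_comm, smul_mul_assoc, vecMul, dotProduct, Finset.sum_smul,
    smul_smul, cast_apply]
  exact Finset.sum_congr rfl fun m _ => by rw [mul_comm]

theorem pullFam_cast (P : Tensor2 ℝ) (T : Fin 4 → Tensor2 ℝ) :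
    pullFam P (fun m => cast 𝕜 (T m)) = fun M => cast 𝕜 (pullFam P T M) := by
  ext M a b
  have hc : cast ℝ P = P := rfl
  simp only [pullFam, hc, cast_apply, Matrix.sum_apply, Matrix.smul_apply, smul_eq_mul,
    ← cast_transpose, ← cast_mul]
  push_cast
  rfl

theorem pullFam_transpose (P : Tensor2 ℝ) (T : Fin 4 → Tensor2 𝕜) (M : Fin 4) :
    (pullFam P T M)ᵀ = pullFam P (fun m => (T m)ᵀ) M := by
  simp only [pullFam, Matrix.transpose_sum, Matrix.transpose_smul, Matrix.transpose_mul,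
    Matrix.transpose_transpose, Matrix.mul_assoc]

theorem pullFam_dot_right {Q g U : Tensor2 ℝ} {η : Tensor4 ℝ} (hQ : IsAdapted Q g η U)
    (T : Fin 4 → Tensor2 𝕜) (A : Tensor2 𝕜) :
    pullFam Q⁻¹ (fun m => dot g (T m) A) =
      fun M => dot mink (pullFam Q⁻¹ T M) ((cast 𝕜 Q⁻¹)ᵀ * A * cast 𝕜 Q⁻¹) := by
  ext1 M
  simp only [pullFam, hQ.inv_transpose_dot]
  simp only [dot_eq, Finset.sum_mul, smul_mul_assoc]

theorem pullFam_dot_left {Q g U : Tensor2 ℝ} {η : Tensor4 ℝ} (hQ : IsAdapted Q g η U)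
    (T : Fin 4 → Tensor2 𝕜) (A : Tensor2 𝕜) :
    pullFam Q⁻¹ (fun m => dot g A (T m)) =
      fun M => dot mink ((cast 𝕜 Q⁻¹)ᵀ * A * cast 𝕜 Q⁻¹) (pullFam Q⁻¹ T M) := by
  ext1 M
  simp only [pullFam, hQ.inv_transpose_dot]
  simp only [dot_eq, Finset.mul_sum, mul_smul_comm]

theorem pullFam_hodge {Q g U : Tensor2 ℝ} {η : Tensor4 ℝ} (hQ : IsAdapted Q g η U)
    (T : Fin 4 → Tensor2 𝕜) :
    pullFam Q⁻¹ (fun m => hodge g η (T m)) = fun M => hodge mink eps (pullFam Q⁻¹ T M) := by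
  ext1 M
  simp only [pullFam, hQ.inv_transpose_hodge, map_sum, map_smul]

end Pull

theorem wedgeRow_eq (g : Tensor2 ℂ) (θ : Fin 4 → ℂ) (m : Fin 4) :
    wedgeRow g θ m = vecMulVec θ (g m) - vecMulVec (g m) θ := by
  ext b c
  simp [wedgeRow, vecMulVec_apply, mul_comm]

theorem wedgeRow_transpose (g : Tensor2 ℂ) (θ : Fin 4 → ℂ) (m : Fin 4) :
    (wedgeRow g θ m)ᵀ = -wedgeRow g θ m := by
  ext b c
  simp [wedgeRow]

theorem conj_vecMulVec (P : Tensor2 ℂ) (θ w : Fin 4 → ℂ) :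
    Pᵀ * vecMulVec θ w * P = vecMulVec (θ ᵥ* P) (w ᵥ* P) := by
  rw [mul_vecMulVec, vecMulVec_mul, mulVec_transpose]

theorem sum_smul_row (P g : Tensor2 ℂ) (M : Fin 4) :
    ∑ m, P m M • (g m ᵥ* P) = (Pᵀ * g * P) M := by
  ext B
  simp only [Finset.sum_apply, Pi.smul_apply, smul_eq_mul, vecMul, dotProduct, Matrix.mul_apply,
    Matrix.transpose_apply, Finset.mul_sum, Finset.sum_mul]
  rw [Finset.sum_comm]
  exact Finset.sum_congr rfl fun m _ => Finset.sum_congr rfl fun n _ => by ring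

/-- The label `m` is a tensor index here, since it comes from a row of g; the change of frame acts
on it as on the other two. -/
theorem pullFam_wedgeRow (P : Tensor2 ℝ) (g : Tensor2 ℂ) (θ : Fin 4 → ℂ) (M : Fin 4) :
    pullFam P (wedgeRow g θ) M =
      wedgeRow ((cast ℂ P)ᵀ * g * cast ℂ P) (θ ᵥ* cast ℂ P) M := by
  rw [wedgeRow_eq, ← sum_smul_row]
  simp only [pullFam, wedgeRow_eq, mul_sub, sub_mul, conj_vecMulVec, smul_sub,
    Finset.sum_sub_distrib]
  congr 1
  · ext B C
    simp only [Matrix.sum_apply, Matrix.smul_apply, vecMulVec_apply, Finset.sum_apply, smul_eq_mul,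
      Pi.smul_apply, Finset.mul_sum, cast_apply]
    exact Finset.sum_congr rfl fun m _ => mul_left_comm _ _ _
  · ext B C
    simp only [Matrix.sum_apply, Matrix.smul_apply, vecMulVec_apply, Finset.sum_apply, smul_eq_mul,
      Pi.smul_apply, Finset.sum_mul, cast_apply, mul_assoc]

theorem contractLeft_eq (g : Tensor2 ℝ) (θ : Fin 4 → ℂ) (A : Tensor2 ℂ) :
    contractLeft g θ A = θ ᵥ* (cast ℂ g⁻¹ * A) := by
  ext b
  rw [← vecMul_vecMul]
  simp only [contractLeft, vecMul, dotProduct, Finset.sum_mul]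
  rfl

/-- The divergence of a family of matrices, pulled back to a frame. -/
theorem pull_divergence {Q g U : Tensor2 ℝ} {η : Tensor4 ℝ} (hQ : IsAdapted Q g η U)
    (Z : Fin 4 → Tensor2 ℂ) (B : Fin 4) :
    ((fun b => ∑ a, (cast ℂ g⁻¹ * Z a) a b) ᵥ* cast ℂ Q⁻¹) B =
      ∑ A, (cast ℂ mink * pullFam Q⁻¹ Z A) A B := by
  have h1 : ∀ a, (cast ℂ g⁻¹ * Z a * cast ℂ Q⁻¹) a B = ∑ A, (Q⁻¹ a A : ℂ) *
      (cast ℂ mink * ((cast ℂ Q⁻¹)ᵀ * Z a * cast ℂ Q⁻¹)) A B := by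
    intro a
    rw [hQ.cast_inv_metric, Matrix.mul_assoc, Matrix.mul_assoc, Matrix.mul_assoc,
      Matrix.mul_apply]
    simp only [Matrix.mul_assoc]
    rfl
  calc _ = ∑ a, (cast ℂ g⁻¹ * Z a * cast ℂ Q⁻¹) a B := by
        simp only [vecMul, dotProduct, Finset.sum_mul]
        rw [Finset.sum_comm]
        rfl
    _ = _ := by
        simp only [h1]
        rw [Finset.sum_comm]
        refine Finset.sum_congr rfl fun A _ => ?_
        simp only [pullFam, Matrix.mul_sum, Matrix.sum_apply, mul_smul_comm, Matrix.smul_apply,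
          smul_eq_mul]
        rfl

/-- The algebraic content of umbilicity for the covariant derivative of the SD bivector. -/
theorem umbilic_pointwise {Q g U : Tensor2 ℝ} {η : Tensor4 ℝ} (hQ : IsAdapted Q g η U)
    {c D : Fin 4 → Tensor2 ℝ} (ha : ∀ m, (c m)ᵀ = -c m)
    (hD : ∀ m, D m = dot g (c m) U + dot g U (c m))
    (hc : ∀ m, dot g (D m) U + dot g (dot g U U) (c m) = c m)
    (hV : ∀ C A B, frameSecondForm stdV stdH (pullFam Q⁻¹ D) C A B +
        frameSecondForm stdV stdH (pullFam Q⁻¹ D) C B A =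
      stdV A B * ∑ M, ∑ N, mink M N * frameSecondForm stdV stdH (pullFam Q⁻¹ D) C M N)
    (hH : ∀ C A B, frameSecondForm stdH stdV (pullFam Q⁻¹ (-D)) C A B +
        frameSecondForm stdH stdV (pullFam Q⁻¹ (-D)) C B A =
      stdH A B * ∑ M, ∑ N, mink M N * frameSecondForm stdH stdV (pullFam Q⁻¹ (-D)) C M N)
    {Z : Fin 4 → Tensor2 ℂ}
    (hZ : ∀ m, Z m = rt • (cast ℂ (c m) - Complex.I • hodge g η (cast ℂ (c m))))
    {ξ : Fin 4 → ℂ} (hξ : ∀ b, ξ b = -∑ a, (cast ℂ g⁻¹ * Z a) a b) (m : Fin 4) :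
    Z m = contractLeft g ξ (sdFrame Q 0) m • sdFrame Q 0 + (1 / 2 : ℂ) •
      (wedgeRow (cast ℂ g) ξ m - Complex.I • hodge g η (wedgeRow (cast ℂ g) ξ m)) := by
  have hcast : ∀ A : Tensor2 ℝ, cast ℝ A = A := fun A => rfl
  have hU : Q⁻¹ᵀ * U * Q⁻¹ = stdForm := by
    rw [hQ.form]
    exact hQ.inv_conj (𝕜 := ℝ) stdForm
  have hg : (cast ℂ Q⁻¹)ᵀ * cast ℂ g * cast ℂ Q⁻¹ = cast ℂ mink := by
    rw [hQ.metric, cast_mul, cast_mul, cast_transpose]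
    exact hQ.inv_conj _
  have hfD : D = fun m => dot g (c m) U + dot g U (c m) := funext hD
  have pD : ∀ M, pullFam Q⁻¹ D M = dot mink (pullFam Q⁻¹ c M) stdForm +
      dot mink stdForm (pullFam Q⁻¹ c M) := by
    intro M
    rw [hfD, pullFam_add, pullFam_dot_left hQ, pullFam_dot_right hQ]
    simp only [hcast, hU]
  have pa : ∀ M, (pullFam Q⁻¹ c M)ᵀ = -pullFam Q⁻¹ c M := by
    intro M
    rw [pullFam_transpose]
    simp only [ha]
    exact congrFun (pullFam_neg _ c) M
  -- The derivative of U³ = U, expressed in the frame.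
  have pc : ∀ M, dot mink (dot mink (pullFam Q⁻¹ c M) stdForm +
      dot mink stdForm (pullFam Q⁻¹ c M)) stdForm +
      dot mink (dot mink stdForm stdForm) (pullFam Q⁻¹ c M) = pullFam Q⁻¹ c M := by
    intro M
    have h1 : pullFam Q⁻¹ (fun m => dot g (D m) U + dot g (dot g U U) (c m)) M =
        pullFam Q⁻¹ c M := by
      rw [funext hc]
    rw [pullFam_add, pullFam_dot_left hQ, pullFam_dot_right hQ] at h1
    simp only [hQ.inv_transpose_dot, pD] at h1
    simpa only [hcast, hU] using h1
  rw [pullFam_neg] at hH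
  obtain ⟨a0, a1, a2, a3, b0, b1, d2, d3, h0, h1, h2, h3⟩ := frame_equations pa pc pD hV hH
  have hZ' : Z = fun m => rt • (cast ℂ (c m) - Complex.I • hodge g η (cast ℂ (c m))) := funext hZ
  have pZ : ∀ M, pullFam Q⁻¹ Z M = rt • (cast ℂ (pullFam Q⁻¹ c M) -
      Complex.I • hodge mink eps (cast ℂ (pullFam Q⁻¹ c M))) := by
    intro M
    rw [hZ', pullFam_smul, pullFam_sub, pullFam_cast, pullFam_smul, pullFam_hodge hQ, pullFam_cast]
  have pξ : ∀ B, (ξ ᵥ* cast ℂ Q⁻¹) B =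
      -∑ A, ∑ C, (mink A C : ℂ) * pullFam Q⁻¹ Z A C B := by
    intro B
    have := pull_divergence hQ Z B
    have hx : ξ = -(fun b => ∑ a, (cast ℂ g⁻¹ * Z a) a b) := funext hξ
    rw [hx, neg_vecMul, Pi.neg_apply, this]
    rfl
  have pχ : ∀ M, (contractLeft g ξ (sdFrame Q 0) ᵥ* cast ℂ Q⁻¹) M =
      ∑ A, ∑ C, (ξ ᵥ* cast ℂ Q⁻¹) C * (mink C A : ℂ) * sdStd 0 A M := by
    intro M
    have : contractLeft g ξ (sdFrame Q 0) ᵥ* cast ℂ Q⁻¹ =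
        (ξ ᵥ* cast ℂ Q⁻¹) ᵥ* cast ℂ mink ᵥ* sdStd 0 := by
      rw [contractLeft_eq, vecMul_vecMul, vecMul_vecMul, vecMul_vecMul, hQ.cast_inv_metric]
      congr 1
      calc _ = cast ℂ Q⁻¹ * cast ℂ mink * ((cast ℂ Q⁻¹)ᵀ * sdFrame Q 0 * cast ℂ Q⁻¹) := by
            simp only [Matrix.mul_assoc]
        _ = _ := by rw [sdFrame, hQ.inv_conj, Matrix.mul_assoc]
    rw [this]
    simp only [vecMul, dotProduct, Finset.sum_mul]
    rfl
  have key := umbilic_mink a0 a1 a2 a3 b0 b1 d2 d3 (pullFam Q⁻¹ c) h0 h1 h2 h3 (pullFam Q⁻¹ Z) pZ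
    (ξ ᵥ* cast ℂ Q⁻¹) pξ (contractLeft g ξ (sdFrame Q 0) ᵥ* cast ℂ Q⁻¹) pχ
  -- Both sides are tensors, so the identity may be checked in the frame.
  refine congrFun (hQ.pullFam_injective (T := Z) (T' := fun m =>
    contractLeft g ξ (sdFrame Q 0) m • sdFrame Q 0 + (1 / 2 : ℂ) •
      (wedgeRow (cast ℂ g) ξ m - Complex.I • hodge g η (wedgeRow (cast ℂ g) ξ m))) ?_) m
  ext1 M
  have hw : pullFam Q⁻¹ (fun m => wedgeRow (cast ℂ g) ξ m) =
      fun M => wedgeRow (cast ℂ mink) (ξ ᵥ* cast ℂ Q⁻¹) M := by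
    ext1 M
    rw [← hg]
    exact pullFam_wedgeRow _ _ _ _
  rw [key, pullFam_add]
  beta_reduce
  rw [pullFam_smul_const, pullFam_smul, pullFam_sub, pullFam_smul, pullFam_hodge hQ, hw]
  congr 2
  rw [sdFrame, hQ.inv_conj]

end Umbilic

/-! ### Covariant derivative of the canonical SD bivector -/

namespace Umbilic
open Matrix Filter Topology

section CovMat

variable {𝕜 : Type} [RCLike 𝕜] {G : E4 → Tensor2 ℝ} {F H : E4 → Tensor2 𝕜} {x : E4}

theorem covMat_congr (hFH : F =ᶠ[𝓝 x] H) (m : Fin 4) : covMat G F x m = covMat G H x m := by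
  rw [covMat, covMat, dMat_congr hFH, hFH.eq_of_nhds]

theorem covMat_add (hF : SmoothMat F x) (hH : SmoothMat H x) (m : Fin 4) :
    covMat G (fun y => F y + H y) x m = covMat G F x m + covMat G H x m := by
  simp only [covMat, dMat_add hF hH, Matrix.mul_add, Matrix.add_mul]
  abel

theorem covMat_sub (hF : SmoothMat F x) (hH : SmoothMat H x) (m : Fin 4) :
    covMat G (fun y => F y - H y) x m = covMat G F x m - covMat G H x m := by
  simp only [covMat, dMat_sub hF hH, Matrix.mul_sub, Matrix.sub_mul]
  abel

theorem covMat_neg (m : Fin 4) : covMat G (fun y => -F y) x m = -covMat G F x m := by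
  simp only [covMat, dMat_neg, Matrix.mul_neg, Matrix.neg_mul]
  abel

theorem covMat_smul {f : E4 → 𝕜} (hf : ContDiffAt ℝ ∞ f x) (hF : SmoothMat F x) (m : Fin 4) :
    covMat G (fun y => f y • F y) x m = pd f x m • F x + f x • covMat G F x m := by
  simp only [covMat, dMat_smul hf hF, mul_smul_comm, smul_mul_assoc, smul_sub]
  abel

theorem covMat_const_smul (r : 𝕜) (hF : SmoothMat F x) (m : Fin 4) :
    covMat G (fun y => r • F y) x m = r • covMat G F x m := by
  rw [covMat_smul contDiffAt_const hF, pd_const, zero_smul, zero_add]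

theorem covMat_transpose (m : Fin 4) : covMat G (fun y => (F y)ᵀ) x m = (covMat G F x m)ᵀ := by
  simp only [covMat, dMat_transpose, Matrix.transpose_sub, Matrix.transpose_mul,
    Matrix.transpose_transpose]
  abel

theorem covMat_cast {F : E4 → Tensor2 ℝ} (hF : SmoothMat F x) (m : Fin 4) :
    covMat G (fun y => cast 𝕜 (F y)) x m = cast 𝕜 (covMat G F x m) := by
  simp only [covMat, dMat_cast hF, cast_sub, cast_mul, cast_transpose]
  rfl

end CovMat

theorem sdU_eq (G : E4 → Tensor2 ℝ) (η : E4 → Tensor4 ℝ) (U : E4 → Tensor2 ℝ) (x : E4) :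
    sdU G η U x = rt • (cast ℂ (U x) - Complex.I • hodge (G x) (η x) (cast ℂ (U x))) := by
  rw [← cast_hodge]
  rfl

theorem stdForm_transpose : stdFormᵀ = -stdForm := by
  ext i j; fin_cases i <;> fin_cases j <;> simp [stdForm]

theorem stdForm_cube : stdForm * mink * stdForm * mink * stdForm = stdForm := by
  rw [stdForm_sq]
  ext i j; fin_cases i <;> fin_cases j <;> simp [stdForm, mink, stdV]

namespace IsAdapted

variable {Q g U : Tensor2 ℝ} {η : Tensor4 ℝ}

theorem dot_conj (h : IsAdapted Q g η U) (A B : Tensor2 ℝ) :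
    dot g (Qᵀ * A * Q) (Qᵀ * B * Q) = Qᵀ * (A * mink * B) * Q := by
  have hc : ∀ A : Tensor2 ℝ, cast ℝ A = A := fun A => rfl
  rw [dot_eq, hc, h.inv_metric]
  calc _ = Qᵀ * A * (Q * Q⁻¹) * mink * (Q⁻¹ᵀ * Qᵀ) * B * Q := by
        simp only [Matrix.mul_assoc]
    _ = _ := by
        rw [h.mul_inv, h.inv_transpose_mul]
        simp only [Matrix.mul_assoc, Matrix.mul_one]

theorem form_transpose (h : IsAdapted Q g η U) : Uᵀ = -U := by
  rw [h.form]
  simp only [Matrix.transpose_mul, Matrix.transpose_transpose, stdForm_transpose, Matrix.mul_neg,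
    Matrix.neg_mul, Matrix.mul_assoc]

theorem form_sq (h : IsAdapted Q g η U) : dot g U U = Qᵀ * stdV * Q := by
  rw [h.form, h.dot_conj, stdForm_sq]

/-- U² is the projector on the time-like plane and U lives in that plane. Differentiated, this
relation confines ∇U to mixed components. -/
theorem form_cube (h : IsAdapted Q g η U) : dot g (dot g U U) U = U := by
  rw [h.form_sq]
  conv_lhs => rw [h.form]
  rw [h.dot_conj, ← stdForm_sq, stdForm_cube, ← h.form]

end IsAdapted

namespace AdaptedOn

variable {O : Set E4} {G : E4 → Tensor2 ℝ} {η : E4 → Tensor4 ℝ} {U : E4 → Tensor2 ℝ} {x : E4}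

theorem eventually (h : AdaptedOn O G η U) (hx : x ∈ O) {p : E4 → Prop} (hp : ∀ y ∈ O, p y) :
    ∀ᶠ y in 𝓝 x, p y :=
  Filter.mem_of_superset (h.mem_nhds hx) hp

theorem smooth_dot {𝕜 : Type} [RCLike 𝕜] (h : AdaptedOn O G η U) (hx : x ∈ O)
    {F H : E4 → Tensor2 𝕜} (hF : SmoothMat F x) (hH : SmoothMat H x) :
    SmoothMat (fun y => dot (G y) (F y) (H y)) x := by
  simp only [dot_eq]
  exact (hF.mul (h.smooth_inv hx).cast).mul hH

theorem smooth_sdU (h : AdaptedOn O G η U) (hx : x ∈ O) : SmoothMat (sdU G η U) x := by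
  have hc : SmoothMat (fun y => cast ℂ (U y)) x := (h.smooth_form x hx).cast
  have : sdU G η U = fun y => rt • (cast ℂ (U y) - Complex.I •
      hodge (G y) (η y) (cast ℂ (U y))) := funext (sdU_eq G η U)
  rw [this]
  exact SmoothMat.smul contDiffAt_const
    (hc.sub (SmoothMat.smul contDiffAt_const (h.smooth_hodge hx hc)))

theorem covMat_sdU_eq (h : AdaptedOn O G η U) (hx : x ∈ O) (m : Fin 4) :
    covMat G (sdU G η U) x m = rt • (cast ℂ (covMat G U x m) -
      Complex.I • hodge (G x) (η x) (cast ℂ (covMat G U x m))) := by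
  have hc : SmoothMat (fun y => cast ℂ (U y)) x := (h.smooth_form x hx).cast
  have hh := h.smooth_hodge hx hc
  have hi : SmoothMat (fun y => Complex.I • hodge (G y) (η y) (cast ℂ (U y))) x :=
    SmoothMat.smul contDiffAt_const hh
  have : sdU G η U = fun y => rt • (cast ℂ (U y) - Complex.I •
      hodge (G y) (η y) (cast ℂ (U y))) := funext (sdU_eq G η U)
  rw [this, covMat_const_smul _ (hc.sub hi), covMat_sub hc hi, covMat_const_smul _ hh,
    h.covMat_hodge hx hc, covMat_cast (h.smooth_form x hx)]

theorem codiff_eq {𝕜 : Type} [RCLike 𝕜] (F : E4 → Tensor2 𝕜) (b : Fin 4) :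
    codiff G F x b = -∑ a, (cast 𝕜 (G x)⁻¹ * covMat G F x a) a b := by
  simp only [codiff, covDeriv_eq, Matrix.mul_apply, cast_apply]

/-- For an umbilical structure, the covariant derivative of the canonical SD bivector is
determined by its codifferential. -/
theorem covMat_sdU (h : AdaptedOn O G η U) (hx : x ∈ O) (hu : UmbilicalAt G U x) (m : Fin 4) :
    covMat G (sdU G η U) x m = chi G η U x m • sdU G η U x + (1 / 2 : ℂ) •
      (wedgeRow (cast ℂ (G x)) (codiff G (sdU G η U) x) m - Complex.I • hodge (G x) (η x)
        (wedgeRow (cast ℂ (G x)) (codiff G (sdU G η U) x) m)) := by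
  obtain ⟨Q, hQ⟩ := h.exists_frame x hx
  have hU := h.smooth_form x hx
  have hUU : SmoothMat (projV G U) x := h.smooth_dot hx hU hU
  have hv : covMat G (projV G U) x = fun m => dot (G x) (covMat G U x m) (U x) +
      dot (G x) (U x) (covMat G U x m) := funext fun m => h.covMat_dot hx hU hU m
  -- As ∇g = 0, the two projectors have opposite derivatives, so both umbilicity conditions concern
  -- a single tensor.
  have hh : covMat G (projH G U) x = -covMat G (projV G U) x := by
    ext1 m
    have : projH G U = fun y => G y - projV G U y := rfl
    rw [this, covMat_sub (h.smooth_metric x hx) hUU, h.covMat_metric hx, zero_sub]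
    rfl
  have pv : projV G U x = Qᵀ * stdV * Q := hQ.form_sq
  have ph : projH G U x = Qᵀ * stdH * Q := by
    rw [projH, pv, hQ.metric, ← Matrix.sub_mul, ← Matrix.mul_sub, mink_sub_stdV]
  have e0 : sdU G η U x = sdFrame Q 0 := hQ.selfDualPart_eq
  have := umbilic_pointwise hQ (c := covMat G U x) (D := covMat G (projV G U) x)
    (fun m => ?_) (fun m => by rw [hv]) (fun m => ?_)
    (pull_umbilical hQ pv ph hu.1) ?_ (h.covMat_sdU_eq hx) (codiff_eq (sdU G η U)) m
  · rw [this, chi, e0]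
  · rw [← covMat_transpose, ← covMat_neg]
    exact covMat_congr (h.eventually hx fun y hy =>
      (h.exists_frame y hy).elim fun Q hQ => hQ.form_transpose) m
  -- Leibniz rule for U²·U, which equals U on a neighbourhood.
  · refine (h.covMat_dot hx hUU hU m).symm.trans (covMat_congr ?_ m)
    exact h.eventually hx fun y hy => (h.exists_frame y hy).elim fun Q hQ => hQ.form_cube
  · rw [← hh]
    refine pull_umbilical hQ ph ?_ hu.2
    rw [projH, sub_sub_cancel, pv]

end AdaptedOn

end Umbilic

/-! ### Algebraic consequences of the integrability conditions -/

namespace Umbilic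
open Matrix Filter Topology

namespace SDTriple

variable {g : Tensor2 ℝ} {η : Tensor4 ℝ} {e : Fin 3 → Tensor2 ℂ}

theorem inv_transpose (s : SDTriple g η e) : (cast ℂ g⁻¹)ᵀ = cast ℂ g⁻¹ := by
  rw [← cast_transpose, transpose_nonsing_inv, s.metric_transpose]

theorem cast_inv_mul (s : SDTriple g η e) : cast ℂ g⁻¹ * cast ℂ g = 1 := by
  rw [← cast_mul, s.inv_mul, cast_one]

theorem mul_inv_transpose (s : SDTriple g η e) (i : Fin 3) :
    (cast ℂ g⁻¹ * e i)ᵀ = -(e i * cast ℂ g⁻¹) := by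
  rw [Matrix.transpose_mul, s.transpose, s.inv_transpose, Matrix.neg_mul]

theorem trace_mul (s : SDTriple g η e) (i j : Fin 3) :
    (cast ℂ g⁻¹ * e i * (cast ℂ g⁻¹ * e j)).trace = if i = j then 2 else 0 := by
  rw [s.mul]
  split_ifs
  · simp [Matrix.trace_smul]; norm_num
  · rw [Matrix.trace_smul, s.trace, smul_zero]
  · rw [Matrix.trace_smul, s.trace, smul_zero]

/-- Raising the index of g_m gives the m-th coordinate vector. By antisymmetry of `e i` the two
terms of the wedge contribute equally. -/
theorem trace_wedgeRow (s : SDTriple g η e) (θ : Fin 4 → ℂ) (m : Fin 4) (i : Fin 3) :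
    (cast ℂ g⁻¹ * wedgeRow (cast ℂ g) θ m * (cast ℂ g⁻¹ * e i)).trace =
      -2 * (θ ᵥ* (cast ℂ g⁻¹ * e i)) m := by
  have h1 : cast ℂ g m = fun a => cast ℂ g a m := by
    ext a
    rw [cast_apply, cast_apply, ← s.metric_transpose, Matrix.transpose_apply, s.metric_transpose]
  have h2 : cast ℂ g⁻¹ *ᵥ (cast ℂ g m) = Pi.single m 1 := by
    rw [h1]
    ext a
    have := congrFun (congrFun s.cast_inv_mul a) m
    rw [Matrix.mul_apply, Matrix.one_apply] at this
    rw [mulVec, dotProduct, this, Pi.single_apply]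
  rw [wedgeRow_eq, Matrix.mul_sub, Matrix.sub_mul, Matrix.trace_sub, mul_vecMulVec, mul_vecMulVec,
    h2, vecMulVec_mul, vecMulVec_mul, trace_vecMulVec, trace_vecMulVec, single_one_dotProduct,
    ← vecMul_vecMul]
  have h3 : cast ℂ g m ᵥ* cast ℂ g⁻¹ = Pi.single m 1 := by
    rw [← s.inv_transpose, vecMul_transpose, h2]
  rw [h3, single_one_vecMul]
  have h4 : (cast ℂ g⁻¹ *ᵥ θ) ⬝ᵥ (e i).row m = -(θ ᵥ* (cast ℂ g⁻¹ * e i)) m := by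
    have : (e i).row m = -(fun a => e i a m) := by
      ext a
      exact antisymm_apply (s.transpose i) m a
    rw [this, dotProduct_neg, ← vecMul_vecMul]
    rw [← s.inv_transpose, mulVec_transpose, s.inv_transpose]
    rfl
  rw [h4]
  ring

/-- The twofold trace of the SD part of `θ ∧ g_m` with the SD basis. -/
theorem trace_sdPart_wedgeRow (s : SDTriple g η e) {F : Tensor2 ℂ} (hF : Fᵀ = -F) (i : Fin 3) :
    (cast ℂ g⁻¹ * (F - Complex.I • hodge g η F) * (cast ℂ g⁻¹ * e i)).trace =
      2 * (cast ℂ g⁻¹ * F * (cast ℂ g⁻¹ * e i)).trace := by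
  rw [s.sdPart F hF, Matrix.mul_sum, Matrix.sum_mul, Matrix.trace_sum]
  simp only [mul_smul_comm, smul_mul_assoc, Matrix.trace_smul, s.trace_mul, smul_eq_mul, mul_ite,
    mul_zero, Finset.sum_ite_eq', Finset.mem_univ, if_true]
  ring

theorem sdPart_wedgeRow (s : SDTriple g η e) (θ : Fin 4 → ℂ) (m : Fin 4) :
    wedgeRow (cast ℂ g) θ m - Complex.I • hodge g η (wedgeRow (cast ℂ g) θ m) =
      ∑ i, (-2 * (θ ᵥ* (cast ℂ g⁻¹ * e i)) m) • e i := by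
  rw [s.sdPart _ (wedgeRow_transpose _ _ _)]
  simp only [s.trace_wedgeRow]

end SDTriple

/-- The algebraic relations at a point between the curvature and the second derivatives of an
umbilical structure, in terms of the covariant derivative `T` of `ξ = δ𝒰` and of `D = dχ`. -/
structure IntegrabilityData (g : Tensor2 ℝ) (η : Tensor4 ℝ) (e : Fin 3 → Tensor2 ℂ)
    (R : Fin 4 → Fin 4 → Tensor2 ℂ) (ξ : Fin 4 → ℂ) (T D : Tensor2 ℂ)
    (Z : Fin 4 → Tensor2 ℂ) : Prop where
  triple : SDTriple g η e
  curv_transpose : ∀ k m, cast ℂ g⁻¹ * (R k m)ᵀ = -(R k m * cast ℂ g⁻¹)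
  deriv : ∀ m, Z m = (ξ ᵥ* (cast ℂ g⁻¹ * e 0)) m • e 0 + (1 / 2 : ℂ) •
    (wedgeRow (cast ℂ g) ξ m - Complex.I • hodge g η (wedgeRow (cast ℂ g) ξ m))
  ricci : ∀ k m, D k m • e 0 + ((ξ ᵥ* (cast ℂ g⁻¹ * e 0)) m • Z k -
      (ξ ᵥ* (cast ℂ g⁻¹ * e 0)) k • Z m) + (1 / 2 : ℂ) •
      ((wedgeRow (cast ℂ g) (T k) m - Complex.I • hodge g η (wedgeRow (cast ℂ g) (T k) m)) -
        (wedgeRow (cast ℂ g) (T m) k - Complex.I • hodge g η (wedgeRow (cast ℂ g) (T m) k))) =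
    -((R k m)ᵀ * e 0) - e 0 * R k m
  ext_deriv : ∀ k m, D k m = ((T k ᵥ* (cast ℂ g⁻¹ * e 0)) m + (ξ ᵥ* (cast ℂ g⁻¹ * Z k)) m) -
    ((T m ᵥ* (cast ℂ g⁻¹ * e 0)) k + (ξ ᵥ* (cast ℂ g⁻¹ * Z m)) k)

namespace IntegrabilityData

variable {g : Tensor2 ℝ} {η : Tensor4 ℝ} {e : Fin 3 → Tensor2 ℂ}
  {R : Fin 4 → Fin 4 → Tensor2 ℂ} {ξ : Fin 4 → ℂ} {T D : Tensor2 ℂ} {Z : Fin 4 → Tensor2 ℂ}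

/-- The Ricci identity paired with `e i`: the dχ term disappears because `e 0` and `e i` are
orthogonal, and the curvature terms assemble into a trace against the commutator of `e 0` and `e i`.
-/
theorem trace_curv (d : IntegrabilityData g η e R ξ T D Z) {i : Fin 3} (hi : i ≠ 0) (k m : Fin 4) :
    (R k m * (cast ℂ g⁻¹ * e 0 * (cast ℂ g⁻¹ * e i) -
      cast ℂ g⁻¹ * e i * (cast ℂ g⁻¹ * e 0))).trace =
    -2 * ((ξ ᵥ* (cast ℂ g⁻¹ * e 0)) m * (ξ ᵥ* (cast ℂ g⁻¹ * e i)) k -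
      (ξ ᵥ* (cast ℂ g⁻¹ * e 0)) k * (ξ ᵥ* (cast ℂ g⁻¹ * e i)) m) -
    2 * ((T k ᵥ* (cast ℂ g⁻¹ * e i)) m - (T m ᵥ* (cast ℂ g⁻¹ * e i)) k) := by
  have s := d.triple
  have h := congrArg (fun A => (cast ℂ g⁻¹ * A * (cast ℂ g⁻¹ * e i)).trace) (d.ricci k m)
  have h0 : (cast ℂ g⁻¹ * e 0 * (cast ℂ g⁻¹ * e i)).trace = 0 := by
    rw [s.trace_mul, if_neg hi.symm]
  have hw : ∀ θ m, (cast ℂ g⁻¹ * (wedgeRow (cast ℂ g) θ m - Complex.I • hodge g η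
      (wedgeRow (cast ℂ g) θ m)) * (cast ℂ g⁻¹ * e i)).trace =
      -4 * (θ ᵥ* (cast ℂ g⁻¹ * e i)) m := by
    intro θ m
    rw [s.trace_sdPart_wedgeRow (wedgeRow_transpose _ _ _), s.trace_wedgeRow]
    ring
  have hz : ∀ m, (cast ℂ g⁻¹ * Z m * (cast ℂ g⁻¹ * e i)).trace =
      -2 * (ξ ᵥ* (cast ℂ g⁻¹ * e i)) m := by
    intro m
    rw [d.deriv, Matrix.mul_add, Matrix.add_mul, Matrix.trace_add, mul_smul_comm, mul_smul_comm,
      smul_mul_assoc, smul_mul_assoc, Matrix.trace_smul, Matrix.trace_smul, hw, h0, smul_eq_mul,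
      smul_eq_mul]
    ring
  -- Antisymmetry of the lowered curvature moves the transposed term to the other side of `e 0`;
  -- cyclicity of the trace does the rest.
  have hr : (cast ℂ g⁻¹ * (-((R k m)ᵀ * e 0) - e 0 * R k m) * (cast ℂ g⁻¹ * e i)).trace =
      (R k m * (cast ℂ g⁻¹ * e 0 * (cast ℂ g⁻¹ * e i) -
      cast ℂ g⁻¹ * e i * (cast ℂ g⁻¹ * e 0))).trace := by
    rw [Matrix.mul_sub, Matrix.mul_neg, ← Matrix.mul_assoc (cast ℂ g⁻¹) _ (e 0), d.curv_transpose,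
      Matrix.mul_sub, Matrix.sub_mul, Matrix.trace_sub, Matrix.trace_sub]
    congr 1
    · simp only [Matrix.neg_mul, neg_neg, Matrix.mul_assoc]
    · rw [← Matrix.mul_assoc (cast ℂ g⁻¹) (e 0) (R k m), Matrix.trace_mul_comm,
        ← Matrix.mul_assoc, Matrix.trace_mul_comm]
  rw [hr] at h
  rw [← h]
  simp only [Matrix.mul_add, Matrix.mul_sub, Matrix.add_mul, Matrix.sub_mul, mul_smul_comm,
    smul_mul_assoc, Matrix.trace_add, Matrix.trace_sub, Matrix.trace_smul, smul_eq_mul, h0,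
    hz] at hw ⊢
  linear_combination (1 / 2 : ℂ) * hw (T k) m - (1 / 2 : ℂ) * hw (T m) k

theorem trace_vecMulVec_mul (E : Tensor2 ℂ) (a b : Fin 4 → ℂ) :
    (E * vecMulVec a b).trace = b ⬝ᵥ (E *ᵥ a) := by
  rw [mul_vecMulVec, trace_vecMulVec, dotProduct_comm]

/-- The curvature, contracted with SD bivectors. -/
theorem sum_curv (d : IntegrabilityData g η e R ξ T D Z) {i : Fin 3} (hi : i ≠ 0) (j : Fin 3) :
    ∑ k, ∑ m, (cast ℂ g⁻¹ * e j * cast ℂ g⁻¹) k m *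
      (R k m * (cast ℂ g⁻¹ * e 0 * (cast ℂ g⁻¹ * e i) -
        cast ℂ g⁻¹ * e i * (cast ℂ g⁻¹ * e 0))).trace =
    4 * (ξ ⬝ᵥ ((cast ℂ g⁻¹ * e i * (cast ℂ g⁻¹ * e j) * (cast ℂ g⁻¹ * e 0) * cast ℂ g⁻¹) *ᵥ ξ)) +
      4 * (T * (cast ℂ g⁻¹ * e i * (cast ℂ g⁻¹ * e j)) * cast ℂ g⁻¹).trace := by
  have s := d.triple
  set E := cast ℂ g⁻¹ * e j * cast ℂ g⁻¹ with hE
  have hEt : Eᵀ = -E := by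
    rw [hE, Matrix.transpose_mul, s.mul_inv_transpose, s.inv_transpose, Matrix.mul_neg,
      Matrix.mul_assoc]
  set a := ξ ᵥ* (cast ℂ g⁻¹ * e i) with ha
  set χ := ξ ᵥ* (cast ℂ g⁻¹ * e 0) with hχ
  set N := T * (cast ℂ g⁻¹ * e i) with hN
  have h1 : ∀ k m, (R k m * (cast ℂ g⁻¹ * e 0 * (cast ℂ g⁻¹ * e i) -
        cast ℂ g⁻¹ * e i * (cast ℂ g⁻¹ * e 0))).trace =
      ((-2 : ℂ) • (vecMulVec a χ - vecMulVec χ a) - (2 : ℂ) • (N - Nᵀ)) k m := by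
    intro k m
    rw [d.trace_curv hi]
    simp only [Matrix.sub_apply, Matrix.smul_apply, vecMulVec_apply, smul_eq_mul,
      Matrix.transpose_apply]
    rw [mul_comm (a k)]
    rfl
  simp only [h1]
  rw [sum_mul_eq_trace]
  -- `E` is antisymmetric, so the two halves of the antisymmetrised `N` contribute equally.
  have h2 : (E * N).trace = (E * Nᵀ).trace * (-1) := by
    rw [← Matrix.trace_transpose, Matrix.transpose_mul, hEt, Matrix.mul_neg, Matrix.trace_neg,
      Matrix.trace_mul_comm]
    ring
  have h3 : a ⬝ᵥ (E *ᵥ χ) = -(χ ⬝ᵥ (E *ᵥ a)) := by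
    rw [dotProduct_mulVec, ← mulVec_transpose, hEt, neg_mulVec, neg_dotProduct, dotProduct_comm]
  have h4 : a ⬝ᵥ (E *ᵥ χ) = -(ξ ⬝ᵥ ((cast ℂ g⁻¹ * e i * (cast ℂ g⁻¹ * e j) *
      (cast ℂ g⁻¹ * e 0) * cast ℂ g⁻¹) *ᵥ ξ)) := by
    have : χ = -((e 0 * cast ℂ g⁻¹) *ᵥ ξ) := by
      rw [hχ, ← mulVec_transpose, s.mul_inv_transpose, neg_mulVec]
    rw [this, mulVec_neg, dotProduct_neg, ha, ← dotProduct_mulVec, mulVec_mulVec, mulVec_mulVec, hE]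
    simp only [Matrix.mul_assoc]
  have h5 : (E * N).trace = (T * (cast ℂ g⁻¹ * e i * (cast ℂ g⁻¹ * e j)) * cast ℂ g⁻¹).trace := by
    rw [Matrix.trace_mul_comm, hN, hE]
    simp only [Matrix.mul_assoc]
  rw [← h5]
  simp only [Matrix.transpose_sub, Matrix.transpose_smul, transpose_vecMulVec,
    Matrix.transpose_transpose, Matrix.mul_sub, mul_smul_comm, Matrix.trace_sub, Matrix.trace_smul,
    trace_vecMulVec_mul, smul_eq_mul]
  linear_combination -2 * h2 - 4 * h4 + 2 * h3

/-- The exterior derivative of `χ`, contracted with SD bivectors. -/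
theorem trace_ext_deriv (d : IntegrabilityData g η e R ξ T D Z) (j : Fin 3) :
    (cast ℂ g⁻¹ * D * (cast ℂ g⁻¹ * e j)).trace =
      2 * (T * (cast ℂ g⁻¹ * e 0 * (cast ℂ g⁻¹ * e j)) * cast ℂ g⁻¹).trace := by
  have s := d.triple
  -- The terms quadratic in ξ are symmetric in k and m, hence drop out of dχ; only ∇ξ remains.
  have hz : ∀ k m, (ξ ᵥ* (cast ℂ g⁻¹ * Z k)) m =
      (ξ ᵥ* (cast ℂ g⁻¹ * e 0)) k * (ξ ᵥ* (cast ℂ g⁻¹ * e 0)) m -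
        ∑ i, (ξ ᵥ* (cast ℂ g⁻¹ * e i)) k * (ξ ᵥ* (cast ℂ g⁻¹ * e i)) m := by
    intro k m
    rw [d.deriv, s.sdPart_wedgeRow, Matrix.mul_add, vecMul_add, mul_smul_comm, vecMul_smul,
      mul_smul_comm, vecMul_smul, Matrix.mul_sum, vecMul_sum]
    simp only [mul_smul_comm, vecMul_smul, Pi.add_apply, Pi.smul_apply, Finset.sum_apply,
      smul_eq_mul, Finset.mul_sum]
    rw [sub_eq_add_neg, ← Finset.sum_neg_distrib]
    congr 1
    exact Finset.sum_congr rfl fun i _ => by ring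
  have hD : D = T * (cast ℂ g⁻¹ * e 0) - (T * (cast ℂ g⁻¹ * e 0))ᵀ := by
    ext k m
    have h1 : (ξ ᵥ* (cast ℂ g⁻¹ * Z m)) k = (ξ ᵥ* (cast ℂ g⁻¹ * Z k)) m := by
      rw [hz, hz]
      simp only [mul_comm]
    rw [d.ext_deriv, h1, add_sub_add_right_eq_sub]
    rfl
  have h2 : ∀ N : Tensor2 ℂ, (cast ℂ g⁻¹ * Nᵀ * (cast ℂ g⁻¹ * e j)).trace =
      -(N * (cast ℂ g⁻¹ * e j) * cast ℂ g⁻¹).trace := by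
    intro N
    rw [← Matrix.trace_transpose, Matrix.transpose_mul _ (cast ℂ g⁻¹ * e j), s.mul_inv_transpose,
      Matrix.transpose_mul, Matrix.transpose_transpose, s.inv_transpose, Matrix.neg_mul,
      Matrix.trace_neg, Matrix.trace_mul_comm]
    simp only [Matrix.mul_assoc]
  rw [hD, Matrix.mul_sub, Matrix.sub_mul, Matrix.trace_sub, h2, Matrix.mul_assoc (cast ℂ g⁻¹),
    Matrix.trace_mul_comm]
  simp only [Matrix.mul_assoc]
  ring

end IntegrabilityData

end Umbilic

/-! ### The integrability conditions of an umbilical structure -/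

namespace Umbilic
open Matrix Filter Topology

section

variable {𝕜 : Type} [RCLike 𝕜] {G : E4 → Tensor2 ℝ} {x : E4}

/-- The covariant derivative `∇_k θ_b` of a 1-form. -/
def covVec (G : E4 → Tensor2 ℝ) (θ : E4 → Fin 4 → 𝕜) (x : E4) : Tensor2 𝕜 :=
  Matrix.of fun k b => pd (fun y => θ y b) x k - (θ x ᵥ* cast 𝕜 (Gam G x k)) b

theorem contDiffAt_vecMul {θ : E4 → Fin 4 → 𝕜} {F : E4 → Tensor2 𝕜}
    (hθ : ∀ b, ContDiffAt ℝ ∞ (fun y => θ y b) x) (hF : SmoothMat F x) (m : Fin 4) :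
    ContDiffAt ℝ ∞ (fun y => (θ y ᵥ* F y) m) x := by
  simp only [vecMul, dotProduct]
  exact ContDiffAt.sum fun b _ => (hθ b).mul (hF b m)

theorem pd_vecMul {θ : E4 → Fin 4 → 𝕜} {F : E4 → Tensor2 𝕜}
    (hθ : ∀ b, ContDiffAt ℝ ∞ (fun y => θ y b) x) (hF : SmoothMat F x) (k m : Fin 4) :
    pd (fun y => (θ y ᵥ* F y) m) x k =
      ((fun b => pd (fun y => θ y b) x k) ᵥ* F x) m + (θ x ᵥ* dMat F x k) m := by
  simp only [vecMul, dotProduct]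
  rw [pd_sum _ fun b _ => (hθ b).mul (hF b m), ← Finset.sum_add_distrib]
  exact Finset.sum_congr rfl fun b _ => pd_mul (hθ b) (hF b m) k

end

namespace AdaptedOn

variable {O : Set E4} {G : E4 → Tensor2 ℝ} {η : E4 → Tensor4 ℝ} {U : E4 → Tensor2 ℝ} {x : E4}

theorem smooth_covMat {𝕜 : Type} [RCLike 𝕜] (h : AdaptedOn O G η U) (hx : x ∈ O)
    {F : E4 → Tensor2 𝕜} (hF : SmoothMat F x) (m : Fin 4) :
    SmoothMat (fun y => covMat G F y m) x :=
  ((hF.dMat m).sub ((h.smooth_Gam hx m).cast.transpose.mul hF)).sub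
    (hF.mul (h.smooth_Gam hx m).cast)

theorem smooth_codiff {𝕜 : Type} [RCLike 𝕜] (h : AdaptedOn O G η U) (hx : x ∈ O)
    {F : E4 → Tensor2 𝕜} (hF : SmoothMat F x) (b : Fin 4) :
    ContDiffAt ℝ ∞ (fun y => codiff G F y b) x := by
  simp only [codiff_eq]
  exact (ContDiffAt.sum fun a _ =>
    ((h.smooth_inv hx).cast.mul (h.smooth_covMat hx hF a)) a b).neg

theorem smooth_chi (h : AdaptedOn O G η U) (hx : x ∈ O) (m : Fin 4) :
    ContDiffAt ℝ ∞ (fun y => chi G η U y m) x := by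
  simp only [chi, contractLeft_eq]
  exact contDiffAt_vecMul (h.smooth_codiff hx (h.smooth_sdU hx))
    ((h.smooth_inv hx).cast.mul (h.smooth_sdU hx)) m

theorem pd_metric (h : AdaptedOn O G η U) (hx : x ∈ O) (k m c : Fin 4) :
    pd (fun y => cast ℂ (G y) m c) x k =
      ∑ l, cast ℂ (Gam G x k) l m * cast ℂ (G x) l c +
        ∑ l, cast ℂ (G x) m l * cast ℂ (Gam G x k) l c := by
  have := congrFun (congrFun (dMat_cast (𝕜 := ℂ) (h.smooth_metric x hx) k) m) c
  rw [h.dMat_metric hx, cast_add, cast_mul, cast_mul, cast_transpose] at this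
  exact this

theorem smooth_wedgeRow (h : AdaptedOn O G η U) (hx : x ∈ O) {θ : E4 → Fin 4 → ℂ}
    (hθ : ∀ b, ContDiffAt ℝ ∞ (fun y => θ y b) x) (m : Fin 4) :
    SmoothMat (fun y => wedgeRow (cast ℂ (G y)) (θ y) m) x := fun b c =>
  ((hθ b).mul ((h.smooth_metric x hx).cast m c)).sub ((hθ c).mul ((h.smooth_metric x hx).cast m b))

/-- `covMat` treats `m` as a mere label; the sum over Γ is the missing connection term for that
index. -/
theorem covMat_wedgeRow (h : AdaptedOn O G η U) (hx : x ∈ O) {θ : E4 → Fin 4 → ℂ}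
    (hθ : ∀ b, ContDiffAt ℝ ∞ (fun y => θ y b) x) (k m : Fin 4) :
    covMat G (fun y => wedgeRow (cast ℂ (G y)) (θ y) m) x k =
      wedgeRow (cast ℂ (G x)) (covVec G θ x k) m +
        ∑ l, cast ℂ (Gam G x k) l m • wedgeRow (cast ℂ (G x)) (θ x) l := by
  have hg : ∀ a b, ContDiffAt ℝ ∞ (fun y => cast ℂ (G y) a b) x :=
    fun a b => (h.smooth_metric x hx).cast a b
  have hd : dMat (fun y => wedgeRow (cast ℂ (G y)) (θ y) m) x k = Matrix.of fun b c =>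
      (pd (fun y => θ y b) x k * cast ℂ (G x) m c + θ x b * pd (fun y => cast ℂ (G y) m c) x k) -
      (pd (fun y => θ y c) x k * cast ℂ (G x) m b + θ x c * pd (fun y => cast ℂ (G y) m b) x k) := by
    ext b c
    simp only [dMat, wedgeRow, Matrix.of_apply]
    rw [pd_sub ((hθ b).mul (hg m c)) ((hθ c).mul (hg m b)), pd_mul (hθ b) (hg m c),
      pd_mul (hθ c) (hg m b)]
  rw [covMat, hd]
  ext b c
  simp only [h.pd_metric hx, Matrix.sub_apply, Matrix.add_apply, Matrix.of_apply, Matrix.mul_apply,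
    Matrix.transpose_apply, wedgeRow, covVec, vecMul, dotProduct,
    Matrix.smul_apply, smul_eq_mul, Fin.sum_univ_four]
  ring

theorem covMat_sd_wedgeRow (h : AdaptedOn O G η U) (hx : x ∈ O) {θ : E4 → Fin 4 → ℂ}
    (hθ : ∀ b, ContDiffAt ℝ ∞ (fun y => θ y b) x) (k m : Fin 4) :
    covMat G (fun y => wedgeRow (cast ℂ (G y)) (θ y) m -
        Complex.I • hodge (G y) (η y) (wedgeRow (cast ℂ (G y)) (θ y) m)) x k =
      (wedgeRow (cast ℂ (G x)) (covVec G θ x k) m -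
        Complex.I • hodge (G x) (η x) (wedgeRow (cast ℂ (G x)) (covVec G θ x k) m)) +
      ∑ l, cast ℂ (Gam G x k) l m • (wedgeRow (cast ℂ (G x)) (θ x) l -
        Complex.I • hodge (G x) (η x) (wedgeRow (cast ℂ (G x)) (θ x) l)) := by
  have hw := h.smooth_wedgeRow hx hθ m
  have hh := h.smooth_hodge hx hw
  rw [covMat_sub hw (SmoothMat.smul contDiffAt_const hh), covMat_const_smul _ hh,
    h.covMat_hodge hx hw, h.covMat_wedgeRow hx hθ, map_add, map_sum]
  simp only [map_smul, smul_add, smul_sub, Finset.smul_sum, Finset.sum_sub_distrib]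
  rw [add_sub_add_comm]
  congr 2
  exact Finset.sum_congr rfl fun l _ => smul_comm _ _ _

theorem Gam_symm (h : AdaptedOn O G η U) (hx : x ∈ O) (k l m : Fin 4) :
    Gam G x k l m = Gam G x m l k := h.christoffel_symm hx l k m

theorem pd_chi (h : AdaptedOn O G η U) (hx : x ∈ O) (k m : Fin 4) :
    pd (fun y => chi G η U y m) x k =
      ((covVec G (codiff G (sdU G η U)) x k ᵥ* (cast ℂ (G x)⁻¹ * sdU G η U x)) m +
        (codiff G (sdU G η U) x ᵥ* (cast ℂ (G x)⁻¹ * covMat G (sdU G η U) x k)) m) +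
      (chi G η U x ᵥ* cast ℂ (Gam G x k)) m := by
  have hs := h.smooth_sdU hx
  have hi := (h.smooth_inv hx).cast (𝕜 := ℂ)
  have e : ∀ y, chi G η U y = codiff G (sdU G η U) y ᵥ* (cast ℂ (G y)⁻¹ * sdU G η U y) :=
    fun y => contractLeft_eq _ _ _
  simp only [e]
  rw [pd_vecMul (h.smooth_codiff hx hs) (hi.mul hs), dMat_mul hi hs, dMat_cast (h.smooth_inv hx),
    h.dMat_inv hx]
  have hv : (fun b => pd (fun y => codiff G (sdU G η U) y b) x k) =
      covVec G (codiff G (sdU G η U)) x k + codiff G (sdU G η U) x ᵥ* cast ℂ (Gam G x k) := by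
    ext b
    simp [covVec]
  have hm : dMat (sdU G η U) x k = covMat G (sdU G η U) x k +
      (cast ℂ (Gam G x k))ᵀ * sdU G η U x + sdU G η U x * cast ℂ (Gam G x k) := by
    rw [covMat]; abel
  rw [hv, hm, add_vecMul, Pi.add_apply, cast_sub, cast_neg, cast_mul, cast_mul, cast_transpose]
  simp only [vecMul_vecMul, Matrix.mul_add, Matrix.sub_mul, Matrix.neg_mul, vecMul_add, vecMul_sub,
    vecMul_neg, Pi.add_apply, Pi.sub_apply, Pi.neg_apply, Matrix.mul_assoc]
  ring

/-- The integrability conditions of an umbilical structure. -/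
theorem integrabilityData (h : AdaptedOn O G η U) (hu : ∀ y ∈ O, UmbilicalAt G U y) (hx : x ∈ O)
    {Q : Tensor2 ℝ} (hQ : IsAdapted Q (G x) (η x) (U x)) :
    IntegrabilityData (G x) (η x) (sdFrame Q) (fun k m => cast ℂ (Curv G x k m))
      (codiff G (sdU G η U) x) (covVec G (codiff G (sdU G η U)) x) (extD (chi G η U) x)
      (covMat G (sdU G η U) x) := by
  have hs := h.smooth_sdU hx
  have hξ := h.smooth_codiff hx hs
  have e0 : sdU G η U x = sdFrame Q 0 := hQ.selfDualPart_eq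
  have hχ : chi G η U x = codiff G (sdU G η U) x ᵥ* (cast ℂ (G x)⁻¹ * sdFrame Q 0) := by
    rw [chi, contractLeft_eq, e0]
  have hD : ∀ k m, extD (chi G η U) x k m =
      pd (fun y => chi G η U y m) x k - pd (fun y => chi G η U y k) x m := fun k m => rfl
  refine ⟨hQ.sdTriple, fun k m => ?_, fun m => ?_, fun k m => ?_, fun k m => ?_⟩
  · have h1 := h.curv_transpose hx k m
    have h2 : (G x)⁻¹ * (Curv G x k m)ᵀ = -(Curv G x k m * (G x)⁻¹) := by
      calc _ = (G x)⁻¹ * ((Curv G x k m)ᵀ * (G x)ᵀ) * (G x)⁻¹ := by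
            rw [h.symm hx, Matrix.mul_assoc, Matrix.mul_assoc, h.mul_inv hx, Matrix.mul_one]
        _ = -(((G x)⁻¹ * G x) * Curv G x k m * (G x)⁻¹) := by
            rw [← Matrix.transpose_mul, h1]
            simp only [Matrix.mul_neg, Matrix.neg_mul, Matrix.mul_assoc]
        _ = _ := by rw [h.inv_mul hx, Matrix.one_mul]
    rw [← cast_transpose, ← cast_mul, h2, cast_neg, cast_mul]
  · rw [h.covMat_sdU hx (hu x hx), hχ, e0]
  · have hz : ∀ k m, covMat G (fun y => covMat G (sdU G η U) y m) x k =
        pd (fun y => chi G η U y m) x k • sdU G η U x +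
        chi G η U x m • covMat G (sdU G η U) x k + (1 / 2 : ℂ) •
        ((wedgeRow (cast ℂ (G x)) (covVec G (codiff G (sdU G η U)) x k) m -
        Complex.I • hodge (G x) (η x)
          (wedgeRow (cast ℂ (G x)) (covVec G (codiff G (sdU G η U)) x k) m)) +
        ∑ l, cast ℂ (Gam G x k) l m • (wedgeRow (cast ℂ (G x)) (codiff G (sdU G η U) x) l -
          Complex.I • hodge (G x) (η x)
            (wedgeRow (cast ℂ (G x)) (codiff G (sdU G η U) x) l))) := by
      intro k m
      have hw := h.smooth_wedgeRow hx hξ m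
      have hw' := hw.sub (SmoothMat.smul (contDiffAt_const (c := Complex.I)) (h.smooth_hodge hx hw))
      rw [covMat_congr (h.eventually hx fun y hy => h.covMat_sdU hy (hu y hy) m),
        covMat_add (SmoothMat.smul (h.smooth_chi hx m) hs) (SmoothMat.smul contDiffAt_const hw'),
        covMat_smul (h.smooth_chi hx m) hs, covMat_const_smul _ hw', h.covMat_sd_wedgeRow hx hξ]
    have hr := h.ricci_identity hx hs k m
    rw [hz, hz, e0] at hr
    -- By symmetry of Γ the correction terms for the label index cancel on antisymmetrising in k and
    -- m.
    have hsum : ∑ l, cast ℂ (Gam G x k) l m • (wedgeRow (cast ℂ (G x)) (codiff G (sdU G η U) x) l -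
          Complex.I • hodge (G x) (η x)
            (wedgeRow (cast ℂ (G x)) (codiff G (sdU G η U) x) l)) =
        ∑ l, cast ℂ (Gam G x m) l k • (wedgeRow (cast ℂ (G x)) (codiff G (sdU G η U) x) l -
          Complex.I • hodge (G x) (η x)
            (wedgeRow (cast ℂ (G x)) (codiff G (sdU G η U) x) l)) :=
      Finset.sum_congr rfl fun l _ => by
        rw [cast_apply, cast_apply, h.Gam_symm hx]
    rw [hsum] at hr
    rw [← hr, ← hχ, hD]
    module
  · have hsum : (chi G η U x ᵥ* cast ℂ (Gam G x k)) m = (chi G η U x ᵥ* cast ℂ (Gam G x m)) k := by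
      simp only [vecMul, dotProduct]
      exact Finset.sum_congr rfl fun l _ => by
        rw [cast_apply, cast_apply, h.Gam_symm hx]
    rw [hD, h.pd_chi hx, h.pd_chi hx, hsum, e0]
    ring

end AdaptedOn

end Umbilic

/-! ### The Weyl matrix of an umbilical structure -/

namespace Umbilic
open Matrix Filter Topology

namespace SDTriple

variable {g : Tensor2 ℝ} {η : Tensor4 ℝ} {e : Fin 3 → Tensor2 ℂ}

theorem mul_self (s : SDTriple g η e) (i : Fin 3) :
    cast ℂ g⁻¹ * e i * (cast ℂ g⁻¹ * e i) = (1 / 2 : ℂ) • 1 := by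
  rw [s.mul, if_pos rfl]

theorem mul_values (s : SDTriple g η e) :
    (cast ℂ g⁻¹ * e 0 * (cast ℂ g⁻¹ * e 1) = (-(rt * Complex.I)) • (cast ℂ g⁻¹ * e 2) ∧
      cast ℂ g⁻¹ * e 1 * (cast ℂ g⁻¹ * e 0) = (rt * Complex.I) • (cast ℂ g⁻¹ * e 2)) ∧
    (cast ℂ g⁻¹ * e 1 * (cast ℂ g⁻¹ * e 2) = (-(rt * Complex.I)) • (cast ℂ g⁻¹ * e 0) ∧
      cast ℂ g⁻¹ * e 2 * (cast ℂ g⁻¹ * e 1) = (rt * Complex.I) • (cast ℂ g⁻¹ * e 0)) ∧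
    (cast ℂ g⁻¹ * e 2 * (cast ℂ g⁻¹ * e 0) = (-(rt * Complex.I)) • (cast ℂ g⁻¹ * e 1) ∧
      cast ℂ g⁻¹ * e 0 * (cast ℂ g⁻¹ * e 2) = (rt * Complex.I) • (cast ℂ g⁻¹ * e 1)) :=
  ⟨⟨s.mul 0 1, s.mul 1 0⟩, ⟨s.mul 1 2, s.mul 2 1⟩, ⟨s.mul 2 0, s.mul 0 2⟩⟩

theorem anticomm_mul (s : SDTriple g η e) (i j : Fin 3) :
    cast ℂ g⁻¹ * e i * (cast ℂ g⁻¹ * e j) + cast ℂ g⁻¹ * e j * (cast ℂ g⁻¹ * e i) =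
      if i = j then 1 else 0 := by
  obtain ⟨⟨h1, h2⟩, ⟨h3, h4⟩, h5, h6⟩ := s.mul_values
  have hs : ∀ i, cast ℂ g⁻¹ * e i * (cast ℂ g⁻¹ * e i) + cast ℂ g⁻¹ * e i * (cast ℂ g⁻¹ * e i) =
      1 := fun i => by rw [s.mul_self, ← add_smul]; norm_num
  fin_cases i <;> fin_cases j <;> simp [h1, h2, h3, h4, h5, h6, hs]

/-- An antisymmetric form vanishes on the diagonal. This removes most of the terms quadratic in ξ
from the curvature. -/
theorem quadratic_eq_zero (s : SDTriple g η e) (ξ : Fin 4 → ℂ) (i : Fin 3) :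
    ξ ⬝ᵥ ((cast ℂ g⁻¹ * e i * cast ℂ g⁻¹) *ᵥ ξ) = 0 := by
  have ht : (cast ℂ g⁻¹ * e i * cast ℂ g⁻¹)ᵀ = -(cast ℂ g⁻¹ * e i * cast ℂ g⁻¹) := by
    rw [Matrix.transpose_mul, s.mul_inv_transpose, s.inv_transpose, Matrix.mul_neg,
      Matrix.mul_assoc]
  have : ξ ⬝ᵥ ((cast ℂ g⁻¹ * e i * cast ℂ g⁻¹) *ᵥ ξ) =
      -(ξ ⬝ᵥ ((cast ℂ g⁻¹ * e i * cast ℂ g⁻¹) *ᵥ ξ)) := by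
    conv_lhs => rw [dotProduct_mulVec, ← mulVec_transpose, ht, neg_mulVec, neg_dotProduct,
      dotProduct_comm]
  linear_combination (1 / 2 : ℂ) * this

end SDTriple

theorem weylForm_add (g : Tensor2 ℝ) (W W' : Tensor4 ℝ) (e : Fin 3 → Tensor2 ℂ) (j i : Fin 3) :
    weylForm g (W + W') e j i = weylForm g W e j i + weylForm g W' e j i := by
  simp only [weylForm, Pi.add_apply, Complex.ofReal_add, mul_add, Finset.sum_add_distrib]

theorem weylForm_smul (g : Tensor2 ℝ) (r : ℝ) (W : Tensor4 ℝ) (e : Fin 3 → Tensor2 ℂ)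
    (j i : Fin 3) : weylForm g (r • W) e j i = r * weylForm g W e j i := by
  simp only [weylForm, Pi.smul_apply, smul_eq_mul, Complex.ofReal_mul, Finset.mul_sum]
  refine Finset.sum_congr rfl fun a _ => Finset.sum_congr rfl fun b _ =>
    Finset.sum_congr rfl fun m _ => Finset.sum_congr rfl fun n _ => ?_
  ring

theorem sum_mul_mul_eq_trace (F E A B : Tensor2 ℂ) :
    ∑ a, ∑ b, F b a * ∑ m, ∑ n, E m n * (A a m * B b n) = (F * A * E * Bᵀ).trace := by
  have h : ∀ a b, ∑ m, ∑ n, E m n * (A a m * B b n) = (A * E * Bᵀ) a b := by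
    intro a b
    simp only [Matrix.mul_apply, Matrix.transpose_apply, Finset.sum_mul]
    rw [Finset.sum_comm]
    exact Finset.sum_congr rfl fun n _ => Finset.sum_congr rfl fun m _ => by ring
  simp only [h]
  rw [Matrix.mul_assoc F, Matrix.mul_assoc F, Matrix.trace_mul_comm]
  simp only [Matrix.trace, Matrix.diag_apply, Matrix.mul_apply (N := F)]
  exact Finset.sum_congr rfl fun a _ => Finset.sum_congr rfl fun b _ => mul_comm _ _

theorem sum_mul_mul_eq_trace' (F E A B : Tensor2 ℂ) :
    ∑ a, ∑ b, F b a * ∑ m, ∑ n, E m n * (A a n * B b m) = (F * A * Eᵀ * Bᵀ).trace := by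
  rw [← sum_mul_mul_eq_trace]
  refine Finset.sum_congr rfl fun a _ => Finset.sum_congr rfl fun b _ => ?_
  rw [Finset.sum_comm]
  rfl

/-- The Kulkarni-Nomizu product of the metric with a symmetric tensor. -/
def kulkarni (g h : Tensor2 ℝ) : Tensor4 ℝ := fun a b c d =>
  g a c * h b d + g b d * h a c - g a d * h b c - g b c * h a d

/-- The Clifford relation e_i e_j + e_j e_i = δ_ij leaves only the trace of `h`: trace-free Ricci
curvature does not act within the SD bivectors. -/
theorem weylForm_kulkarni {g h : Tensor2 ℝ} {η : Tensor4 ℝ} {e : Fin 3 → Tensor2 ℂ}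
    (s : SDTriple g η e) (hh : hᵀ = h) (j i : Fin 3) :
    weylForm g (kulkarni g h) e j i = if i = j then (cast ℂ g⁻¹ * cast ℂ h).trace else 0 := by
  have hg : (cast ℂ g)ᵀ = cast ℂ g := by rw [← cast_transpose, s.metric_transpose]
  have hh' : (cast ℂ h)ᵀ = cast ℂ h := by rw [← cast_transpose, hh]
  have hE : (cast ℂ g⁻¹ * e j * cast ℂ g⁻¹)ᵀ = -(cast ℂ g⁻¹ * e j * cast ℂ g⁻¹) := by
    rw [Matrix.transpose_mul, s.mul_inv_transpose, s.inv_transpose, Matrix.mul_neg,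
      Matrix.mul_assoc]
  set F := cast ℂ g⁻¹ * e i * cast ℂ g⁻¹ with hF
  set E := cast ℂ g⁻¹ * e j * cast ℂ g⁻¹ with hE'
  have h1 : weylForm g (kulkarni g h) e j i =
      (1 / 2) * ((F * cast ℂ g * E * (cast ℂ h)ᵀ).trace + (F * cast ℂ h * E * (cast ℂ g)ᵀ).trace -
        (F * cast ℂ g * Eᵀ * (cast ℂ h)ᵀ).trace - (F * cast ℂ h * Eᵀ * (cast ℂ g)ᵀ).trace) := by
    rw [← sum_mul_mul_eq_trace, ← sum_mul_mul_eq_trace, ← sum_mul_mul_eq_trace',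
      ← sum_mul_mul_eq_trace']
    have hk : ∀ a b m n, ((kulkarni g h a b m n : ℝ) : ℂ) =
        cast ℂ g a m * cast ℂ h b n + cast ℂ h a m * cast ℂ g b n -
          cast ℂ g a n * cast ℂ h b m - cast ℂ h a n * cast ℂ g b m := by
      intro a b m n
      rw [kulkarni, mul_comm (g b n), mul_comm (g b m)]
      push_cast
      rfl
    simp only [weylForm, ← hF, ← hE', hk, mul_add, mul_sub, Finset.sum_add_distrib,
      Finset.sum_sub_distrib]
  have h2 : (F * cast ℂ g * E * cast ℂ h).trace + (F * cast ℂ h * E * cast ℂ g).trace =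
      if i = j then (cast ℂ g⁻¹ * cast ℂ h).trace else 0 := by
    have e1 : (F * cast ℂ g * E * cast ℂ h).trace =
        (cast ℂ g⁻¹ * e i * (cast ℂ g⁻¹ * e j) * (cast ℂ g⁻¹ * cast ℂ h)).trace := by
      rw [hF, Matrix.mul_assoc _ _ (cast ℂ g), s.cast_inv_mul, Matrix.mul_one, hE']
      simp only [Matrix.mul_assoc]
    have e2 : (F * cast ℂ h * E * cast ℂ g).trace =
        (cast ℂ g⁻¹ * e j * (cast ℂ g⁻¹ * e i) * (cast ℂ g⁻¹ * cast ℂ h)).trace := by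
      rw [hE', Matrix.mul_assoc (F * _), Matrix.mul_assoc _ _ (cast ℂ g), s.cast_inv_mul,
        Matrix.mul_one, Matrix.trace_mul_comm, hF]
      simp only [Matrix.mul_assoc]
    rw [e1, e2, ← Matrix.trace_add, ← Matrix.add_mul, add_comm, s.anticomm_mul]
    by_cases hij : i = j
    · rw [if_pos hij.symm, if_pos hij, Matrix.one_mul]
    · rw [if_neg (Ne.symm hij), if_neg hij, Matrix.zero_mul, Matrix.trace_zero]
  rw [h1, hg, hh', hE]
  simp only [Matrix.mul_neg, Matrix.neg_mul, Matrix.trace_neg]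
  rw [← h2]
  ring

namespace AdaptedOn

variable {O : Set E4} {G : E4 → Tensor2 ℝ} {η : E4 → Tensor4 ℝ} {U : E4 → Tensor2 ℝ} {x : E4}

theorem weylForm_riemann (h : AdaptedOn O G η U) (hx : x ∈ O) (e : Fin 3 → Tensor2 ℂ)
    (j i : Fin 3) : weylForm (G x) (riemann G x) e j i =
      (1 / 2) * ∑ m, ∑ n, (cast ℂ (G x)⁻¹ * e j * cast ℂ (G x)⁻¹) m n *
        (cast ℂ (Curv G x m n) * (cast ℂ (G x)⁻¹ * e i)).trace := by
  have h1 : ∀ m n, (cast ℂ (Curv G x m n) * (cast ℂ (G x)⁻¹ * e i)).trace =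
      ∑ a, ∑ b, (cast ℂ (G x)⁻¹ * e i * cast ℂ (G x)⁻¹) b a * (riemann G x a b m n : ℂ) := by
    intro m n
    have : cast ℂ (G x)⁻¹ * cast ℂ (G x) = 1 := by rw [← cast_mul, h.inv_mul hx, cast_one]
    calc _ = (cast ℂ (G x * Curv G x m n) *
          (cast ℂ (G x)⁻¹ * e i * cast ℂ (G x)⁻¹)).trace := by
          rw [Matrix.trace_mul_comm, Matrix.trace_mul_comm (cast ℂ (G x * _)), cast_mul,
            Matrix.mul_assoc (cast ℂ (G x)⁻¹ * e i), ← Matrix.mul_assoc (cast ℂ (G x)⁻¹) (cast ℂ _),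
            this, Matrix.one_mul]
      _ = _ := by
          simp only [Matrix.trace, Matrix.diag_apply, Matrix.mul_apply (M := cast ℂ (G x * _)),
            riemann_eq]
          exact Finset.sum_congr rfl fun a _ => Finset.sum_congr rfl fun b _ => mul_comm _ _
  simp only [h1]
  simp only [weylForm, Finset.mul_sum]
  refine Eq.trans ?_ (sum_comm₄ (fun a b m n => (1 / 2 : ℂ) *
    ((cast ℂ (G x)⁻¹ * e j * cast ℂ (G x)⁻¹) m n *
      ((cast ℂ (G x)⁻¹ * e i * cast ℂ (G x)⁻¹) b a * (riemann G x a b m n : ℂ))))).symm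
  refine Finset.sum_congr rfl fun a _ => Finset.sum_congr rfl fun b _ =>
    Finset.sum_congr rfl fun m _ => Finset.sum_congr rfl fun n _ => ?_
  rw [mul_left_comm ((cast ℂ (G x)⁻¹ * e i * cast ℂ (G x)⁻¹) b a)]

/-- The Ricci corrections are Kulkarni-Nomizu products with g, so they shift the matrix by a scalar.
Its value is immaterial: only off-diagonal entries and differences of diagonal ones are used. -/
theorem exists_weylForm_eq (h : AdaptedOn O G η U) (hx : x ∈ O) {e : Fin 3 → Tensor2 ℂ}
    (s : SDTriple (G x) (η x) e) : ∃ r : ℂ, ∀ j i, weylForm (G x) (weyl G x) e j i =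
      weylForm (G x) (riemann G x) e j i + if i = j then r else 0 := by
  -- The product of g with itself counts each term twice, so the coefficient 1/6 becomes 1/12.
  have hw : weyl G x = riemann G x + ((-(1 / 2) : ℝ) • kulkarni (G x) (ricci G x) +
      (1 / 12 * scalarCurvature G x) • kulkarni (G x) (G x)) := by
    ext a b c d
    simp only [weyl, kulkarni, Pi.add_apply, Pi.smul_apply, smul_eq_mul]
    ring
  have hr : (ricci G x)ᵀ = ricci G x := by
    ext a b
    exact h.ricci_symm hx b a
  refine ⟨((-(1 / 2) : ℝ) : ℂ) * (cast ℂ (G x)⁻¹ * cast ℂ (ricci G x)).trace +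
    ((1 / 12 * scalarCurvature G x : ℝ) : ℂ) * (cast ℂ (G x)⁻¹ * cast ℂ (G x)).trace,
    fun j i => ?_⟩
  rw [hw, weylForm_add, weylForm_add, weylForm_smul, weylForm_smul, weylForm_kulkarni s hr,
    weylForm_kulkarni s (h.symm hx)]
  split_ifs <;> ring

/-- The Weyl tensor and the exterior derivative of `χ` of an umbilical structure. -/
theorem weylForm_umbilical (h : AdaptedOn O G η U) (hu : ∀ y ∈ O, UmbilicalAt G U y) (hx : x ∈ O)
    {Q : Tensor2 ℝ} (hQ : IsAdapted Q (G x) (η x) (U x)) {w : Fin 3 → Fin 3 → ℂ}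
    (hw : w = weylForm (G x) (weyl G x) (sdFrame Q)) {δ : Fin 3 → ℂ}
    (hδ : δ = fun j => (cast ℂ (G x)⁻¹ * extD (chi G η U) x *
      (cast ℂ (G x)⁻¹ * sdFrame Q j)).trace) :
    (∀ j i, w j i = w i j) ∧ w 0 0 + w 1 1 + w 2 2 = 0 ∧ w 1 2 = 0 ∧ w 1 1 = w 2 2 ∧
      δ 0 = 0 ∧ δ 1 = 2 * (rt * Complex.I) * w 0 2 ∧ δ 2 = -(2 * (rt * Complex.I)) * w 0 1 := by
  have s := hQ.sdTriple
  have d := h.integrabilityData hu hx hQ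
  have hW := hQ.pull_isWeylLike (h.isWeylLike hx)
  have hwm : ∀ j i, w j i = weylForm mink (pull Q⁻¹ (weyl G x)) sdStd j i := fun j i => by
    rw [hw, hQ.weylForm_eq]
  have hsymm : ∀ j i, w j i = w i j := fun j i => by
    rw [hwm, hwm, weylForm_symm hW.toIsCurvatureLike]
  have htr : w 0 0 + w 1 1 + w 2 2 = 0 := by
    rw [hwm, hwm, hwm, weylForm_trace hW]
  obtain ⟨r, hr⟩ := h.exists_weylForm_eq hx s
  set ρ := weylForm (G x) (riemann G x) (sdFrame Q) with hρ
  have hκ0 : rt * Complex.I ≠ 0 := mul_ne_zero rt_ne_zero Complex.I_ne_zero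
  obtain ⟨⟨m01, m10⟩, ⟨m12, m21⟩, m20, m02⟩ := s.mul_values
  have c1 := fun j => d.sum_curv (i := 1) (by decide) j
  have c2 := fun j => d.sum_curv (i := 2) (by decide) j
  -- The commutator of `e 0` and `e 1` is −2i/√2 times `e 2`; the other factor 2 undoes the ½ in
  -- `weylForm`.
  have b1 : ∀ j, -(rt * Complex.I) * 4 * ρ j 2 = 4 * (codiff G (sdU G η U) x ⬝ᵥ
      ((cast ℂ (G x)⁻¹ * sdFrame Q 1 * (cast ℂ (G x)⁻¹ * sdFrame Q j) *
        (cast ℂ (G x)⁻¹ * sdFrame Q 0) * cast ℂ (G x)⁻¹) *ᵥ codiff G (sdU G η U) x)) +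
      4 * (covVec G (codiff G (sdU G η U)) x * (cast ℂ (G x)⁻¹ * sdFrame Q 1 *
        (cast ℂ (G x)⁻¹ * sdFrame Q j)) * cast ℂ (G x)⁻¹).trace := by
    intro j
    rw [← c1, hρ, h.weylForm_riemann hx, m01, m10, ← sub_smul]
    simp only [mul_smul_comm, Matrix.trace_smul, smul_eq_mul, Finset.mul_sum]
    refine Finset.sum_congr rfl fun m _ => Finset.sum_congr rfl fun n _ => ?_
    ring
  have b2 : ∀ j, (rt * Complex.I) * 4 * ρ j 1 = 4 * (codiff G (sdU G η U) x ⬝ᵥ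
      ((cast ℂ (G x)⁻¹ * sdFrame Q 2 * (cast ℂ (G x)⁻¹ * sdFrame Q j) *
        (cast ℂ (G x)⁻¹ * sdFrame Q 0) * cast ℂ (G x)⁻¹) *ᵥ codiff G (sdU G η U) x)) +
      4 * (covVec G (codiff G (sdU G η U)) x * (cast ℂ (G x)⁻¹ * sdFrame Q 2 *
        (cast ℂ (G x)⁻¹ * sdFrame Q j)) * cast ℂ (G x)⁻¹).trace := by
    intro j
    rw [← c2, hρ, h.weylForm_riemann hx, m02, m20, ← sub_smul]
    simp only [mul_smul_comm, Matrix.trace_smul, smul_eq_mul, Finset.mul_sum]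
    refine Finset.sum_congr rfl fun m _ => Finset.sum_congr rfl fun n _ => ?_
    ring
  have d0 : δ 0 = _ := (congrFun hδ 0).trans (d.trace_ext_deriv 0)
  have d1 : δ 1 = _ := (congrFun hδ 1).trans (d.trace_ext_deriv 1)
  have d2 : δ 2 = _ := (congrFun hδ 2).trans (d.trace_ext_deriv 2)
  have q := s.quadratic_eq_zero (codiff G (sdU G η U) x)
  have b10 := b1 0
  have b11 := b1 1
  have b12 := b1 2
  have b20 := b2 0
  have b21 := b2 1
  have b22 := b2 2
  -- A quadratic term in ξ survives only when the triple product is scalar, that is, for e₁e₂e₀ and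
  -- e₂e₁e₀, where the signs are opposite.
  simp only [m01, m10, m12, m21, m20, m02, s.mul_self, smul_mul_assoc, mul_smul_comm,
    Matrix.one_mul, Matrix.mul_one, smul_mulVec, dotProduct_smul, q, Matrix.trace_smul, smul_eq_mul,
    mul_zero, zero_add] at b10 b11 b12 b20 b21 b22 d0 d1 d2
  have w12 : w 1 2 = ρ 1 2 := by rw [hw, hr, if_neg (by decide), add_zero]
  have w21 : w 2 1 = ρ 2 1 := by rw [hw, hr, if_neg (by decide), add_zero]
  have w01 : w 0 1 = ρ 0 1 := by rw [hw, hr, if_neg (by decide), add_zero]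
  have w02 : w 0 2 = ρ 0 2 := by rw [hw, hr, if_neg (by decide), add_zero]
  have w11 : w 1 1 = ρ 1 1 + r := by rw [hw, hr, if_pos rfl]
  have w22 : w 2 2 = ρ 2 2 + r := by rw [hw, hr, if_pos rfl]
  have hs12 := hsymm 1 2
  -- `b11` and `b22` both evaluate to the divergence of ξ and yield ρ 2 1 = −ρ 1 2; symmetry of the
  -- Weyl matrix then gives zero. The same divergence is δ 0.
  have h12 : w 1 2 = 0 := by
    refine mul_left_cancel₀ hκ0 ?_
    linear_combination (rt * Complex.I / 2) * (w12 + w21 + hs12) + (1 / 8 : ℂ) * (b22 - b11)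
  refine ⟨hsymm, htr, h12, ?_, ?_, ?_, ?_⟩
  -- In the sum of `b12` and `b21` the terms in ξ² and in ∇ξ both cancel.
  · refine mul_left_cancel₀ hκ0 ?_
    linear_combination (1 / 4 : ℂ) * (b21 + b12) + rt * Complex.I * (w11 - w22)
  · linear_combination d0 - (1 / 2 : ℂ) * b22 + 2 * (rt * Complex.I) * (h12 - hs12 - w21)
  · linear_combination d1 + (1 / 2 : ℂ) * b10 - 2 * (rt * Complex.I) * w02
  · linear_combination d2 + (1 / 2 : ℂ) * b20 + 2 * (rt * Complex.I) * w01

end AdaptedOn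

end Umbilic

/-! ### Type D read off from the Weyl matrix -/

namespace Umbilic
open Matrix Filter Topology

theorem act_comp (g : Tensor2 ℝ) (η W : Tensor4 ℝ) (F : Tensor2 ℂ) :
    act g (fun a b c d => ((comp g η W a b c d : ℝ) : ℂ)) F =
      hodge g η (act g (fun a b c d => (W a b c d : ℂ)) F) := by
  set H := cast ℂ g⁻¹ * F * (cast ℂ g⁻¹)ᵀ with hH
  have h1 : act g (fun a b c d => (W a b c d : ℂ)) F =
      (1 / 2 : ℂ) • ∑ m, ∑ n, H m n • cast ℂ (Matrix.of fun k l => W k l m n) := by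
    ext a b
    rw [act_apply, ← hH]
    simp only [Matrix.smul_apply, Matrix.sum_apply, cast_apply, Matrix.of_apply, smul_eq_mul,
      mul_comm (H _ _)]
    rfl
  ext a b
  rw [h1, map_smul, map_sum, act_apply, ← hH]
  simp only [map_sum, map_smul, ← cast_hodge, Matrix.smul_apply, Matrix.sum_apply, cast_apply,
    smul_eq_mul, mul_comm (H _ _)]
  rfl

namespace SDTriple

variable {g : Tensor2 ℝ} {η : Tensor4 ℝ} {e : Fin 3 → Tensor2 ℂ}

theorem hodge_eq (s : SDTriple g η e) (i : Fin 3) : hodge g η (e i) = Complex.I • e i := by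
  have h := s.sdPart (e i) (s.transpose i)
  simp only [s.trace_mul, ite_smul, zero_smul, Finset.sum_ite_eq, Finset.mem_univ, if_true] at h
  have h2 : Complex.I • hodge g η (e i) = -e i := by
    rw [sub_eq_iff_eq_add, two_smul, add_assoc, left_eq_add] at h
    exact (neg_eq_of_add_eq_zero_right h).symm
  have h3 := congrArg (fun A => (-Complex.I) • A) h2
  simpa [smul_smul] using h3

theorem trace_linearCombination (s : SDTriple g η e) (c : Fin 3 → ℂ) (i : Fin 3) :
    (cast ℂ g⁻¹ * Fintype.linearCombination ℂ e c * (cast ℂ g⁻¹ * e i)).trace = 2 * c i := by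
  rw [Fintype.linearCombination_apply, Matrix.mul_sum, Matrix.sum_mul, Matrix.trace_sum]
  simp only [mul_smul_comm, smul_mul_assoc, Matrix.trace_smul, s.trace_mul, smul_eq_mul, mul_ite,
    mul_zero, Finset.sum_ite_eq', Finset.mem_univ, if_true]
  ring

theorem linearCombination_injective (s : SDTriple g η e) :
    Function.Injective (Fintype.linearCombination ℂ e) := by
  intro c c' h
  ext i
  have h1 := s.trace_linearCombination c i
  rw [h, s.trace_linearCombination] at h1
  linear_combination -(1 / 2 : ℂ) * h1

theorem sdBivectors_eq (s : SDTriple g η e) :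
    sdBivectors g η = LinearMap.range (Fintype.linearCombination ℂ e) := by
  ext F
  constructor
  · rintro ⟨hF, hF'⟩
    have h := s.sdPart F hF
    rw [hF', smul_smul, Complex.I_mul_I, neg_one_smul, sub_neg_eq_add, ← two_smul ℂ] at h
    refine ⟨fun i => (1 / 2 : ℂ) * (cast ℂ g⁻¹ * F * (cast ℂ g⁻¹ * e i)).trace, ?_⟩
    rw [Fintype.linearCombination_apply]
    simp only [← smul_smul, ← Finset.smul_sum, ← h]
    rw [smul_smul]
    norm_num
  · rintro ⟨c, rfl⟩
    rw [Fintype.linearCombination_apply]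
    exact Submodule.sum_mem _ fun i _ => Submodule.smul_mem _ _ ⟨s.transpose i, s.hodge_eq i⟩

end SDTriple

theorem trace_mul_eq_sum (A B : Tensor2 ℂ) : (A * B).trace = ∑ a, ∑ b, A a b * B b a := by
  simp only [Matrix.trace, Matrix.diag_apply, Matrix.mul_apply]

/-- The `r`-eigenspace of the transpose of `w / 2`. -/
def coordEigenspace (w : Fin 3 → Fin 3 → ℂ) (r : ℂ) : Submodule ℂ (Fin 3 → ℂ) where
  carrier := {c | ∀ i, (1 / 2) * ∑ j, c j * w j i = r * c i}
  zero_mem' := by simp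
  add_mem' := by
    intro c c' hc hc' i
    simp only [Pi.add_apply, add_mul, Finset.sum_add_distrib, mul_add, hc i, hc' i]
  smul_mem' := by
    intro a c hc i
    simp only [Pi.smul_apply, smul_eq_mul, mul_assoc, ← Finset.mul_sum]
    rw [mul_left_comm, hc i, mul_left_comm]

variable {G : E4 → Tensor2 ℝ} {η : E4 → Tensor4 ℝ} {x : E4} {e : Fin 3 → Tensor2 ℂ}

/-- The self-dual Weyl tensor acts as W followed by ½(1 − i*), and `sdPart` expands the result;
hence the matrix is half of `weylForm`. -/
theorem act_sdWeyl (s : SDTriple (G x) (η x) e) (hW : IsCurvatureLike (weyl G x)) (j : Fin 3) :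
    act (G x) (sdWeyl G η x) (e j) =
      ∑ i, ((1 / 2) * weylForm (G x) (weyl G x) e j i) • e i := by
  set Y := act (G x) (fun a b c d => (weyl G x a b c d : ℂ)) (e j) with hY
  have h1 : act (G x) (sdWeyl G η x) (e j) =
      (1 / 2 : ℂ) • (Y - Complex.I • hodge (G x) (η x) Y) := by
    rw [hY, ← act_comp]
    ext a b
    simp only [Matrix.smul_apply, Matrix.sub_apply, smul_eq_mul, act_apply, sdWeyl]
    simp only [mul_sub, sub_mul, Finset.sum_sub_distrib, Finset.mul_sum]
    congr 1 <;> refine Finset.sum_congr rfl fun m _ => Finset.sum_congr rfl fun n _ => ?_ <;> ring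
  have h2 : Yᵀ = -Y := by
    ext a b
    simp only [hY, Matrix.transpose_apply, Matrix.neg_apply, act_apply]
    rw [← mul_neg, ← Finset.sum_neg_distrib]
    congr 1
    refine Finset.sum_congr rfl fun m _ => ?_
    rw [← Finset.sum_neg_distrib]
    refine Finset.sum_congr rfl fun n _ => ?_
    rw [hW.anti_left]
    push_cast
    ring
  rw [h1, s.sdPart Y h2, Finset.smul_sum]
  refine Finset.sum_congr rfl fun i _ => ?_
  rw [smul_smul]
  congr 2
  have h3 : (cast ℂ (G x)⁻¹ * Y * (cast ℂ (G x)⁻¹ * e i)).trace =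
      (Y * (cast ℂ (G x)⁻¹ * e i * cast ℂ (G x)⁻¹)).trace := by
    rw [Matrix.mul_assoc, Matrix.trace_mul_comm, Matrix.mul_assoc]
  rw [h3, trace_mul_eq_sum, weylForm, Finset.mul_sum]
  refine Finset.sum_congr rfl fun a _ => ?_
  rw [Finset.mul_sum]
  refine Finset.sum_congr rfl fun b _ => ?_
  rw [hY, act_apply, s.inv_transpose, mul_comm, mul_left_comm]
  simp only [mul_comm (Complex.ofReal _)]

theorem weylEigenspace_eq (s : SDTriple (G x) (η x) e) (hW : IsCurvatureLike (weyl G x)) (r : ℂ) :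
    weylEigenspace G η x r = (coordEigenspace (weylForm (G x) (weyl G x) e) r).map
      (Fintype.linearCombination ℂ e) := by
  have key : ∀ c, act (G x) (sdWeyl G η x) (Fintype.linearCombination ℂ e c) =
      Fintype.linearCombination ℂ e
        (fun i => (1 / 2) * ∑ j, c j * weylForm (G x) (weyl G x) e j i) := by
    intro c
    simp only [Fintype.linearCombination_apply, map_sum, map_smul, act_sdWeyl s hW,
      Finset.smul_sum, smul_smul, Finset.mul_sum, Finset.sum_smul]
    rw [Finset.sum_comm]
    exact Finset.sum_congr rfl fun i _ => Finset.sum_congr rfl fun j _ => by ring_nf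
  rw [weylEigenspace, s.sdBivectors_eq]
  ext F
  constructor
  · rintro ⟨⟨c, rfl⟩, hF⟩
    refine ⟨c, fun i => ?_, rfl⟩
    rw [SetLike.mem_coe, Module.End.mem_eigenspace_iff, key, ← map_smul] at hF
    exact congrFun (s.linearCombination_injective hF) i
  · rintro ⟨c, hc, rfl⟩
    refine ⟨⟨c, rfl⟩, ?_⟩
    rw [SetLike.mem_coe, Module.End.mem_eigenspace_iff, key, ← map_smul]
    exact congrArg _ (funext hc)

theorem finrank_weylEigenspace (s : SDTriple (G x) (η x) e) (hW : IsCurvatureLike (weyl G x))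
    (r : ℂ) : Module.finrank ℂ (weylEigenspace G η x r) =
      Module.finrank ℂ (coordEigenspace (weylForm (G x) (weyl G x) e) r) := by
  rw [weylEigenspace_eq s hW]
  exact (LinearEquiv.finrank_eq
    (Submodule.equivMapOfInjective _ s.linearCombination_injective _)).symm

theorem finrank_le_one_of_injOn {K : Submodule ℂ (Fin 3 → ℂ)} (i : Fin 3)
    (h : ∀ c ∈ K, c i = 0 → c = 0) : Module.finrank ℂ K ≤ 1 := by
  have hi : Function.Injective ((LinearMap.proj i : (Fin 3 → ℂ) →ₗ[ℂ] ℂ).domRestrict K) := by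
    rw [← LinearMap.ker_eq_bot, LinearMap.ker_eq_bot']
    rintro ⟨c, hc⟩ h0
    exact Subtype.ext (h c hc h0)
  simpa using LinearMap.finrank_le_finrank_of_injective hi

section

variable {w : Fin 3 → Fin 3 → ℂ}

/-- A two-dimensional eigenspace contains, for each coordinate, a nonzero vector where that
coordinate vanishes. If w 1 1 ≠ 2r, coordinate 0 determines the eigenvector; if w 0 1 or w 0 2 is
nonzero, coordinate 2 or 1 respectively does. -/
theorem eq_zero_of_finrank_coordEigenspace (hs : ∀ j i, w j i = w i j)
    (h12 : w 1 2 = 0) (h11 : w 1 1 = w 2 2) {r : ℂ}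
    (hr : Module.finrank ℂ (coordEigenspace w r) = 2) :
    w 0 1 = 0 ∧ w 0 2 = 0 ∧ w 1 1 = 2 * r := by
  have h21 := (hs 2 1).trans h12
  have hne : ∀ i, ¬ ∀ c ∈ coordEigenspace w r, c i = 0 → c = 0 := by
    intro i h
    have := finrank_le_one_of_injOn i h
    omega
  have hmem : ∀ c ∈ coordEigenspace w r,
      (1 / 2) * (c 0 * w 0 0 + c 1 * w 0 1 + c 2 * w 0 2) = r * c 0 ∧
      (1 / 2) * (c 0 * w 0 1 + c 1 * w 1 1) = r * c 1 ∧
      (1 / 2) * (c 0 * w 0 2 + c 2 * w 1 1) = r * c 2 := by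
    intro c hc
    have h0 := hc 0
    have h1 := hc 1
    have h2 := hc 2
    simp only [Fin.sum_univ_three, hs 1 0, hs 2 0, h12, h21, ← h11, mul_zero, add_zero] at h0 h1 h2
    exact ⟨h0, h1, h2⟩
  have hext : ∀ c : Fin 3 → ℂ, c 0 = 0 → c 1 = 0 → c 2 = 0 → c = 0 := by
    intro c h0 h1 h2
    ext i
    fin_cases i
    exacts [h0, h1, h2]
  have hd : w 1 1 = 2 * r := by
    by_contra hd
    have hd' : w 1 1 - 2 * r ≠ 0 := sub_ne_zero.mpr hd
    refine hne 0 fun c hc h0 => ?_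
    obtain ⟨-, h1, h2⟩ := hmem c hc
    refine hext c h0 (mul_left_cancel₀ hd' ?_) (mul_left_cancel₀ hd' ?_)
    · rw [h0] at h1
      linear_combination 2 * h1
    · rw [h0] at h2
      linear_combination 2 * h2
  refine ⟨?_, ?_, hd⟩
  · by_contra hb
    refine hne 2 fun c hc h2 => ?_
    obtain ⟨e0, e1, -⟩ := hmem c hc
    have h0 : c 0 = 0 := mul_left_cancel₀ hb (by rw [hd] at e1; linear_combination 2 * e1)
    refine hext c h0 (mul_left_cancel₀ hb ?_) h2
    rw [h0, h2] at e0
    linear_combination 2 * e0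
  · by_contra hb
    refine hne 1 fun c hc h1 => ?_
    obtain ⟨e0, -, e2⟩ := hmem c hc
    have h0 : c 0 = 0 := mul_left_cancel₀ hb (by rw [hd] at e2; linear_combination 2 * e2)
    refine hext c h0 h1 (mul_left_cancel₀ hb ?_)
    rw [h0, h1] at e0
    linear_combination 2 * e0

/-- Here w = diag(−2a, a, a) with a = w 1 1 ≠ 0; the halves come from the ½ in `coordEigenspace`. -/
theorem finrank_coordEigenspace (hs : ∀ j i, w j i = w i j)
    (ht : w 0 0 + w 1 1 + w 2 2 = 0) (h12 : w 1 2 = 0) (h11 : w 1 1 = w 2 2) (h01 : w 0 1 = 0)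
    (h02 : w 0 2 = 0) (hd : w 1 1 ≠ 0) :
    Module.finrank ℂ (coordEigenspace w (w 1 1 / 2)) = 2 ∧
      Module.finrank ℂ (coordEigenspace w (-2 * (w 1 1 / 2))) = 1 := by
  have h21 := (hs 2 1).trans h12
  have h10 := (hs 1 0).trans h01
  have h20 := (hs 2 0).trans h02
  have h00 : w 0 0 = -2 * w 1 1 := by linear_combination ht + h11
  have hmem : ∀ r c, c ∈ coordEigenspace w r ↔ (-w 1 1 - r) * c 0 = 0 ∧
      (w 1 1 / 2 - r) * c 1 = 0 ∧ (w 1 1 / 2 - r) * c 2 = 0 := by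
    intro r c
    have : c ∈ coordEigenspace w r ↔ ∀ i, (1 / 2) * ∑ j, c j * w j i = r * c i := Iff.rfl
    rw [this]
    simp only [Fin.forall_fin_succ, Fin.sum_univ_three]
    simp only [Fin.succ_zero_eq_one, Fin.succ_one_eq_two, IsEmpty.forall_iff, and_true, h01, h02, h10,
      h20, h12, h21, h00, ← h11, mul_zero, add_zero, zero_add]
    refine and_congr ⟨fun h => ?_, fun h => ?_⟩
      (and_congr ⟨fun h => ?_, fun h => ?_⟩ ⟨fun h => ?_, fun h => ?_⟩) <;> linear_combination h
  constructor
  · have : coordEigenspace w (w 1 1 / 2) =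
        LinearMap.ker (LinearMap.proj 0 : (Fin 3 → ℂ) →ₗ[ℂ] ℂ) := by
      ext c
      rw [hmem, LinearMap.mem_ker, LinearMap.proj_apply, sub_self, zero_mul, zero_mul,
        eq_self_iff_true, and_true, and_true, mul_eq_zero, or_iff_right]
      intro h
      exact hd (by linear_combination (-2 / 3 : ℂ) * h)
    rw [this]
    have h := LinearMap.finrank_range_add_finrank_ker
      (LinearMap.proj 0 : (Fin 3 → ℂ) →ₗ[ℂ] ℂ)
    rw [LinearMap.range_eq_top.mpr (LinearMap.proj_surjective 0), finrank_top] at h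
    simp at h
    omega
  · have : coordEigenspace w (-2 * (w 1 1 / 2)) = Submodule.span ℂ {Pi.single 0 1} := by
      ext c
      have h2 : w 1 1 / 2 - -2 * (w 1 1 / 2) ≠ 0 := fun h =>
        hd (by linear_combination (2 / 3 : ℂ) * h)
      have h0 : -w 1 1 - -2 * (w 1 1 / 2) = 0 := by ring
      rw [hmem, h0, zero_mul, mul_eq_zero, mul_eq_zero, or_iff_right h2, or_iff_right h2,
        Submodule.mem_span_singleton]
      constructor
      · rintro ⟨-, h1, h2⟩
        refine ⟨c 0, ?_⟩
        ext i
        fin_cases i <;> simp [h1, h2]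
      · rintro ⟨a, rfl⟩
        simp
    rw [this, finrank_span_singleton]
    intro h
    simpa using congrFun h 0

end

end Umbilic

/-! ### Real and imaginary parts of dχ, and type D at a point -/

namespace Umbilic
open Matrix Filter Topology

theorem contractRight_eq_neg (g : Tensor2 ℝ) (hg : g⁻¹ᵀ = g⁻¹) {A : Tensor2 ℝ} (hA : Aᵀ = -A)
    (θ : Fin 4 → ℝ) : contractRight g A θ = -(θ ᵥ* (g⁻¹ * A)) := by
  ext a
  rw [← vecMul_vecMul, ← mulVec_transpose A, hA, neg_mulVec, neg_neg]
  simp only [contractRight, mulVec, dotProduct, vecMul, Finset.mul_sum]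
  refine Finset.sum_congr rfl fun b _ => Finset.sum_congr rfl fun c _ => ?_
  rw [← congrFun (congrFun hg c) b, Matrix.transpose_apply, mul_assoc, mul_comm (θ c)]
  rfl

theorem hodge_transpose {𝕜 : Type} [RCLike 𝕜] {Q g U : Tensor2 ℝ} {η : Tensor4 ℝ}
    (hQ : IsAdapted Q g η U) (F : Tensor2 𝕜) : (hodge g η F)ᵀ = -hodge g η F := by
  ext a b
  simp only [Matrix.transpose_apply, Matrix.neg_apply, hodge, act_apply, hQ.vol_eq]
  rw [← mul_neg, ← Finset.sum_neg_distrib]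
  congr 1
  refine Finset.sum_congr rfl fun m _ => ?_
  rw [← Finset.sum_neg_distrib]
  refine Finset.sum_congr rfl fun n _ => ?_
  have : eps b a m n = -eps a b m n := by
    simp only [eps]
    ring
  rw [this]
  push_cast
  ring

/-- F − i*F is a combination of SD bivectors, so * multiplies it by i; comparing the two expressions
gives ** = −1. -/
theorem SDTriple.hodge_hodge {g : Tensor2 ℝ} {η : Tensor4 ℝ} {e : Fin 3 → Tensor2 ℂ}
    (s : SDTriple g η e) {F : Tensor2 ℂ} (hF : Fᵀ = -F) : hodge g η (hodge g η F) = -F := by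
  have h := congrArg (hodge g η) (s.sdPart F hF)
  simp only [map_sub, map_smul, map_sum, s.hodge_eq, smul_comm _ Complex.I] at h
  rw [← Finset.smul_sum, ← s.sdPart F hF, smul_sub, smul_smul, Complex.I_mul_I] at h
  have h2 : Complex.I • hodge g η (hodge g η F) = Complex.I • (-F) := by
    calc _ = hodge g η F - (hodge g η F - Complex.I • hodge g η (hodge g η F)) := by abel
      _ = _ := by
        rw [h]
        module
  exact smul_right_injective _ Complex.I_ne_zero h2

theorem cast_injective {A B : Tensor2 ℝ} (h : cast ℂ A = cast ℂ B) : A = B := by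
  ext a b
  exact Complex.ofReal_injective (congrFun (congrFun h a) b)

/-- Real and imaginary parts of complex tensors. -/
theorem cast_add_I_smul_inj {A B A' B' : Tensor2 ℝ}
    (h : cast ℂ A + Complex.I • cast ℂ B = cast ℂ A' + Complex.I • cast ℂ B') :
    A = A' ∧ B = B' := by
  have h1 : ∀ a b, (A a b : ℂ) + Complex.I * B a b = A' a b + Complex.I * B' a b := fun a b =>
    congrFun (congrFun h a) b
  constructor <;> ext a b
  · simpa using congrArg Complex.re (h1 a b)
  · simpa using congrArg Complex.im (h1 a b)

theorem eq_zero_of_entries {w : Fin 3 → Fin 3 → ℂ} (hs : ∀ j i, w j i = w i j)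
    (ht : w 0 0 + w 1 1 + w 2 2 = 0) (h12 : w 1 2 = 0) (h11 : w 1 1 = w 2 2) (h01 : w 0 1 = 0)
    (h02 : w 0 2 = 0) (hd : w 1 1 = 0) (j i : Fin 3) : w j i = 0 := by
  have h00 : w 0 0 = 0 := by linear_combination ht - 2 * hd + h11
  fin_cases j <;> fin_cases i
  exacts [h00, h01, h02, (hs 1 0).trans h01, hd, h12, (hs 2 0).trans h02, (hs 2 1).trans h12,
    h11.symm.trans hd]

namespace AdaptedOn

variable {O : Set E4} {G : E4 → Tensor2 ℝ} {η : E4 → Tensor4 ℝ} {U : E4 → Tensor2 ℝ} {x : E4}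

theorem smooth_starU (h : AdaptedOn O G η U) (hx : x ∈ O) : SmoothMat (starU G η U) x :=
  h.smooth_hodge hx (h.smooth_form x hx)

theorem smooth_contractRight (h : AdaptedOn O G η U) (hx : x ∈ O) {A : E4 → Tensor2 ℝ}
    (hA : SmoothMat A x) {θ : E4 → Fin 4 → ℝ} (hθ : ∀ b, ContDiffAt ℝ ∞ (fun y => θ y b) x)
    (a : Fin 4) : ContDiffAt ℝ ∞ (fun y => contractRight (G y) (A y) (θ y) a) x :=
  ContDiffAt.sum fun b _ => ContDiffAt.sum fun c _ =>
    ((hA a b).mul (h.smooth_inv hx b c)).mul (hθ c)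

theorem smooth_expansion (h : AdaptedOn O G η U) (hx : x ∈ O) (a : Fin 4) :
    ContDiffAt ℝ ∞ (fun y => expansion G η U y a) x :=
  (h.smooth_contractRight hx (h.smooth_starU hx) (h.smooth_codiff hx (h.smooth_starU hx)) a).sub
    (h.smooth_contractRight hx (h.smooth_form x hx) (h.smooth_codiff hx (h.smooth_form x hx)) a)

theorem smooth_rotation (h : AdaptedOn O G η U) (hx : x ∈ O) (a : Fin 4) :
    ContDiffAt ℝ ∞ (fun y => rotation G η U y a) x :=
  (h.smooth_contractRight hx (h.smooth_starU hx) (h.smooth_codiff hx (h.smooth_form x hx)) a).add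
    (h.smooth_contractRight hx (h.smooth_form x hx) (h.smooth_codiff hx (h.smooth_starU hx)) a)

theorem codiff_cast (g : E4 → Tensor2 ℝ) (F : E4 → Tensor2 ℝ) (x : E4) :
    (fun b => ((codiff g F x b : ℝ) : ℂ)) =
      fun b => -∑ a, (cast ℂ (g x)⁻¹ * cast ℂ (covMat g F x a)) a b := by
  ext b
  rw [codiff_eq]
  simp only [← cast_mul]
  push_cast
  rfl

theorem codiff_sdU (h : AdaptedOn O G η U) (hx : x ∈ O) : codiff G (sdU G η U) x =
    rt • ((fun b => ((codiff G U x b : ℝ) : ℂ)) -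
      Complex.I • fun b => ((codiff G (starU G η U) x b : ℝ) : ℂ)) := by
  have hs : ∀ a, covMat G (starU G η U) x a = hodge (G x) (η x) (covMat G U x a) := fun a =>
    h.covMat_hodge hx (h.smooth_form x hx) a
  rw [codiff_cast, codiff_cast]
  ext b
  rw [codiff_eq]
  simp only [h.covMat_sdU_eq hx, hs, cast_hodge, mul_smul_comm, Matrix.sub_apply,
    Matrix.smul_apply, Pi.smul_apply, Pi.sub_apply, smul_eq_mul, Finset.mul_sum,
    Finset.sum_sub_distrib, mul_sub, mul_neg]
  ring

/-- The two factors 1/√2 give ½; the signs come from passing between left and right contraction with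
antisymmetric forms. -/
theorem chi_eq (h : AdaptedOn O G η U) (hx : x ∈ O) (b : Fin 4) : chi G η U x b =
    (1 / 2) * ((expansion G η U x b : ℂ) + Complex.I * (rotation G η U x b : ℂ)) := by
  obtain ⟨Q, hQ⟩ := h.exists_frame x hx
  have hv : ∀ (θ : Fin 4 → ℝ) (A : Tensor2 ℝ) b,
      ((fun b => (θ b : ℂ)) ᵥ* cast ℂ A) b = (((θ ᵥ* A) b : ℝ) : ℂ) := by
    intro θ A b
    simp only [vecMul, dotProduct]
    push_cast
    rfl
  have hU := hQ.form_transpose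
  have hS : (starU G η U x)ᵀ = -starU G η U x := hodge_transpose hQ (U x)
  have hsd : sdU G η U x = rt • (cast ℂ (U x) - Complex.I • cast ℂ (starU G η U x)) := by
    rw [sdU_eq, starU, cast_hodge]
  simp only [expansion, rotation, contractRight_eq_neg _ hQ.inv_metric_transpose hU,
    contractRight_eq_neg _ hQ.inv_metric_transpose hS]
  rw [chi, contractLeft_eq, h.codiff_sdU hx, hsd]
  simp only [Matrix.mul_sub, mul_smul_comm, vecMul_sub, vecMul_smul, sub_vecMul, smul_vecMul,
    ← cast_mul, Pi.sub_apply, Pi.smul_apply, Pi.add_apply, Pi.neg_apply, hv, smul_eq_mul]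
  push_cast
  set p := (((codiff G U x ᵥ* ((G x)⁻¹ * U x)) b : ℝ) : ℂ)
  set q := (((codiff G (starU G η U) x ᵥ* ((G x)⁻¹ * starU G η U x)) b : ℝ) : ℂ)
  set r := (((codiff G U x ᵥ* ((G x)⁻¹ * starU G η U x)) b : ℝ) : ℂ)
  set t := (((codiff G (starU G η U) x ᵥ* ((G x)⁻¹ * U x)) b : ℝ) : ℂ)
  linear_combination (p - Complex.I * r - Complex.I * t + Complex.I * Complex.I * q) * rt_mul_rt +
    (1 / 2) * q * Complex.I_mul_I

theorem extD_chi (h : AdaptedOn O G η U) (hx : x ∈ O) : extD (chi G η U) x =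
    (1 / 2 : ℂ) • (cast ℂ (extD (expansion G η U) x) +
      Complex.I • cast ℂ (extD (rotation G η U) x)) := by
  have hp : ∀ k m, pd (fun y => chi G η U y m) x k = (1 / 2) *
      (((pd (fun y => expansion G η U y m) x k : ℝ) : ℂ) +
        Complex.I * ((pd (fun y => rotation G η U y m) x k : ℝ) : ℂ)) := by
    intro k m
    have h1 := contDiffAt_ofReal (𝕜 := ℂ) (h.smooth_expansion hx m)
    have h2 := contDiffAt_ofReal (𝕜 := ℂ) (h.smooth_rotation hx m)
    rw [pd_congr (h.eventually hx fun y hy => h.chi_eq hy m) k]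
    refine (pd_const_mul _ (h1.add (contDiffAt_const.mul h2)) k).trans ?_
    rw [pd_add h1 (contDiffAt_const.mul h2), pd_const_mul _ h2,
      pd_ofReal (h.smooth_expansion hx m), pd_ofReal (h.smooth_rotation hx m)]
    rfl
  ext k m
  simp only [extD, Matrix.of_apply, hp]
  change _ = (1 / 2 : ℂ) * (((pd (fun y => expansion G η U y m) x k -
    pd (fun y => expansion G η U y k) x m : ℝ) : ℂ) + Complex.I *
      ((pd (fun y => rotation G η U y m) x k - pd (fun y => rotation G η U y k) x m : ℝ) : ℂ))
  push_cast
  ring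

theorem extD_transpose {𝕜 : Type} [RCLike 𝕜] (θ : E4 → Fin 4 → 𝕜) (x : E4) :
    (extD θ x)ᵀ = -extD θ x := by
  ext k m
  simp [extD]

theorem extD_chi_eq_zero_iff (h : AdaptedOn O G η U) (hx : x ∈ O) : extD (chi G η U) x = 0 ↔
    extD (expansion G η U) x = 0 ∧ extD (rotation G η U) x = 0 := by
  rw [h.extD_chi hx, smul_eq_zero_iff_right (by norm_num)]
  constructor
  · intro h0
    refine cast_add_I_smul_inj (A' := 0) (B' := 0) (h0.trans ?_)
    ext a b
    simp
  · rintro ⟨h1, h2⟩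
    rw [h1, h2]
    ext a b
    simp

theorem hodge_hodge (h : AdaptedOn O G η U) (hx : x ∈ O) {F : Tensor2 ℝ} (hF : Fᵀ = -F) :
    hodge (G x) (η x) (hodge (G x) (η x) F) = -F := by
  obtain ⟨Q, hQ⟩ := h.exists_frame x hx
  refine cast_injective ?_
  rw [cast_hodge, cast_hodge, hQ.sdTriple.hodge_hodge (by rw [← cast_transpose, hF, cast_neg]),
    cast_neg]

theorem hodge_extD_chi (h : AdaptedOn O G η U) (hx : x ∈ O) :
    hodge (G x) (η x) (extD (chi G η U) x) = (1 / 2 : ℂ) •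
      (cast ℂ (hodge (G x) (η x) (extD (expansion G η U) x)) +
        Complex.I • cast ℂ (hodge (G x) (η x) (extD (rotation G η U) x))) := by
  rw [h.extD_chi hx, map_smul, map_add, map_smul, cast_hodge, cast_hodge]

/-- Real and imaginary parts yield two equations that are dual to each other, equivalent because **
= −1. -/
theorem selfDual_extD_chi_iff (h : AdaptedOn O G η U) (hx : x ∈ O) :
    hodge (G x) (η x) (extD (chi G η U) x) = Complex.I • extD (chi G η U) x ↔
      extD (expansion G η U) x = hodge (G x) (η x) (extD (rotation G η U) x) := by
  set A := extD (expansion G η U) x with hA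
  set B := extD (rotation G η U) x with hB
  have hBt : Bᵀ = -B := extD_transpose _ _
  have e : Complex.I • extD (chi G η U) x =
      (1 / 2 : ℂ) • (cast ℂ (-B) + Complex.I • cast ℂ A) := by
    rw [h.extD_chi hx, ← hA, ← hB, smul_comm, smul_add, smul_smul, Complex.I_mul_I, cast_neg,
      neg_one_smul, add_comm]
  rw [e, h.hodge_extD_chi hx, ← hA, ← hB]
  constructor
  · intro h0
    exact (cast_add_I_smul_inj (smul_right_injective _ (by norm_num) h0)).2.symm
  · intro h0
    rw [h0, h.hodge_hodge hx hBt]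

theorem antiselfDual_extD_chi_iff (h : AdaptedOn O G η U) (hx : x ∈ O) :
    extD (chi G η U) x - Complex.I • hodge (G x) (η x) (extD (chi G η U) x) = 0 ↔
      extD (expansion G η U) x = -hodge (G x) (η x) (extD (rotation G η U) x) := by
  set A := extD (expansion G η U) x with hA
  set B := extD (rotation G η U) x with hB
  have hBt : Bᵀ = -B := extD_transpose _ _
  have e : Complex.I • hodge (G x) (η x) (extD (chi G η U) x) = (1 / 2 : ℂ) •
      (cast ℂ (-hodge (G x) (η x) B) + Complex.I • cast ℂ (hodge (G x) (η x) A)) := by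
    rw [h.hodge_extD_chi hx, ← hA, ← hB, smul_comm, smul_add, smul_smul, Complex.I_mul_I, cast_neg,
      neg_one_smul, add_comm]
  rw [e, sub_eq_zero, h.extD_chi hx, ← hA, ← hB]
  constructor
  · intro h0
    exact (cast_add_I_smul_inj (smul_right_injective _ (by norm_num) h0)).1
  · intro h0
    rw [h0, map_neg, h.hodge_hodge hx hBt, neg_neg]

/-- Type D, for an umbilical structure, in terms of the exterior derivatives of the expansion and
rotation 1-forms. -/
theorem typeD_iff (h : AdaptedOn O G η U) (hu : ∀ y ∈ O, UmbilicalAt G U y) (hx : x ∈ O)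
    (hW : weyl G x ≠ 0) :
    (TypeDAt G η x ↔
      extD (expansion G η U) x = -hodge (G x) (η x) (extD (rotation G η U) x)) ∧
    (TypeDAt G η x ↔ TypeDPrincipalAt G η U x) ∧
    (anticomm (G x) (extD (chi G η U) x) (sdU G η U x) = 0 ↔
      extD (expansion G η U) x = hodge (G x) (η x) (extD (rotation G η U) x)) := by
  obtain ⟨Q, hQ⟩ := h.exists_frame x hx
  have s := hQ.sdTriple
  have hWl := h.isWeylLike hx
  have e0 : sdU G η U x = sdFrame Q 0 := hQ.selfDualPart_eq
  obtain ⟨hs, ht, h12, h11, d0, d1, d2⟩ := h.weylForm_umbilical hu hx hQ rfl rfl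
  set w := weylForm (G x) (weyl G x) (sdFrame Q) with hw
  have hκ0 : 2 * (rt * Complex.I) ≠ 0 :=
    mul_ne_zero two_ne_zero (mul_ne_zero rt_ne_zero Complex.I_ne_zero)
  have hDt : (extD (chi G η U) x)ᵀ = -extD (chi G η U) x := extD_transpose _ _
  have hfwd : TypeDAt G η x → w 0 1 = 0 ∧ w 0 2 = 0 := by
    rintro ⟨r, -, h2, -⟩
    rw [finrank_weylEigenspace s hWl.toIsCurvatureLike] at h2
    obtain ⟨h01, h02, -⟩ := eq_zero_of_finrank_coordEigenspace hs h12 h11 h2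
    exact ⟨h01, h02⟩
  have hbwd : w 0 1 = 0 ∧ w 0 2 = 0 → TypeDPrincipalAt G η U x := by
    rintro ⟨h01, h02⟩
    -- Otherwise the whole matrix vanishes, hence the Weyl tensor, against `hW`.
    have hd : w 1 1 ≠ 0 := by
      intro hd
      have hwz := eq_zero_of_entries hs ht h12 h11 h01 h02 hd
      have hp : pull Q⁻¹ (weyl G x) = 0 := by
        refine eq_zero_of_weylForm (hQ.pull_isWeylLike hWl) fun j i => ?_
        rw [← hQ.weylForm_eq]
        exact hwz j i
      refine hW (eq_zero_of_pull ?_ hp)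
      exact (Matrix.isUnit_nonsing_inv_det_iff).mpr hQ.det_ne
    obtain ⟨f2, f1⟩ := finrank_coordEigenspace hs ht h12 h11 h01 h02 hd
    refine ⟨w 1 1 / 2, ⟨div_ne_zero hd two_ne_zero, ?_, ?_⟩, ?_⟩
    · rw [finrank_weylEigenspace s hWl.toIsCurvatureLike, f2]
    · rw [finrank_weylEigenspace s hWl.toIsCurvatureLike, f1]
    · refine ⟨?_, ?_⟩
      · rw [e0]
        exact ⟨s.transpose 0, s.hodge_eq 0⟩
      · rw [SetLike.mem_coe, Module.End.mem_eigenspace_iff, e0, act_sdWeyl s hWl.toIsCurvatureLike,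
          Fin.sum_univ_three, ← hw, h01, h02]
        have h00 : w 0 0 = -2 * w 1 1 := by linear_combination ht + h11
        rw [h00]
        simp only [mul_zero, zero_smul, add_zero]
        congr 1
        ring
  have hprin : TypeDPrincipalAt G η U x → TypeDAt G η x := fun ⟨r, hr, _⟩ => ⟨r, hr⟩
  refine ⟨?_, ⟨fun h1 => hbwd (hfwd h1), hprin⟩, ?_⟩
  -- The coefficients of the SD part of dχ are those computed in `d0`, `d1`, `d2`; they vanish
  -- together exactly when w 0 1 and w 0 2 do.
  · rw [← h.antiselfDual_extD_chi_iff hx, s.sdPart _ hDt]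
    refine Iff.trans ⟨hfwd, fun h1 => hprin (hbwd h1)⟩ ?_
    constructor
    · rintro ⟨h01, h02⟩
      rw [Fin.sum_univ_three, d0, d1, d2, h01, h02]
      simp
    · intro h0
      have h1 : Fintype.linearCombination ℂ (sdFrame Q) (fun i => (cast ℂ (G x)⁻¹ *
          extD (chi G η U) x * (cast ℂ (G x)⁻¹ * sdFrame Q i)).trace) =
          Fintype.linearCombination ℂ (sdFrame Q) 0 := by
        rw [map_zero, Fintype.linearCombination_apply, h0]
      have h2 := s.linearCombination_injective h1
      have z1 := (congrFun h2 1).symm.trans d1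
      have z2 := (congrFun h2 2).symm.trans d2
      refine ⟨mul_left_cancel₀ (neg_ne_zero.mpr hκ0) ?_, mul_left_cancel₀ hκ0 ?_⟩
      · rw [mul_zero]; exact z2.symm
      · rw [mul_zero]; exact z1.symm
  -- `d0` supplies the absence of a component of dχ along 𝒰.
  · rw [e0, s.anticomm_iff _ hDt d0, h.selfDual_extD_chi_iff hx]

end AdaptedOn

end Umbilic

/-! ### From the manifold to charts -/

namespace Umbilic
open Matrix Filter Topology

theorem flip_conj : (Matrix.diagonal ![1, 1, 1, -1] : Tensor2 ℝ) * mink *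
    Matrix.diagonal ![1, 1, 1, -1] = mink := by
  ext i j; fin_cases i <;> fin_cases j <;> simp [mink, Matrix.mul_apply, Fin.sum_univ_four]

theorem flip_conj_form : (Matrix.diagonal ![1, 1, 1, -1] : Tensor2 ℝ) * stdForm *
    Matrix.diagonal ![1, 1, 1, -1] = stdForm := by
  ext i j; fin_cases i <;> fin_cases j <;> simp [stdForm, Matrix.mul_apply, Fin.sum_univ_four]

theorem det_flip : (Matrix.diagonal ![1, 1, 1, -1] : Tensor2 ℝ).det = -1 := by
  simp [Matrix.det_diagonal, Fin.prod_univ_four]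

/-- A frame adapted up to orientation can be made adapted. -/
theorem exists_isAdapted {Q g U : Tensor2 ℝ} {η : Tensor4 ℝ} (hQ : IsUnit Q.det)
    (hg : g = Qᵀ * mink * Q) (hU : U = Qᵀ * stdForm * Q) {σ : ℝ} (hσ : σ = 1 ∨ σ = -1)
    (hη : ∀ a b c d, η a b c d = σ * (Q.submatrix id ![a, b, c, d]).det) :
    ∃ Q', IsAdapted Q' g η U := by
  rcases hσ with rfl | rfl
  · exact ⟨Q, hQ, hg, hU, fun a b c d => by rw [hη, one_mul]⟩
  -- Reversing the last frame vector, which lies in the space-like plane, changes the orientation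
  -- but neither g nor U.
  · refine ⟨Matrix.diagonal ![1, 1, 1, -1] * Q, ?_, ?_, ?_, fun a b c d => ?_⟩
    · rw [Matrix.det_mul, det_flip]
      exact isUnit_one.neg.mul hQ
    · rw [Matrix.transpose_mul, Matrix.diagonal_transpose, hg]
      conv_lhs => rw [← flip_conj]
      simp only [Matrix.mul_assoc]
    · rw [Matrix.transpose_mul, Matrix.diagonal_transpose, hU]
      conv_lhs => rw [← flip_conj_form]
      simp only [Matrix.mul_assoc]
    · have : (Matrix.diagonal ![1, 1, 1, -1] * Q).submatrix id ![a, b, c, d] =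
          Matrix.diagonal ![1, 1, 1, -1] * Q.submatrix id ![a, b, c, d] := by
        ext i j
        simp [Matrix.diagonal_mul]
      rw [this, Matrix.det_mul, det_flip, hη]

theorem IsLorentzFrame.apply {V : Type*} [AddCommGroup V] [Module ℝ V] {g : LinearMap.BilinForm ℝ V}
    {b : Module.Basis (Fin 4) ℝ V} (hb : IsLorentzFrame g b) (v w : V) :
    g v w = ∑ i, ∑ j, b.repr v i * mink i j * b.repr w j := by
  conv_lhs => rw [← b.sum_repr v, ← b.sum_repr w]
  have hm : ∀ i j, g (b i) (b j) = mink i j := by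
    intro i j
    rw [hb]
    fin_cases i <;> fin_cases j <;> simp [mink]
  simp only [map_sum, map_smul, LinearMap.sum_apply, LinearMap.smul_apply, smul_eq_mul, hm,
    Finset.mul_sum]
  rw [Finset.sum_comm]
  exact Finset.sum_congr rfl fun i _ => Finset.sum_congr rfl fun j _ => by ring

section Manifold

variable {M : Type*} [TopologicalSpace M] [ChartedSpace E4 M] [IsManifold I4 ∞ M]

/-- The coordinate vectors form a basis of the tangent space. -/
theorem exists_basis_coordVec {e : OpenPartialHomeomorph M E4} (he : e ∈ atlas E4 M) {x : E4}
    (hx : x ∈ e.target) : ∃ b : Module.Basis (Fin 4) ℝ (TangentSpace I4 (e.symm x)),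
      ∀ i, b i = coordVec e x i := by
  have : IsManifold I4 1 M := IsManifold.of_le (n := ∞) (by exact_mod_cast le_top)
  have hd : e.MDifferentiable I4 I4 := mdifferentiable_of_mem_atlas he
  let L : E4 ≃L[ℝ] TangentSpace I4 (e.symm x) := hd.symm.mfderiv hx
  refine ⟨((EuclideanSpace.basisFun (Fin 4) ℝ).toBasis).map L.toLinearEquiv, fun i => ?_⟩
  rw [Module.Basis.map_apply, OrthonormalBasis.coe_toBasis, EuclideanSpace.basisFun_apply]
  rfl

theorem adaptedOn (S : OrientedSpacetime M) (U : Structure22 S)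
    {e : OpenPartialHomeomorph M E4} (he : e ∈ atlas E4 M) :
    AdaptedOn e.target (S.G e) (S.η e) (U.comps e) where
  isOpen := e.open_target
  smooth_metric x hx a b := (S.smooth_metric e he a b).contDiffAt (e.open_target.mem_nhds hx)
  smooth_form x hx a b := (U.smooth_form e he a b).contDiffAt (e.open_target.mem_nhds hx)
  smooth_vol x hx a b c d := (S.smooth_vol e he a b c d).contDiffAt (e.open_target.mem_nhds hx)
  exists_frame x hx := by
    obtain ⟨b, hb, hf⟩ := U.exists_frame (e.symm x)
    obtain ⟨b', hb'⟩ := exists_basis_coordVec he hx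
    have hQ : ∀ A i, b.toMatrix b' A i = b.repr (coordVec e x i) A := fun A i => by
      rw [Module.Basis.toMatrix_apply, hb']
    refine exists_isAdapted (Q := b.toMatrix b') ?_ ?_ ?_ (S.vol_frame _ b hb)
      fun i j k l => ?_
    · exact Matrix.isUnit_det_of_right_inverse (b.toMatrix_mul_toMatrix_flip b')
    · ext i j
      simp only [OrientedSpacetime.G, Matrix.of_apply, hb.apply, Matrix.mul_apply,
        Matrix.transpose_apply, hQ, Finset.sum_mul]
      rw [Finset.sum_comm]
    · ext i j
      simp only [Structure22.comps, Matrix.of_apply, hf, Matrix.mul_apply, Matrix.transpose_apply,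
        hQ, Fin.sum_univ_four]
      simp [stdForm]
      ring
    -- A 4-form on a four-dimensional space is a multiple of the determinant in the frame;
    -- `vol_frame` makes the factor ±1.
    · have hv : ∀ v, S.vol (e.symm x) v = S.vol (e.symm x) b * b.det v := fun v =>
        congrArg (fun f => f v) (AlternatingMap.eq_smul_basis_det b (S.vol (e.symm x)))
      rw [OrientedSpacetime.η, hv, Module.Basis.det_apply]
      congr 2
      ext A B
      rw [Matrix.submatrix_apply, hQ, Module.Basis.toMatrix_apply]
      fin_cases B <;> rfl

end Manifold

end Umbilic

/-! ### The four conditions as relations between dΦ and dΨ -/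

namespace Umbilic
open Matrix Filter Topology

variable {M : Type*} [TopologicalSpace M] [ChartedSpace E4 M] [IsManifold I4 ∞ M]
  {S : OrientedSpacetime M} {U : Structure22 S}

theorem typeD_iff (hW : S.NonConformallyFlat) (hU : U.Umbilical) : S.TypeD ↔
    ∀ e ∈ atlas E4 M, ∀ x ∈ e.target, extD (expansion (S.G e) (S.η e) (U.comps e)) x =
      -hodge (S.G e x) (S.η e x) (extD (rotation (S.G e) (S.η e) (U.comps e)) x) :=
  forall₂_congr fun e he => forall₂_congr fun x hx =>
    ((adaptedOn S U he).typeD_iff (hU e he) hx (hW e he x hx)).1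

theorem typeD_iff_principal (hW : S.NonConformallyFlat) (hU : U.Umbilical) :
    S.TypeD ↔ U.TypeDPrincipal :=
  forall₂_congr fun e he => forall₂_congr fun x hx =>
    ((adaptedOn S U he).typeD_iff (hU e he) hx (hW e he x hx)).2.1

theorem anticommVanishes_iff (hW : S.NonConformallyFlat) (hU : U.Umbilical) :
    U.AnticommVanishes ↔ U.ExpansionDualRotation :=
  forall₂_congr fun e he => forall₂_congr fun x hx =>
    ((adaptedOn S U he).typeD_iff (hU e he) hx (hW e he x hx)).2.2

theorem maxwellian_iff : U.Maxwellian ↔ U.PreMaxwellian ∧ U.RotationClosed := by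
  have h : ∀ e (he : e ∈ atlas E4 M), ∀ x ∈ e.target, _ := fun e he x hx =>
    (adaptedOn S U he).extD_chi_eq_zero_iff hx
  exact ⟨fun hm => ⟨fun e he x hx => ((h e he x hx).1 (hm e he x hx)).1,
    fun e he x hx => ((h e he x hx).1 (hm e he x hx)).2⟩,
    fun hm e he x hx => (h e he x hx).2 ⟨hm.1 e he x hx, hm.2 e he x hx⟩⟩

theorem conditions_of_maxwellian (hW : S.NonConformallyFlat) (hU : U.Umbilical)
    (hm : U.Maxwellian) (k : Fin 4) : U.conditions k := by
  obtain ⟨h2, h3⟩ := maxwellian_iff.1 hm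
  fin_cases k
  · exact (typeD_iff hW hU).2 fun e he x hx => by
      rw [h2 e he x hx, h3 e he x hx, map_zero, neg_zero]
  · exact h2
  · exact h3
  · exact (anticommVanishes_iff hW hU).2 fun e he x hx => by
      rw [h2 e he x hx, h3 e he x hx, map_zero]

theorem rotationClosed_of_hodge_eq_zero (h : ∀ e ∈ atlas E4 M, ∀ x ∈ e.target,
    hodge (S.G e x) (S.η e x) (extD (rotation (S.G e) (S.η e) (U.comps e)) x) = 0) :
    U.RotationClosed := fun e he x hx => by
  have h1 := (adaptedOn S U he).hodge_hodge hx
    (AdaptedOn.extD_transpose (rotation (S.G e) (S.η e) (U.comps e)) x)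
  rwa [h e he x hx, map_zero, eq_comm, neg_eq_zero] at h1

/-- Conditions 1 and 4 read dΦ = ∓ *dΨ, conditions 2 and 3 read dΦ = 0 and dΨ = 0; any two leave
only zero, as * is injective on 2-forms. -/
theorem maxwellian_of_conditions (hW : S.NonConformallyFlat) (hU : U.Umbilical) {i j : Fin 4}
    (hij : i < j) (hi : U.conditions i) (hj : U.conditions j) : U.Maxwellian := by
  have c1 := (typeD_iff (S := S) hW hU).1
  have c4 := (anticommVanishes_iff hW hU).1
  rw [maxwellian_iff]
  -- Six pairs remain, in the order (0,1), (0,2), (0,3), (1,2), (1,3), (2,3).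
  fin_cases i <;> fin_cases j <;> first | exact absurd hij (by decide) | skip
  · refine ⟨hj, rotationClosed_of_hodge_eq_zero fun e he x hx => ?_⟩
    have h1 := c1 hi e he x hx
    rwa [hj e he x hx, eq_comm, neg_eq_zero] at h1
  · refine ⟨fun e he x hx => ?_, hj⟩
    rw [c1 hi e he x hx, hj e he x hx, map_zero, neg_zero]
  -- Conditions 1 and 4 together make dΦ its own negative.
  · have h0 : U.PreMaxwellian := fun e he x hx => by
      have h1 := c1 hi e he x hx
      rw [← c4 hj e he x hx] at h1
      ext a b
      have h2 := congrFun (congrFun h1 a) b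
      rw [Matrix.neg_apply] at h2
      exact self_eq_neg.1 h2
    refine ⟨h0, rotationClosed_of_hodge_eq_zero fun e he x hx => ?_⟩
    rw [← c4 hj e he x hx, h0 e he x hx]
  · exact ⟨hi, hj⟩
  · refine ⟨hi, rotationClosed_of_hodge_eq_zero fun e he x hx => ?_⟩
    rw [← c4 hj e he x hx, hi e he x hx]
  · refine ⟨fun e he x hx => ?_, hi⟩
    rw [c4 hj e he x hx, hi e he x hx, map_zero]

end Umbilic

end

theorem mainTheorem6 {M : Type*} [TopologicalSpace M] [ChartedSpace Umbilic.E4 M]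
    [IsManifold Umbilic.I4 ∞ M] (S : Umbilic.OrientedSpacetime M)
    (hW : S.NonConformallyFlat) (U : Umbilic.Structure22 S) (hU : U.Umbilical) :
    (U.Maxwellian ↔ ∃ i j, i ≠ j ∧ U.conditions i ∧ U.conditions j) ∧
    ((∃ i j, i ≠ j ∧ U.conditions i ∧ U.conditions j) → ∀ k, U.conditions k) ∧
    (S.TypeD ↔ U.TypeDPrincipal) ∧
    (U.AnticommVanishes ↔ U.ExpansionDualRotation) := by
  have h1 : (∃ i j, i ≠ j ∧ U.conditions i ∧ U.conditions j) → U.Maxwellian := by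
    rintro ⟨i, j, hij, hi, hj⟩
    rcases lt_or_gt_of_ne hij with h | h
    · exact Umbilic.maxwellian_of_conditions hW hU h hi hj
    · exact Umbilic.maxwellian_of_conditions hW hU h hj hi
  have h2 := Umbilic.conditions_of_maxwellian hW hU
  exact ⟨⟨fun h => ⟨0, 1, by decide, h2 h 0, h2 h 1⟩, h1⟩, fun h => h2 (h1 h),
    Umbilic.typeD_iff_principal hW hU, Umbilic.anticommVanishes_iff hW hU⟩
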